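/- Let $d\in\{2,3\}$ and $s>0$. On $\mathbb R^{d+1}=\mathbb R^d\times\mathbb R$ let $\sigma_s^{\pm}$ be the measure carried by the sheet $\mathbb H^{d,\pm}_s=\{(y,\pm\sqrt{s^2+|y|^2}):y\in\mathbb R^d\}$ that is given by $$\int g\,d\sigma_s^{\pm}=\int_{\mathbb R^d} g\bigl(y,\pm\sqrt{s^2+|y|^2}\bigr)\frac{dy}{\sqrt{s^2+|y|^2}},$$ and let $\bar\sigma_s=\sigma_s^++\sigma_s^-$ be the corresponding measure on the two-sheeted hyperboloid $\bar{\mathbb H}^d_s=\mathbb H^{d,+}_s\cup\mathbb H^{d,-}_s$. All functions are complex-valued. For $\mu\in\{\sigma_s^+,\sigma_s^-,\bar\sigma_s\}$ and $f\in L^2(\mu)$ let $T_\mu f(z)=\int e^{iz\cdot\zeta}f(\zeta)\,d\mu(\zeta)$, $z\in\mathbb R^{d+1}$, that is, the reflected Fourier transform of the tempered distribution $f\mu$. Let $\|T_\mu f\|_{4}$ be the $L^4(\mathbb R^{d+1})$ norm of $T_\mu f$ (it is $\infty$ if $T_\mu f$ is not represented by an $L^4$ function). Write $$C(\mu)=\sup_{0\ne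 f\in L^2(\mu)}\frac{\|T_\mu f\|_{4}}{\|f\|_{L^2(\mu)}}.$$ An extremizer for $\mu$ is an $f\in L^2(\mu)$, $f\ne0$, with $\|T_\mu f\|_4=C(\mu)\|f\|_{L^2(\mu)}$. An extremizing sequence for $\mu$ is a sequence $(f_n)$ in $L^2(\mu)$ with $\|f_n\|_{L^2(\mu)}\le1$ for all $n$ and $\|T_\mu f_n\|_4\to C(\mu)$. Write $T_s,T_s^-,\bar T_s$ for $T_{\sigma_s^+},T_{\sigma_s^-},T_{\bar\sigma_s}$, write $\mathbf H_{d,4,s}=C(\sigma_s^+)$ and $\bar{\mathbf H}_{d,4,s}=C(\bar\sigma_s)$, and for $f\in L^2(\bar\sigma_s)$ let $f_\pm\in L^2(\sigma_s^\pm)$ be the restrictions of $f$ to the two sheets, so that $\bar T_sf=T_sf_++T_s^-f_-$. Then $\mathbf H_{d,4,s}<\infty$, $C(\sigma_s^-)=\mathbf H_{d,4,s}$, and the following hold. 1. For every $f\in L^2(\bar\sigma_s)$, $$\|\bar T_sf\|_4^4\le\tfrac32\,\mathbf H_{d,4,s}^4\,\|f\|_{L^2(\bar\sigma_s)}^4.$$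 2. If $f\ne0$ and equality holds in 1, then $f_+$ is an extremizer for $\sigma_s^+$ and $f_-$ is an extremizer for $\sigma_s^-$; in particular $\|T_sf_+\|_4=\mathbf H_{d,4,s}\|f_+\|_{L^2(\sigma_s^+)}$ and $\|T_s^-f_-\|_4=\mathbf H_{d,4,s}\|f_-\|_{L^2(\sigma_s^-)}$. 3. If $(f_n)$ is an extremizing sequence for $\bar\sigma_s$, then $f_{n,+}\ne0$ and $f_{n,-}\ne0$ for all sufficiently large $n$, and $\bigl(f_{n,+}/\|f_{n,+}\|_2\bigr)_n$ and $\bigl(f_{n,-}/\|f_{n,-}\|_2\bigr)_n$ are extremizing sequences for $\sigma_s^+$ and $\sigma_s^-$ respectively (a term with zero denominator is read as $0$). 4. $\bar{\mathbf H}_{d,4,s}=(3/2)^{1/4}\,\mathbf H_{d,4,s}$. 5. There is no extremizer for $\bar\sigma_s$. -/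

import Mathlib

open MeasureTheory Filter Topology SchwartzMap FourierTransform
open scoped ENNReal

noncomputable section

namespace Hyperboloid

/-- Euclidean space-time `ℝ^d × ℝ ≅ ℝ^(d+1)`, with points `(y, y')`, the Euclidean inner product and
Lebesgue measure. -/
abbrev Spacetime (d : ℕ) : Type := WithLp 2 (EuclideanSpace ℝ (Fin d) × ℝ)

/-- `ψ_s(y) = √(s² + |y|²)`. -/
def psi (d : ℕ) (s : ℝ) (y : EuclideanSpace ℝ (Fin d)) : ℝ := Real.sqrt (s ^ 2 + ‖y‖ ^ 2)

/-- The measure `dy / √(s² + |y|²)` on `ℝ^d`. -/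
def baseMeasure (d : ℕ) (s : ℝ) : Measure (EuclideanSpace ℝ (Fin d)) :=
  volume.withDensity fun y => ENNReal.ofReal (1 / psi d s y)

/-- Parametrization `y ↦ (y, √(s² + |y|²))` of the upper sheet. -/
def upperMap (d : ℕ) (s : ℝ) (y : EuclideanSpace ℝ (Fin d)) : Spacetime d :=
  WithLp.toLp 2 (y, psi d s y)

/-- Parametrization `y ↦ (y, -√(s² + |y|²))` of the lower sheet. -/
def lowerMap (d : ℕ) (s : ℝ) (y : EuclideanSpace ℝ (Fin d)) : Spacetime d :=
  WithLp.toLp 2 (y, -psi d s y)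

/-- The measure `σ_s^+ = δ(y' - √(s² + |y|²)) dy dy' / √(s² + |y|²)`. -/
def sigmaPlus (d : ℕ) (s : ℝ) : Measure (Spacetime d) := (baseMeasure d s).map (upperMap d s)

/-- The measure `σ_s^- = δ(y' + √(s² + |y|²)) dy dy' / √(s² + |y|²)`. -/
def sigmaMinus (d : ℕ) (s : ℝ) : Measure (Spacetime d) := (baseMeasure d s).map (lowerMap d s)

/-- The measure `σ_s^+ + σ_s^-` on the two-sheeted hyperboloid. -/
def sigmaBar (d : ℕ) (s : ℝ) : Measure (Spacetime d) := sigmaPlus d s + sigmaMinus d s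

/-! These measures have temperate growth, so that `f σ` is a tempered distribution for every
`f ∈ L²(σ)`. -/

theorem continuous_psi (d : ℕ) (s : ℝ) : Continuous (psi d s) := by
  unfold psi; fun_prop

theorem continuous_upperMap (d : ℕ) (s : ℝ) : Continuous (upperMap d s) :=
  (WithLp.prod_continuous_toLp 2 _ _).comp (continuous_id.prodMk (continuous_psi d s))

theorem continuous_lowerMap (d : ℕ) (s : ℝ) : Continuous (lowerMap d s) :=
  (WithLp.prod_continuous_toLp 2 _ _).comp (continuous_id.prodMk (continuous_psi d s).neg)

theorem hasTemperateGrowth_map (d : ℕ) (s : ℝ) (hs : 0 < s)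
    (Φ : EuclideanSpace ℝ (Fin d) → Spacetime d) (hc : Continuous Φ)
    (hΦ : ∀ y, ‖y‖ ≤ ‖Φ y‖) : ((baseMeasure d s).map Φ).HasTemperateGrowth := by
  obtain ⟨n, hn⟩ := (inferInstance :
    (volume : Measure (EuclideanSpace ℝ (Fin d))).HasTemperateGrowth).exists_integrable
  refine ⟨⟨n, ?_⟩⟩
  have hpos : ∀ z : Spacetime d, 0 < 1 + ‖z‖ := fun z => by positivity
  have hcont : Continuous fun z : Spacetime d => (1 + ‖z‖) ^ (-(n : ℝ)) :=
    (continuous_const.add continuous_norm).rpow_const fun z => Or.inl (hpos z).ne'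
  rw [integrable_map_measure hcont.aestronglyMeasurable hc.measurable.aemeasurable]
  have hmeas : Measurable fun y => ENNReal.ofReal (1 / psi d s y) :=
    ((continuous_psi d s).measurable.const_div 1).ennreal_ofReal
  have hle : baseMeasure d s ≤ ENNReal.ofReal (1 / s) • volume := by
    rw [baseMeasure, ← withDensity_const]
    refine withDensity_mono (Eventually.of_forall fun y => ENNReal.ofReal_le_ofReal ?_)
    exact one_div_le_one_div_of_le hs (Real.le_sqrt_of_sq_le (by nlinarith [sq_nonneg ‖y‖]))
  refine Integrable.mono_measure ?_ hle
  refine Integrable.smul_measure ?_ ENNReal.ofReal_ne_top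
  refine hn.mono' (hcont.comp hc).aestronglyMeasurable (Eventually.of_forall fun y => ?_)
  have h0 : 0 < 1 + ‖y‖ := by positivity
  simp only [Function.comp]
  rw [Real.norm_of_nonneg (Real.rpow_nonneg (hpos _).le _)]
  exact Real.rpow_le_rpow_of_nonpos h0 (by linarith [hΦ y]) (by simp)

theorem norm_le_norm_toLp (d : ℕ) (y : EuclideanSpace ℝ (Fin d)) (t : ℝ) :
    ‖y‖ ≤ ‖(WithLp.toLp 2 (y, t) : Spacetime d)‖ := by
  rw [WithLp.prod_norm_eq_of_L2]
  exact Real.le_sqrt_of_sq_le (by simp [sq_nonneg])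

instance (d : ℕ) (s : ℝ) [hs : Fact (0 < s)] : (sigmaPlus d s).HasTemperateGrowth :=
  hasTemperateGrowth_map d s hs.out _ (continuous_upperMap d s) fun y => norm_le_norm_toLp d y _

instance (d : ℕ) (s : ℝ) [hs : Fact (0 < s)] : (sigmaMinus d s).HasTemperateGrowth :=
  hasTemperateGrowth_map d s hs.out _ (continuous_lowerMap d s) fun y => norm_le_norm_toLp d y _

instance (d : ℕ) (s : ℝ) [Fact (0 < s)] : (sigmaBar d s).HasTemperateGrowth := by
  obtain ⟨m, hm⟩ := (inferInstance : (sigmaPlus d s).HasTemperateGrowth).exists_integrable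
  obtain ⟨n, hn⟩ := (inferInstance : (sigmaMinus d s).HasTemperateGrowth).exists_integrable
  have hpos : ∀ z : Spacetime d, 0 < 1 + ‖z‖ := fun z => by positivity
  have key : ∀ (k : ℕ) (_ : k ≤ max m n) (μ : Measure (Spacetime d)),
      Integrable (fun z => (1 + ‖z‖) ^ (-(k : ℝ))) μ →
      Integrable (fun z => (1 + ‖z‖) ^ (-((max m n : ℕ) : ℝ))) μ := by
    intro k hk μ h
    have hcont : Continuous fun z : Spacetime d => (1 + ‖z‖) ^ (-((max m n : ℕ) : ℝ)) :=
      (continuous_const.add continuous_norm).rpow_const fun z => Or.inl (hpos z).ne'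
    refine h.mono' hcont.aestronglyMeasurable (Eventually.of_forall fun z => ?_)
    rw [Real.norm_of_nonneg (Real.rpow_nonneg (hpos _).le _)]
    refine Real.rpow_le_rpow_of_exponent_le (by linarith [norm_nonneg z]) ?_
    have : (k : ℝ) ≤ ((max m n : ℕ) : ℝ) := by exact_mod_cast hk
    linarith
  exact ⟨⟨max m n, (key m (le_max_left _ _) _ hm).add_measure (key n (le_max_right _ _) _ hn)⟩⟩

/-! ### The adjoint restriction operator -/

/-- The dilation `ζ ↦ ζ / (2π)`, as a linear isomorphism. -/
def dilation (d : ℕ) : Spacetime d ≃L[ℝ] Spacetime d :=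
  ContinuousLinearEquiv.smulLeft
    (Units.mk0 ((2 * Real.pi)⁻¹ : ℝ) (inv_ne_zero Real.two_pi_pos.ne'))

/-- The operator `φ ↦ (ζ ↦ ∫ e^{i z·ζ} φ(z) dz)` on Schwartz functions: the (reflected) Fourier
transform in the normalization without `2π` in the exponent. See `expTransform_apply`. -/
def expTransform (d : ℕ) : 𝓢(Spacetime d, ℂ) →L[ℂ] 𝓢(Spacetime d, ℂ) :=
  (SchwartzMap.compCLMOfContinuousLinearEquiv ℂ (dilation d)).comp
    (fourierInvCLM ℂ 𝓢(Spacetime d, ℂ))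

theorem expTransform_apply (d : ℕ) (φ : 𝓢(Spacetime d, ℂ)) (ζ : Spacetime d) :
    expTransform d φ ζ = ∫ z, Complex.exp (Complex.I * (inner ℝ z ζ : ℝ)) * φ z := by
  have h : expTransform d φ ζ = (𝓕⁻ (φ : Spacetime d → ℂ)) ((2 * Real.pi)⁻¹ • ζ) := by
    rw [← SchwartzMap.fourierInv_coe]; rfl
  rw [h, Real.fourierInv_eq']
  congr 1
  ext z
  rw [inner_smul_right, smul_eq_mul]
  congr 2
  have : (Real.pi : ℂ) ≠ 0 := by exact_mod_cast Real.pi_ne_zero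
  push_cast
  field_simp

/-- The adjoint restriction (extension) operator of a measure `μ` on space-time, formally
`(T f)(z) = ∫ e^{i z·ζ} f(ζ) dμ(ζ)`: for `f ∈ L²(μ)` it is the (reflected) Fourier transform of the
tempered distribution `f μ`, that is, `⟨T f, φ⟩ = ∫ f(ζ) (∫ e^{i z·ζ} φ(z) dz) dμ(ζ)`. -/
def adjointRestriction {d : ℕ} {μ : Measure (Spacetime d)} [μ.HasTemperateGrowth]
    (f : Lp ℂ 2 μ) : 𝓢'(Spacetime d, ℂ) :=
  PointwiseConvergenceCLM.precomp ℂ (expTransform d) (Lp.toTemperedDistribution f)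

theorem adjointRestriction_apply {d : ℕ} {μ : Measure (Spacetime d)} [μ.HasTemperateGrowth]
    (f : Lp ℂ 2 μ) (φ : 𝓢(Spacetime d, ℂ)) :
    adjointRestriction f φ =
      ∫ ζ, (∫ z, Complex.exp (Complex.I * (inner ℝ z ζ : ℝ)) * φ z) * f ζ ∂μ := by
  simp_rw [← expTransform_apply]
  exact Lp.toTemperedDistribution_apply f (expTransform d φ)

instance fact_one_le_four : Fact ((1 : ℝ≥0∞) ≤ 4) := ⟨by norm_num⟩

/-- The `L^p(ℝ^(d+1))` norm of a tempered distribution: the norm of the `L^p` function that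
represents it, and `∞` if there is none. -/
def distLpNorm {d : ℕ} (p : ℝ≥0∞) [Fact (1 ≤ p)] (u : 𝓢'(Spacetime d, ℂ)) : ℝ≥0∞ :=
  ⨅ (F : Lp ℂ p (volume : Measure (Spacetime d))) (_ : Lp.toTemperedDistribution F = u), ‖F‖ₑ

/-- The best constant in `‖T f‖_{L^p(ℝ^(d+1))} ≤ C ‖f‖_{L²(μ)}`. -/
def bestConst {d : ℕ} (p : ℝ≥0∞) [Fact (1 ≤ p)] (μ : Measure (Spacetime d))
    [μ.HasTemperateGrowth] : ℝ≥0∞ :=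
  ⨆ (f : Lp ℂ 2 μ) (_ : f ≠ 0), distLpNorm p (adjointRestriction f) / ‖f‖ₑ

/-- Extremizers of `‖T f‖_{L^p(ℝ^(d+1))} ≤ C ‖f‖_{L²(μ)}`. -/
def IsExtremizer {d : ℕ} (p : ℝ≥0∞) [Fact (1 ≤ p)] (μ : Measure (Spacetime d))
    [μ.HasTemperateGrowth] (f : Lp ℂ 2 μ) : Prop :=
  f ≠ 0 ∧ distLpNorm p (adjointRestriction f) = bestConst p μ * ‖f‖ₑ

/-- Extremizing sequences of `‖T f‖_{L^p(ℝ^(d+1))} ≤ C ‖f‖_{L²(μ)}`. -/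
def IsExtremizingSeq {d : ℕ} (p : ℝ≥0∞) [Fact (1 ≤ p)] (μ : Measure (Spacetime d))
    [μ.HasTemperateGrowth] (f : ℕ → Lp ℂ 2 μ) : Prop :=
  (∀ n, ‖f n‖ ≤ 1) ∧
    Tendsto (fun n => distLpNorm p (adjointRestriction (f n))) atTop (𝓝 (bestConst p μ))

/-! ### The two components of a function on the two-sheeted hyperboloid -/

/-- The component `f_+ ∈ L²(σ_s^+)` of `f ∈ L²(σ_s^+ + σ_s^-)`. -/
def plusPart {d : ℕ} {s : ℝ} (f : Lp ℂ 2 (sigmaBar d s)) : Lp ℂ 2 (sigmaPlus d s) :=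
  ((Lp.memLp f).mono_measure (Measure.le_add_right le_rfl)).toLp f

/-- The component `f_- ∈ L²(σ_s^-)` of `f ∈ L²(σ_s^+ + σ_s^-)`. -/
def minusPart {d : ℕ} {s : ℝ} (f : Lp ℂ 2 (sigmaBar d s)) : Lp ℂ 2 (sigmaMinus d s) :=
  ((Lp.memLp f).mono_measure (Measure.le_add_left le_rfl)).toLp f

/-- On the two-sheeted hyperboloid, `T f = T^+ f_+ + T^- f_-`. -/
theorem adjointRestriction_sigmaBar {d : ℕ} {s : ℝ} [Fact (0 < s)]
    (f : Lp ℂ 2 (sigmaBar d s)) :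
    adjointRestriction f =
      adjointRestriction (plusPart f) + adjointRestriction (minusPart f) := by
  ext φ
  change Lp.toTemperedDistribution f (expTransform d φ) =
    Lp.toTemperedDistribution (plusPart f) (expTransform d φ) +
      Lp.toTemperedDistribution (minusPart f) (expTransform d φ)
  have hint : Integrable (fun x => expTransform d φ x • f x) (sigmaBar d s) :=
    MemLp.integrable_mul (p := 2) (q := 2) ((expTransform d φ).memLp 2 _) (Lp.memLp f)
  rw [Lp.toTemperedDistribution_apply, Lp.toTemperedDistribution_apply,
    Lp.toTemperedDistribution_apply]
  have h1 := hint.mono_measure (ν := sigmaBar d s) (μ := sigmaPlus d s)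
    (Measure.le_add_right le_rfl)
  have h2 := hint.mono_measure (ν := sigmaBar d s) (μ := sigmaMinus d s)
    (Measure.le_add_left le_rfl)
  refine (integral_add_measure h1 h2).trans ?_
  congr 1
  · refine integral_congr_ae ?_
    filter_upwards [MemLp.coeFn_toLp ((Lp.memLp f).mono_measure
      (Measure.le_add_right le_rfl : sigmaPlus d s ≤ sigmaBar d s))] with x hx
    rw [plusPart, hx]
  · refine integral_congr_ae ?_
    filter_upwards [MemLp.coeFn_toLp ((Lp.memLp f).mono_measure
      (Measure.le_add_left le_rfl : sigmaMinus d s ≤ sigmaBar d s))] with x hx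
    rw [minusPart, hx]

end Hyperboloid

end

open Hyperboloid

open MeasureTheory Filter Topology SchwartzMap FourierTransform
open scoped ENNReal

noncomputable section

namespace Hyperboloid

/-! Write `F` for the extension of `f₊` and `G` for that of `f₋`. The Fourier supports of `F²`, `FG`
and `G²` lie in the sums upper + upper, upper + lower and lower + lower of the sheets, hence in the
solid future region, the spacelike region `|τ| ≤ |ξ|` and the solid past region. These are closed
and pairwise disjoint, so the three products are orthogonal in `L²`, and squaring `F + G` gives `‖F
+ G‖₄⁴ = ‖F‖₄⁴ + ‖G‖₄⁴ + 4‖FG‖₂²` (`norm_add_four`).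

By Hölder, with `x = ‖F‖₄` and `y = ‖G‖₄`, this is at most `x⁴ + y⁴ + 4x²y² = (3/2)(x² + y²)² -
(1/2)(x² - y²)²` (`norm_add_four_le`). Since `x ≤ H‖f₊‖` and `y ≤ H‖f₋‖`, the constant `(3/2)H⁴`
follows. The discarded square forces `x = y` and `x² + y² = H²‖f‖²` under equality, and the same in
the limit along extremizing sequences (`components_eq_of_four_eq`, `tendsto_components`). The
constant is sharp: for `f₋(ζ) = conj f₊(-ζ)` one has `G = conj F`, Hölder is an equality, and the
factor is `6/4` (`norm_add_reflect_four`, `opNorm_sigmaBar_four`).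

An extremizer on both sheets would thus give one on the upper sheet, and there is none. Let `k` be
the density of `σ⁺ ∗ σ⁺`, computed by a Lorentz boost to the centre of mass frame
(`lintegral_lintegral_sigmaPlus_add`). Weighted Cauchy-Schwarz and Plancherel give `‖T f‖₄⁴ ≤
(2π)^(d+1) ∬ k(ζ + ζ')|f(ζ)|²|f(ζ')|²`. For `d = 2, 3` the supremum of `k` is finite and not
attained, so the bound by `(2π)^(d+1) sup k` is strict for `f ≠ 0` (`extension_sigmaPlus_four_lt`).
That bound is nevertheless the best constant: testing with `e^{-aτ}` shows that it dominates the
average of `k` in the weight `k e^{-aτ}`. This average tends to `sup k` as `a → ∞` for `d = 2`,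
where the weight concentrates at the vertex, and as `a → 0` for `d = 3`, where it escapes to
infinity (`densityBound_two_le`, `densityBound_three_le`).

The extension operators are built on integrable functions, where they are given by absolutely
convergent integrals, and then extended by density in `L²` (`exists_extension`). -/

/-! ### Polar coordinates and the dispersion relation. -/

theorem lintegral_comp_norm {V : Type*} [NormedAddCommGroup V] [NormedSpace ℝ V]
    [FiniteDimensional ℝ V] [MeasurableSpace V] [BorelSpace V] [Nontrivial V] (μ : Measure V)
    [μ.IsAddHaarMeasure] {f : ℝ → ℝ≥0∞} (hf : Measurable f) :
    ∫⁻ x, f ‖x‖ ∂μ = μ.toSphere Set.univ *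
      ∫⁻ r in Set.Ioi (0 : ℝ), ENNReal.ofReal (r ^ (Module.finrank ℝ V - 1)) * f r := by
  have h1 : ∫⁻ x, f ‖x‖ ∂μ = ∫⁻ x : ({(0)}ᶜ : Set V), f ‖x.1‖ ∂(μ.comap (↑)) := by
    rw [lintegral_subtype_comap (measurableSet_singleton _).compl fun x => f ‖x‖,
      restrict_compl_singleton]
  have h2 := μ.measurePreserving_homeomorphUnitSphereProd.lintegral_comp_emb
    (Homeomorph.measurableEmbedding _) (fun p => f p.2.1)
  simp only [homeomorphUnitSphereProd_apply_snd_coe] at h2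
  rw [h1, h2, lintegral_prod _ (by fun_prop)]
  simp only [lintegral_const]
  rw [mul_comm, Measure.volumeIoiPow, lintegral_withDensity_eq_lintegral_mul _ (by fun_prop)
    (by fun_prop)]
  congr 1
  exact lintegral_subtype_comap measurableSet_Ioi
    (fun r => ENNReal.ofReal (r ^ (Module.finrank ℝ V - 1)) * f r)

theorem psi_sq (d : ℕ) (s : ℝ) (y : EuclideanSpace ℝ (Fin d)) :
    psi d s y ^ 2 = s ^ 2 + ‖y‖ ^ 2 := Real.sq_sqrt (by positivity)

theorem psi_pos (d : ℕ) {s : ℝ} (hs : 0 < s) (y : EuclideanSpace ℝ (Fin d)) : 0 < psi d s y :=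
  Real.sqrt_pos.2 (by positivity)

theorem psi_neg (d : ℕ) (s : ℝ) (y : EuclideanSpace ℝ (Fin d)) : psi d s (-y) = psi d s y := by
  simp [psi]

theorem norm_lt_psi (d : ℕ) {s : ℝ} (hs : 0 < s) (y : EuclideanSpace ℝ (Fin d)) :
    ‖y‖ < psi d s y := Real.lt_sqrt_of_sq_lt (by nlinarith)

/-! ### Boosts to the centre of mass frame -/

/-- Energy of a pair with total momentum `ξ` and momentum `±η` in the centre of mass frame. -/
def pairEnergy (d : ℕ) (s : ℝ) (ξ η : EuclideanSpace ℝ (Fin d)) : ℝ :=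
  Real.sqrt (4 * psi d s η ^ 2 + ‖ξ‖ ^ 2)

theorem pairEnergy_sq (d : ℕ) (s : ℝ) (ξ η : EuclideanSpace ℝ (Fin d)) :
    pairEnergy d s ξ η ^ 2 = 4 * psi d s η ^ 2 + ‖ξ‖ ^ 2 := Real.sq_sqrt (by positivity)

theorem pairEnergy_pos (d : ℕ) {s : ℝ} (hs : 0 < s) (ξ η : EuclideanSpace ℝ (Fin d)) :
    0 < pairEnergy d s ξ η :=
  Real.sqrt_pos.2 (by have := psi_pos d hs η; positivity)

theorem pairEnergy_neg (d : ℕ) (s : ℝ) (ξ η : EuclideanSpace ℝ (Fin d)) :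
    pairEnergy d s ξ (-η) = pairEnergy d s ξ η := by simp [pairEnergy, psi_neg]

/-- The first momentum of the pair with total momentum `ξ` and centre of mass momentum `η`. -/
def boost (d : ℕ) (s : ℝ) (ξ η : EuclideanSpace ℝ (Fin d)) : EuclideanSpace ℝ (Fin d) :=
  (1 / 2 : ℝ) • ξ + (η +
    ((pairEnergy d s ξ η / (2 * psi d s η) - 1) * (inner ℝ ξ η / ‖ξ‖ ^ 2)) • ξ)

/-- In the centre of mass frame the two momenta are opposite, so the partner is the boost of `-η`.
-/
theorem sub_boost (d : ℕ) (s : ℝ) (ξ η : EuclideanSpace ℝ (Fin d)) :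
    ξ - boost d s ξ η = boost d s ξ (-η) := by
  simp only [boost, pairEnergy_neg, psi_neg, inner_neg_right]
  module

/-- With `τ` the pair energy, `boost` is the spatial part of the Lorentz boost of velocity `ξ/τ` and
factor `γ = τ/(2ψ(η))`. The formula is the transformation law `γ(ψ + v·η)` for the energy. -/
theorem psi_boost {d : ℕ} {s : ℝ} (hs : 0 < s) {ξ : EuclideanSpace ℝ (Fin d)} (hξ : ξ ≠ 0)
    (η : EuclideanSpace ℝ (Fin d)) :
    psi d s (boost d s ξ η) = pairEnergy d s ξ η / 2 + inner ℝ ξ η / (2 * psi d s η) := by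
  have hq := psi_pos d hs η
  have hτ := pairEnergy_pos d hs ξ η
  have hq2 := psi_sq d s η
  have hτ2 := pairEnergy_sq d s ξ η
  have hN : 0 < ‖ξ‖ := norm_pos_iff.2 hξ
  have hη := norm_lt_psi d hs η
  have hin := abs_real_inner_le_norm ξ η
  set q := psi d s η
  set τ := pairEnergy d s ξ η
  have hb : boost d s ξ η = (1 / 2 : ℝ) • ξ + (η + ((τ / (2 * q) - 1) *
    (inner ℝ ξ η / ‖ξ‖ ^ 2)) • ξ) := rfl
  set t : ℝ := inner ℝ ξ η
  set k : ℝ := (τ / (2 * q) - 1) * (t / ‖ξ‖ ^ 2) with hk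
  have hkN : k * ‖ξ‖ ^ 2 = (τ / (2 * q) - 1) * t := by rw [hk]; field_simp
  have hnorm : ‖boost d s ξ η‖ ^ 2 =
      ‖ξ‖ ^ 2 / 4 + ‖η‖ ^ 2 + k ^ 2 * ‖ξ‖ ^ 2 + t + k * ‖ξ‖ ^ 2 + 2 * k * t := by
    have : boost d s ξ η = (1 / 2 + k) • ξ + η := by rw [hb]; module
    rw [this, norm_add_sq_real, norm_smul, inner_smul_left, mul_pow, Real.norm_eq_abs, sq_abs]
    simp only [conj_trivial]
    ring
  have hk2 : k ^ 2 * ‖ξ‖ ^ 2 + 2 * k * t = t ^ 2 / (4 * q ^ 2) := by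
    have : k ^ 2 * ‖ξ‖ ^ 2 + 2 * k * t = t ^ 2 / ‖ξ‖ ^ 2 * (τ ^ 2 / (4 * q ^ 2) - 1) := by
      have : k ^ 2 * ‖ξ‖ ^ 2 = k * (k * ‖ξ‖ ^ 2) := by ring
      rw [this, hkN, hk]; field_simp; ring
    rw [this, hτ2]; field_simp; ring
  -- The sign selects the positive root: `|ξ| ≤ τ`, and `|ξ·η| ≤ |ξ|ψ(η)` by Cauchy-Schwarz.
  have hpos : 0 ≤ τ / 2 + t / (2 * q) := by
    have h1 : ‖ξ‖ ≤ τ := by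
      refine Real.le_sqrt_of_sq_le ?_
      nlinarith
    have h2 : -‖ξ‖ ≤ t / q := by
      rw [le_div_iff₀ hq]
      have := neg_le_of_abs_le hin
      nlinarith
    have h3 : t / (2 * q) = t / q / 2 := by field_simp
    rw [h3]; linarith
  rw [psi, Real.sqrt_eq_iff_mul_self_eq (by positivity) hpos, hnorm]
  have : (τ / 2 + t / (2 * q)) * (τ / 2 + t / (2 * q)) =
      τ ^ 2 / 4 + τ * t / (2 * q) + t ^ 2 / (4 * q ^ 2) := by field_simp; ring
  rw [this, hτ2, ← hk2, hq2]
  have h4 : τ * t / (2 * q) = k * ‖ξ‖ ^ 2 + t := by rw [hkN]; ring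
  rw [h4]; ring

theorem psi_sub_boost {d : ℕ} {s : ℝ} (hs : 0 < s) {ξ : EuclideanSpace ℝ (Fin d)} (hξ : ξ ≠ 0)
    (η : EuclideanSpace ℝ (Fin d)) :
    psi d s (ξ - boost d s ξ η) = pairEnergy d s ξ η / 2 - inner ℝ ξ η / (2 * psi d s η) := by
  rw [sub_boost, psi_boost hs hξ, pairEnergy_neg, psi_neg, inner_neg_right]
  ring

theorem psi_eq_of_pairEnergy_eq {d : ℕ} {s : ℝ} (hs : 0 < s) {ξ η η' : EuclideanSpace ℝ (Fin d)}
    (h : pairEnergy d s ξ η = pairEnergy d s ξ η') : psi d s η = psi d s η' := by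
  have h1 := pairEnergy_sq d s ξ η
  rw [h, pairEnergy_sq] at h1
  have := psi_pos d hs η
  have := psi_pos d hs η'
  rw [← sq_eq_sq₀ (by positivity) (by positivity)]
  linarith

/-- The sum and the difference of the two energies recover the pair energy and `ξ·η`, hence the
coefficient of `ξ` in `boost`; what remains is a translation of `η`. -/
theorem boost_injective {d : ℕ} {s : ℝ} (hs : 0 < s) {ξ : EuclideanSpace ℝ (Fin d)}
    (hξ : ξ ≠ 0) : Function.Injective (boost d s ξ) := by
  intro η η' h
  have h1 := psi_boost hs hξ η
  have h2 := psi_sub_boost hs hξ η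
  rw [h, psi_boost hs hξ] at h1
  rw [h, psi_sub_boost hs hξ] at h2
  have hE : pairEnergy d s ξ η = pairEnergy d s ξ η' := by linarith
  have hq := psi_eq_of_pairEnergy_eq hs hE
  have hqp := psi_pos d hs η'
  have ht : (inner ℝ ξ η : ℝ) = inner ℝ ξ η' := by
    have : (inner ℝ ξ η' : ℝ) / (2 * psi d s η') = inner ℝ ξ η / (2 * psi d s η') := by
      rw [hq] at h1; linarith
    field_simp at this
    linarith
  simpa [boost, hE, hq, ht] using h

theorem boost_surjective {d : ℕ} {s : ℝ} (hs : 0 < s) {ξ : EuclideanSpace ℝ (Fin d)}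
    (hξ : ξ ≠ 0) : Function.Surjective (boost d s ξ) := by
  intro x
  have ha := norm_lt_psi d hs x
  have hb := norm_lt_psi d hs (ξ - x)
  have ha2 := psi_sq d s x
  have hb2 := psi_sq d s (ξ - x)
  have hN : 0 < ‖ξ‖ := norm_pos_iff.2 hξ
  have htri : ‖ξ‖ ≤ ‖x‖ + ‖ξ - x‖ := by
    simpa using norm_add_le x (ξ - x)
  rw [norm_sub_sq_real] at hb2
  set a := psi d s x
  set b := psi d s (ξ - x)
  -- The invariant mass of the pair; in the centre of mass frame each particle has energy `m/2`.
  set m := Real.sqrt ((a + b) ^ 2 - ‖ξ‖ ^ 2) with hm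
  have hpos : 0 < (a + b) ^ 2 - ‖ξ‖ ^ 2 := by
    have : ‖ξ‖ < a + b := by linarith
    nlinarith
  have hm2 : m ^ 2 = (a + b) ^ 2 - ‖ξ‖ ^ 2 := Real.sq_sqrt hpos.le
  have hmp : 0 < m := Real.sqrt_pos.2 hpos
  have hd : (a + b) * (a - b) = 2 * inner ℝ ξ x - ‖ξ‖ ^ 2 := by linarith
  -- The value that `ξ·η` must take, solved from the energy difference `a - b = 2(ξ·η)/m`; `κ` is
  -- then the coefficient `(γ - 1)(ξ·η)/|ξ|²` of the boost.
  set t : ℝ := m * (a - b) / 2 with ht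
  set κ : ℝ := (a + b - m) * (a - b) / (2 * ‖ξ‖ ^ 2) with hκ
  have hκN : κ * ‖ξ‖ ^ 2 = (a + b - m) * (a - b) / 2 := by rw [hκ]; field_simp
  set η := x - (1 / 2 + κ) • ξ with hη
  have hin : (inner ℝ ξ η : ℝ) = t := by
    rw [hη, inner_sub_right, inner_smul_right, real_inner_self_eq_norm_sq]
    have : (1 / 2 + κ) * ‖ξ‖ ^ 2 = ‖ξ‖ ^ 2 / 2 + κ * ‖ξ‖ ^ 2 := by ring
    rw [this, hκN, ht]; linarith
  have hnorm : ‖η‖ ^ 2 = ‖x‖ ^ 2 - 2 * (1 / 2 + κ) * inner ℝ ξ x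
      + (1 / 2 + κ) ^ 2 * ‖ξ‖ ^ 2 := by
    rw [hη, norm_sub_sq_real, norm_smul, inner_smul_right, mul_pow, Real.norm_eq_abs, sq_abs,
      real_inner_comm]
    ring
  have hq : psi d s η = m / 2 := by
    rw [psi, Real.sqrt_eq_iff_mul_self_eq (by positivity) (by positivity), hnorm]
    have hix : (inner ℝ ξ x : ℝ) = ((a + b) * (a - b) + ‖ξ‖ ^ 2) / 2 := by linarith
    have hx2 : s ^ 2 + ‖x‖ ^ 2 = a ^ 2 := ha2.symm
    have e1 : (1 / 2 + κ) ^ 2 * ‖ξ‖ ^ 2 = ‖ξ‖ ^ 2 / 4 + κ * ‖ξ‖ ^ 2 + κ * (κ * ‖ξ‖ ^ 2) := by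
      ring
    have e2 : κ * (κ * ‖ξ‖ ^ 2) - κ * ((a + b) * (a - b)) = - (a - b) ^ 2 / 4 := by
      rw [hκN, hκ]
      have : ‖ξ‖ ^ 2 = (a + b) ^ 2 - m ^ 2 := by linarith
      have hne : (a + b) ^ 2 - m ^ 2 ≠ 0 := by rw [← this]; positivity
      rw [this]; field_simp; ring
    rw [e1, hix]
    nlinarith
  have hE : pairEnergy d s ξ η = a + b := by
    rw [pairEnergy, hq, Real.sqrt_eq_iff_mul_self_eq (by positivity)
      (by linarith [norm_nonneg x, norm_nonneg (ξ - x)])]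
    linarith
  refine ⟨η, ?_⟩
  have hcoef : ((a + b) / (2 * (m / 2)) - 1) * (t / ‖ξ‖ ^ 2) = κ := by
    rw [ht, hκ]; field_simp
  rw [boost, hE, hq, hin, hcoef, hη]
  module

/-- The derivative of `boost d s ξ` at `η`. -/
def boostDeriv (d : ℕ) (s : ℝ) (ξ η : EuclideanSpace ℝ (Fin d)) :
    EuclideanSpace ℝ (Fin d) →L[ℝ] EuclideanSpace ℝ (Fin d) :=
  ContinuousLinearMap.id ℝ _ +
    ((((pairEnergy d s ξ η / (2 * psi d s η) - 1) / ‖ξ‖ ^ 2) • innerSL ℝ ξ -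
      (inner ℝ ξ η / (2 * pairEnergy d s ξ η * psi d s η ^ 3)) • innerSL ℝ η)).smulRight ξ

theorem hasFDerivAt_boost {d : ℕ} {s : ℝ} (hs : 0 < s) {ξ : EuclideanSpace ℝ (Fin d)}
    (hξ : ξ ≠ 0) (η : EuclideanSpace ℝ (Fin d)) :
    HasFDerivAt (boost d s ξ) (boostDeriv d s ξ η) η := by
  have hN : 0 < ‖ξ‖ := norm_pos_iff.2 hξ
  have hq := psi_pos d hs η
  have hτ := pairEnergy_pos d hs ξ η
  have h0 : HasFDerivAt (fun y : EuclideanSpace ℝ (Fin d) => ‖y‖ ^ 2) (2 • innerSL ℝ η) η :=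
    (hasStrictFDerivAt_norm_sq η).hasFDerivAt
  have h1 : HasFDerivAt (psi d s) ((1 / (psi d s η)) • innerSL ℝ η) η := by
    have := (h0.const_add (s ^ 2)).sqrt (by positivity)
    refine this.congr_fderiv ?_
    ext v
    simp [psi]
    field_simp
  have h2 : HasFDerivAt (pairEnergy d s ξ) ((4 / pairEnergy d s ξ η) • innerSL ℝ η) η := by
    have := (((h1.pow 2).const_mul 4).add_const (‖ξ‖ ^ 2)).sqrt (by positivity)
    refine this.congr_fderiv ?_
    ext v
    simp [pairEnergy]
    field_simp
  have h3 : HasFDerivAt (fun y => (inner ℝ ξ y : ℝ)) (innerSL ℝ ξ) η := (innerSL ℝ ξ).hasFDerivAt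
  have h1i := (hasDerivAt_inv (x := 2 * psi d s η) (by positivity)).comp_hasFDerivAt η
    (h1.const_mul 2)
  have h4 := ((((h2.mul h1i).sub_const 1).mul
    (h3.mul_const (1 / ‖ξ‖ ^ 2))).smul_const ξ)
  have h5 := ((hasFDerivAt_id η).add h4).const_add ((1 / 2 : ℝ) • ξ)
  have h6 : (fun y => (1 / 2 : ℝ) • ξ + (y + ((pairEnergy d s ξ y / (2 * psi d s y) - 1) *
      (inner ℝ ξ y * (1 / ‖ξ‖ ^ 2))) • ξ)) = boost d s ξ := by
    ext1 y; rw [boost, mul_one_div]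
  rw [← h6]
  refine HasFDerivAt.congr_fderiv h5 ?_
  ext1 v
  simp only [boostDeriv, add_apply, ContinuousLinearMap.smulRight_apply,
    sub_apply, smul_apply, innerSL_apply_apply,
    smul_eq_mul, Pi.mul_apply, Function.comp_apply]
  congr 2
  have hτ2 := pairEnergy_sq d s ξ η
  generalize (inner ℝ ξ v : ℝ) = u
  generalize (inner ℝ η v : ℝ) = w
  generalize (inner ℝ ξ η : ℝ) = t
  field_simp
  linear_combination (-(t * w)) * hτ2

/-- The derivative is the identity plus a rank-one map, so its determinant is one plus the
functional evaluated at `ξ`. The two energies appear as a factor, which cancels the weights `1/ψ` of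
the two sheet measures. -/
theorem det_boostDeriv {d : ℕ} {s : ℝ} (hs : 0 < s) {ξ : EuclideanSpace ℝ (Fin d)}
    (hξ : ξ ≠ 0) (η : EuclideanSpace ℝ (Fin d)) :
    (boostDeriv d s ξ η).det = 4 / (2 * psi d s η * pairEnergy d s ξ η) *
      (psi d s (boost d s ξ η) * psi d s (ξ - boost d s ξ η)) := by
  have hN : 0 < ‖ξ‖ := norm_pos_iff.2 hξ
  have hq := psi_pos d hs η
  have hτ := pairEnergy_pos d hs ξ η
  have hτ2 := pairEnergy_sq d s ξ η
  have h1 : (boostDeriv d s ξ η : EuclideanSpace ℝ (Fin d) →ₗ[ℝ] EuclideanSpace ℝ (Fin d)) =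
      LinearMap.transvection (((((pairEnergy d s ξ η / (2 * psi d s η) - 1) / ‖ξ‖ ^ 2) •
        innerSL ℝ ξ - (inner ℝ ξ η / (2 * pairEnergy d s ξ η * psi d s η ^ 3)) • innerSL ℝ η) :
          EuclideanSpace ℝ (Fin d) →L[ℝ] ℝ) : EuclideanSpace ℝ (Fin d) →ₗ[ℝ] ℝ) ξ := by
    ext1 v
    rfl
  rw [ContinuousLinearMap.det, h1, LinearMap.transvection.det, psi_boost hs hξ,
    psi_sub_boost hs hξ]
  simp only [ContinuousLinearMap.coe_coe, sub_apply,
    smul_apply, innerSL_apply_apply, smul_eq_mul, real_inner_self_eq_norm_sq]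
  rw [real_inner_comm η ξ]
  generalize (inner ℝ η ξ : ℝ) = t
  have hτ4 : pairEnergy d s ξ η ^ 4 = (4 * psi d s η ^ 2 + ‖ξ‖ ^ 2) ^ 2 := by
    rw [← hτ2]; ring
  field_simp
  ring

/-- Change of variables to the centre of mass momentum. -/
theorem lintegral_boost {d : ℕ} {s : ℝ} (hs : 0 < s) {ξ : EuclideanSpace ℝ (Fin d)}
    (hξ : ξ ≠ 0) (g : ℝ → ℝ≥0∞) :
    ∫⁻ x, ENNReal.ofReal (1 / psi d s x * (1 / psi d s (ξ - x))) *
        g (psi d s x + psi d s (ξ - x)) =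
      ∫⁻ η, ENNReal.ofReal (4 / (2 * psi d s η * pairEnergy d s ξ η)) *
        g (pairEnergy d s ξ η) := by
  have h := lintegral_image_eq_lintegral_abs_det_fderiv_mul volume MeasurableSet.univ
    (fun η _ => (hasFDerivAt_boost hs hξ η).hasFDerivWithinAt) (boost_injective hs hξ).injOn
    (fun x => ENNReal.ofReal (1 / psi d s x * (1 / psi d s (ξ - x))) *
        g (psi d s x + psi d s (ξ - x)))
  rw [Set.image_univ, (boost_surjective hs hξ).range_eq] at h
  simp only [Measure.restrict_univ] at h
  rw [h]
  refine lintegral_congr fun η => ?_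
  have hx := psi_pos d hs (boost d s ξ η)
  have hy := psi_pos d hs (ξ - boost d s ξ η)
  have hq := psi_pos d hs η
  have hτ := pairEnergy_pos d hs ξ η
  have hsum : psi d s (boost d s ξ η) + psi d s (ξ - boost d s ξ η) = pairEnergy d s ξ η := by
    rw [psi_boost hs hξ, psi_sub_boost hs hξ]; ring
  rw [hsum, ← mul_assoc, ← ENNReal.ofReal_mul (abs_nonneg _), det_boostDeriv hs hξ,
    abs_of_pos (by positivity)]
  congr 2
  field_simp


/-! ### The convolution of the upper sheet with itself -/

/-- The surface area of the unit sphere of `ℝ^d`. -/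
def sphereArea (d : ℕ) : ℝ :=
  ((volume : Measure (EuclideanSpace ℝ (Fin d))).toSphere Set.univ).toReal

theorem sphereArea_pos {d : ℕ} (hd : 2 ≤ d) : 0 < sphereArea d := by
  have : NeZero d := ⟨by omega⟩
  refine ENNReal.toReal_pos ?_ (measure_ne_top _ _)
  simpa using ⟨by omega, (Metric.measure_ball_pos volume _ one_pos).ne'⟩

/-- The density of `σ_s^+ ∗ σ_s^+` at a point `(ξ, τ)` with `τ² - |ξ|² = m2`, `τ > 0`. -/
def radialDensity (d : ℕ) (s m2 : ℝ) : ℝ :=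
  sphereArea d * (Real.sqrt (m2 / 4 - s ^ 2) ^ (d - 2) / Real.sqrt m2)

/-- The density of `σ_s^+ ∗ σ_s^+`. -/
def convDensity (d : ℕ) (s : ℝ) (ζ : Spacetime d) : ℝ :=
  if Real.sqrt (4 * s ^ 2 + ‖ζ.fst‖ ^ 2) < ζ.snd then
    radialDensity d s (ζ.snd ^ 2 - ‖ζ.fst‖ ^ 2) else 0

theorem measurable_fst_spacetime (d : ℕ) : Measurable (fun ζ : Spacetime d => ζ.fst) :=
  (WithLp.continuous_fst 2 _ _).measurable

theorem measurable_snd_spacetime (d : ℕ) : Measurable (fun ζ : Spacetime d => ζ.snd) :=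
  (WithLp.continuous_snd 2 _ _).measurable

theorem measurable_convDensity (d : ℕ) (s : ℝ) : Measurable (convDensity d s) := by
  have h1 := measurable_fst_spacetime d
  have h2 := measurable_snd_spacetime d
  unfold convDensity radialDensity
  refine Measurable.ite (measurableSet_lt (by fun_prop) h2) (by fun_prop) measurable_const

theorem radialDensity_nonneg (d : ℕ) (s m2 : ℝ) : 0 ≤ radialDensity d s m2 := by
  unfold radialDensity sphereArea; positivity

theorem convDensity_nonneg (d : ℕ) (s : ℝ) (ζ : Spacetime d) : 0 ≤ convDensity d s ζ := by
  unfold convDensity; split_ifs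
  exacts [radialDensity_nonneg _ _ _, le_rfl]

/-- Integration over the centre of mass momentum in terms of the energy. -/
theorem lintegral_pairEnergy {d : ℕ} (hd : 2 ≤ d) {s : ℝ} (hs : 0 < s)
    (ξ : EuclideanSpace ℝ (Fin d)) {g : ℝ → ℝ≥0∞} (hg : Measurable g) :
    ∫⁻ η, ENNReal.ofReal (4 / (2 * psi d s η * pairEnergy d s ξ η)) * g (pairEnergy d s ξ η) =
      ∫⁻ τ, ENNReal.ofReal (convDensity d s (WithLp.toLp 2 (ξ, τ))) * g τ := by
  have : NeZero d := ⟨by omega⟩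
  set q : ℝ → ℝ := fun r => Real.sqrt (s ^ 2 + r ^ 2) with hq
  set e : ℝ → ℝ := fun r => Real.sqrt (4 * (s ^ 2 + r ^ 2) + ‖ξ‖ ^ 2) with he
  have hqp : ∀ r, 0 < q r := fun r => Real.sqrt_pos.2 (by positivity)
  have hep : ∀ r, 0 < e r := fun r => Real.sqrt_pos.2 (by positivity)
  have he2 : ∀ r, e r ^ 2 = 4 * (s ^ 2 + r ^ 2) + ‖ξ‖ ^ 2 := fun r => Real.sq_sqrt (by positivity)
  have h1 : ∀ η : EuclideanSpace ℝ (Fin d), pairEnergy d s ξ η = e ‖η‖ := fun η => by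
    rw [pairEnergy, psi_sq]
  have h2 : ∀ η : EuclideanSpace ℝ (Fin d), psi d s η = q ‖η‖ := fun η => rfl
  simp_rw [h1, h2]
  have hem : Measurable e := by fun_prop
  rw [lintegral_comp_norm volume
    (f := fun r => ENNReal.ofReal (4 / (2 * q r * e r)) * g (e r)) (by fun_prop)]
  have hde : ∀ r ∈ Set.Ioi (0 : ℝ), HasDerivWithinAt e (4 * r / e r) (Set.Ioi 0) r := by
    intro r _
    have := ((((hasDerivAt_id r).pow 2).const_add (s ^ 2)).const_mul 4).add_const (‖ξ‖ ^ 2)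
    have h3 := (this.sqrt (by simp only [id, Pi.pow_apply]; positivity)).hasDerivWithinAt
      (s := Set.Ioi 0)
    refine h3.congr_deriv ?_
    simp [e]
    field_simp
  have hinj : Set.InjOn e (Set.Ioi 0) := by
    intro r hr r' hr' h
    have h3 := he2 r
    rw [h, he2] at h3
    have : r' ^ 2 = r ^ 2 := by linarith
    exact ((sq_eq_sq₀ (le_of_lt hr') (le_of_lt hr)).1 this).symm
  -- The range of energies is the support of the density: invariant mass above `2s`.
  have himg : e '' Set.Ioi 0 = Set.Ioi (Real.sqrt (4 * s ^ 2 + ‖ξ‖ ^ 2)) := by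
    ext τ
    constructor
    · rintro ⟨r, hr, rfl⟩
      refine Real.sqrt_lt_sqrt (by positivity) ?_
      have : 0 < r ^ 2 := pow_pos hr 2
      linarith
    · intro hτ
      have hτ' : Real.sqrt (4 * s ^ 2 + ‖ξ‖ ^ 2) < τ := hτ
      have hτ0 : 0 < τ := lt_of_le_of_lt (Real.sqrt_nonneg _) hτ'
      have h3 := (Real.sqrt_lt' hτ0).1 hτ'
      have hp : 0 < (τ ^ 2 - ‖ξ‖ ^ 2) / 4 - s ^ 2 := by linarith
      refine ⟨Real.sqrt ((τ ^ 2 - ‖ξ‖ ^ 2) / 4 - s ^ 2), Real.sqrt_pos.2 hp, ?_⟩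
      simp only [he]
      rw [Real.sq_sqrt hp.le, Real.sqrt_eq_iff_mul_self_eq (by positivity) hτ0.le]
      ring
  have h4 : ∫⁻ τ, ENNReal.ofReal (convDensity d s (WithLp.toLp 2 (ξ, τ))) * g τ =
      ∫⁻ τ in Set.Ioi (Real.sqrt (4 * s ^ 2 + ‖ξ‖ ^ 2)),
        ENNReal.ofReal (radialDensity d s (τ ^ 2 - ‖ξ‖ ^ 2)) * g τ := by
    rw [← lintegral_indicator measurableSet_Ioi]
    refine lintegral_congr fun τ => ?_
    by_cases h : Real.sqrt (4 * s ^ 2 + ‖ξ‖ ^ 2) < τ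
    · rw [Set.indicator_of_mem (Set.mem_Ioi.2 h)]
      simp [convDensity, h]
    · rw [Set.indicator_of_notMem (by simpa using h)]
      simp [convDensity, h]
  rw [h4, ← himg, lintegral_image_eq_lintegral_abs_deriv_mul measurableSet_Ioi hde hinj,
    ← lintegral_const_mul _ (by fun_prop)]
  refine setLIntegral_congr_fun measurableSet_Ioi fun r hr => ?_
  have hr0 : 0 < r := hr
  have hqr := hqp r
  have her := hep r
  have harea : (volume : Measure (EuclideanSpace ℝ (Fin d))).toSphere Set.univ =
      ENNReal.ofReal (sphereArea d) := (ENNReal.ofReal_toReal (measure_ne_top _ _)).symm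
  have hpos := sphereArea_pos hd
  rw [harea, ← mul_assoc, ← mul_assoc, ← mul_assoc, ← ENNReal.ofReal_mul hpos.le,
    ← ENNReal.ofReal_mul (by positivity), ← ENNReal.ofReal_mul (abs_nonneg _)]
  congr 2
  rw [abs_of_pos (by positivity), radialDensity, he2]
  have e1 : 4 * (s ^ 2 + r ^ 2) + ‖ξ‖ ^ 2 - ‖ξ‖ ^ 2 = (2 * q r) ^ 2 := by
    rw [mul_pow, hq, Real.sq_sqrt (by positivity)]; ring
  have e2 : (2 * q r) ^ 2 / 4 - s ^ 2 = r ^ 2 := by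
    rw [mul_pow, hq, Real.sq_sqrt (by positivity)]; ring
  rw [e1, e2, Real.sqrt_sq hr0.le, Real.sqrt_sq (by positivity), finrank_euclideanSpace,
    Fintype.card_fin]
  -- The polar Jacobian is `r^(d-1)`; one factor `r` is spent on `dτ = 4r dr/τ`, which leaves the
  -- power `d - 2`.
  have e3 : d - 1 = (d - 2) + 1 := by omega
  rw [e3, pow_succ]
  field_simp

theorem lintegral_sigmaPlus {d : ℕ} {s : ℝ} {g : Spacetime d → ℝ≥0∞} (hg : Measurable g) :
    ∫⁻ ζ, g ζ ∂sigmaPlus d s =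
      ∫⁻ y, ENNReal.ofReal (1 / psi d s y) * g (upperMap d s y) := by
  have hψ := (continuous_psi d s).measurable
  have hu := (continuous_upperMap d s).measurable
  rw [sigmaPlus, lintegral_map hg hu, baseMeasure,
    lintegral_withDensity_eq_lintegral_mul _ (by fun_prop) (by fun_prop)]
  rfl

theorem lintegral_spacetime {d : ℕ} {g : Spacetime d → ℝ≥0∞} (hg : Measurable g) :
    ∫⁻ ζ, g ζ = ∫⁻ ξ : EuclideanSpace ℝ (Fin d), ∫⁻ τ : ℝ, g (WithLp.toLp 2 (ξ, τ)) := by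
  have h := (WithLp.volume_preserving_toLp (EuclideanSpace ℝ (Fin d)) ℝ)
  rw [← h.lintegral_comp hg, Measure.volume_eq_prod, lintegral_prod _ (by fun_prop)]

/-- `σ_s^+ ∗ σ_s^+` is absolutely continuous, with density `convDensity`. -/
theorem lintegral_lintegral_sigmaPlus_add {d : ℕ} (hd : 2 ≤ d) {s : ℝ} (hs : 0 < s)
    {g : Spacetime d → ℝ≥0∞} (hg : Measurable g) :
    ∫⁻ ζ, ∫⁻ ζ', g (ζ + ζ') ∂sigmaPlus d s ∂sigmaPlus d s =
      ∫⁻ ζ, ENNReal.ofReal (convDensity d s ζ) * g ζ := by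
  have : NeZero d := ⟨by omega⟩
  have hψ := (continuous_psi d s).measurable
  have hu := (continuous_upperMap d s).measurable
  have hk := measurable_convDensity d s
  have hW : Measurable (fun p : EuclideanSpace ℝ (Fin d) × ℝ =>
    (WithLp.toLp 2 p : Spacetime d)) := (WithLp.prod_continuous_toLp 2 _ _).measurable
  have hadd : ∀ x y, upperMap d s x + upperMap d s y =
      WithLp.toLp 2 (x + y, psi d s x + psi d s y) := fun x y => rfl
  have h0 : SFinite (sigmaPlus d s) := by
    unfold sigmaPlus baseMeasure; infer_instance
  rw [lintegral_sigmaPlus (by fun_prop)]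
  have h1 : ∀ x : EuclideanSpace ℝ (Fin d),
      ∫⁻ ζ', g (upperMap d s x + ζ') ∂sigmaPlus d s = ∫⁻ ξ, ENNReal.ofReal (1 / psi d s (ξ - x)) *
        g (WithLp.toLp 2 (ξ, psi d s x + psi d s (ξ - x))) := by
    intro x
    rw [lintegral_sigmaPlus (by fun_prop)]
    -- Substitute the total momentum `ξ = x + y` for `y`.
    rw [← lintegral_sub_right_eq_self _ x]
    refine lintegral_congr fun ξ => ?_
    rw [hadd]; simp
  simp_rw [h1]
  have h2 : ∀ x : EuclideanSpace ℝ (Fin d), Measurable fun ξ : EuclideanSpace ℝ (Fin d) =>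
      ENNReal.ofReal (1 / psi d s (ξ - x)) *
        g (WithLp.toLp 2 (ξ, psi d s x + psi d s (ξ - x))) := by
    intro x; fun_prop
  have h3 := fun x =>
    (lintegral_const_mul (μ := volume) (ENNReal.ofReal (1 / psi d s x)) (h2 x)).symm
  simp_rw [h3]
  rw [lintegral_lintegral_swap (by fun_prop), lintegral_spacetime (by fun_prop)]
  refine lintegral_congr_ae ?_
  -- The boost formulas divide by `|ξ|²`; the excluded point `ξ = 0` is null.
  filter_upwards [compl_mem_ae_iff.2 (measure_singleton (0 : EuclideanSpace ℝ (Fin d)))] with ξ hξ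
  have hξ0 : ξ ≠ 0 := hξ
  rw [← lintegral_pairEnergy hd hs ξ (g := fun τ => g (WithLp.toLp 2 (ξ, τ))) (by fun_prop),
    ← lintegral_boost hs hξ0 fun τ => g (WithLp.toLp 2 (ξ, τ))]
  refine lintegral_congr fun x => ?_
  rw [← mul_assoc, ← ENNReal.ofReal_mul (by have := psi_pos d hs x; positivity)]

/-! ### Fourier analysis on space-time -/

theorem finrank_spacetime (d : ℕ) : Module.finrank ℝ (Spacetime d) = d + 1 := by
  rw [(WithLp.linearEquiv 2 ℝ (EuclideanSpace ℝ (Fin d) × ℝ)).finrank_eq]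
  simp

theorem expTransform_apply' (d : ℕ) (φ : 𝓢(Spacetime d, ℂ)) (ζ : Spacetime d) :
    expTransform d φ ζ = (𝓕⁻ φ) ((2 * Real.pi)⁻¹ • ζ) := rfl

theorem expTransform_fourier (d : ℕ) (ψ : 𝓢(Spacetime d, ℂ)) (ζ : Spacetime d) :
    expTransform d (𝓕 ψ) ζ = ψ ((2 * Real.pi)⁻¹ • ζ) := by
  rw [expTransform_apply', FourierTransform.fourierInv_fourier_eq]

theorem expTransform_surjective (d : ℕ) : Function.Surjective (expTransform d) := by
  intro ψ
  refine ⟨𝓕 (SchwartzMap.compCLMOfContinuousLinearEquiv ℂ (dilation d).symm ψ), ?_⟩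
  ext ζ
  rw [expTransform_fourier]
  exact congrArg ψ ((dilation d).symm_apply_apply ζ)

theorem norm_toLp_two_sq {d : ℕ} (φ : 𝓢(Spacetime d, ℂ)) :
    ‖φ.toLp 2‖ ^ 2 = ∫ z, ‖φ z‖ ^ 2 := by
  rw [SchwartzMap.norm_toLp' two_ne_zero ENNReal.ofNat_ne_top]
  simp only [ENNReal.toReal_ofNat, Real.rpow_ofNat]
  rw [← Real.rpow_natCast, ← Real.rpow_mul (integral_nonneg fun z => by positivity)]
  norm_num

/-- Plancherel's theorem for `expTransform`. -/
theorem norm_expTransform_sq {d : ℕ} (φ : 𝓢(Spacetime d, ℂ)) :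
    ‖(expTransform d φ).toLp 2‖ ^ 2 = (2 * Real.pi) ^ (d + 1) * ‖φ.toLp 2‖ ^ 2 := by
  rw [norm_toLp_two_sq]
  simp_rw [expTransform_apply']
  have h := Measure.integral_comp_smul (volume : Measure (Spacetime d))
    (fun z => ‖(𝓕⁻ φ) z‖ ^ 2) ((2 * Real.pi)⁻¹)
  rw [h, ← norm_toLp_two_sq,
    finrank_spacetime, ← SchwartzMap.norm_fourier_toL2_eq (𝓕⁻ φ),
    FourierTransform.fourier_fourierInv_eq]
  have := Real.pi_pos
  rw [abs_of_pos (by positivity), inv_pow, inv_inv, smul_eq_mul]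

/-- A function that acts boundedly on Schwartz functions in the `L²` norm is in `L²`. -/
theorem memLp_two_of_schwartz {d : ℕ} {G : Spacetime d → ℂ} {C : ℝ} (hC : 0 ≤ C)
    (hG : LocallyIntegrable G) (hi : ∀ φ : 𝓢(Spacetime d, ℂ), Integrable fun z => φ z * G z)
    (h : ∀ φ : 𝓢(Spacetime d, ℂ), ‖∫ z, φ z * G z‖ ≤ C * ‖φ.toLp 2‖) :
    MemLp G 2 ∧ eLpNorm G 2 ≤ ENNReal.ofReal C := by
  set ℓ : 𝓢(Spacetime d, ℂ) →ₗ[ℂ] ℂ :=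
    { toFun := fun φ => ∫ z, φ z * G z
      map_add' := fun φ ψ => by
        simp only [add_apply, add_mul]
        exact integral_add (hi φ) (hi ψ)
      map_smul' := fun c φ => by
        simp only [smul_apply, smul_eq_mul, mul_assoc, RingHom.id_apply]
        exact integral_const_mul _ _ } with hℓ
  set e : 𝓢(Spacetime d, ℂ) →ₗ[ℂ] Lp ℂ 2 (volume : Measure (Spacetime d)) :=
    (SchwartzMap.toLpCLM ℂ ℂ 2 volume).toLinearMap with he
  have hd : DenseRange e := SchwartzMap.denseRange_toLpCLM (p := 2) ENNReal.ofNat_ne_top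
  have hb : ∀ φ, ‖ℓ φ‖ ≤ C * ‖e φ‖ := h
  -- The functional extends to `L²` by density of Schwartz functions, and Riesz represents it. The
  -- inner product is conjugate linear in its first slot, so the candidate for `G` is `conj H`.
  set H := (InnerProductSpace.toDual ℂ _).symm (ℓ.extendOfNorm e) with hH
  have hHn : ‖H‖ ≤ C := by
    rw [hH, LinearIsometryEquiv.norm_map]
    exact LinearMap.opNorm_extendOfNorm_le hd hC hb
  have hHφ : ∀ φ : 𝓢(Spacetime d, ℂ), ∫ z, φ z * (starRingEnd ℂ) (H z) = ∫ z, φ z * G z := by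
    intro φ
    have h1 : inner ℂ H (e φ) = ℓ φ := by
      rw [hH, InnerProductSpace.toDual_symm_apply, LinearMap.extendOfNorm_eq hd ⟨C, hb⟩]
    rw [L2.inner_def] at h1
    refine Eq.trans ?_ h1
    refine integral_congr_ae ?_
    filter_upwards [SchwartzMap.coeFn_toLp φ 2 volume] with z hz
    rw [he]
    simp only [ContinuousLinearMap.coe_coe, SchwartzMap.toLpCLM_apply]
    rw [hz]
    simp
  have hstar : MemLp (fun z => (starRingEnd ℂ) (H z)) 2 volume := (Lp.memLp H).star
  have hae : ∀ᵐ z, G z = (starRingEnd ℂ) (H z) := by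
    refine ae_eq_of_integral_contDiff_smul_eq hG (hstar.locallyIntegrable (by norm_num)) ?_
    intro g hg hgc
    have hg1 : HasCompactSupport (Complex.ofRealCLM ∘ g) := hgc.comp_left rfl
    have hg2 : ContDiff ℝ ((⊤ : ℕ∞) : WithTop ℕ∞) (Complex.ofRealCLM ∘ g) := Complex.ofRealCLM.contDiff.comp hg
    exact (hHφ (hg1.toSchwartzMap hg2)).symm
  refine ⟨hstar.ae_eq (by filter_upwards [hae] with z hz using hz.symm), ?_⟩
  rw [eLpNorm_congr_norm_ae (g := H) (by filter_upwards [hae] with z hz; simp [hz])]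
  rw [← Lp.enorm_def, ← ofReal_norm]
  exact ENNReal.ofReal_le_ofReal hHn

/-- Square integrable functions with disjoint closed Fourier supports are orthogonal. -/
theorem inner_eq_zero_of_disjoint_fourier_support {d : ℕ} {A₁ A₂ : Set (Spacetime d)}
    (h₁ : IsClosed A₁) (h₂ : IsClosed A₂) (hA : Disjoint A₁ A₂)
    {G₁ G₂ : Lp ℂ 2 (volume : Measure (Spacetime d))}
    (hG₁ : ∀ φ : 𝓢(Spacetime d, ℂ), (∀ ζ ∈ A₁, expTransform d φ ζ = 0) → ∫ z, φ z * G₁ z = 0)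
    (hG₂ : ∀ φ : 𝓢(Spacetime d, ℂ), (∀ ζ ∈ A₂, expTransform d φ ζ = 0) → ∫ z, φ z * G₂ z = 0) :
    (inner ℂ G₁ G₂ : ℂ) = 0 := by
  -- The transform `𝓕` carries `2π` in its exponent, so a spectrum in `A` means that `𝓕 G` vanishes
  -- almost everywhere off `A/(2π)`. The test functions are `φ = 𝓕 ψ`, with `ψ` smooth and compactly
  -- supported off `A/(2π)`.
  have key : ∀ {A : Set (Spacetime d)} (_ : IsClosed A)
      {G : Lp ℂ 2 (volume : Measure (Spacetime d))}
      (_ : ∀ φ : 𝓢(Spacetime d, ℂ), (∀ ζ ∈ A, expTransform d φ ζ = 0) → ∫ z, φ z * G z = 0),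
      ∀ᵐ x, (2 * Real.pi) • x ∉ A →
        (𝓕 G : Lp ℂ 2 (volume : Measure (Spacetime d))) x = 0 := by
    intro A hA G hG
    set H : Lp ℂ 2 (volume : Measure (Spacetime d)) := 𝓕 G with hH
    have hU : IsOpen {x : Spacetime d | (2 * Real.pi) • x ∉ A} :=
      hA.isOpen_compl.preimage (continuous_const_smul _)
    refine hU.ae_eq_zero_of_integral_contDiff_smul_eq_zero
      (((Lp.memLp H).locallyIntegrable (by norm_num)).locallyIntegrableOn _) ?_
    intro g hg hgc hgs
    have hg1 : HasCompactSupport (Complex.ofRealCLM ∘ g) := hgc.comp_left rfl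
    have hg2 : ContDiff ℝ ((⊤ : ℕ∞) : WithTop ℕ∞) (Complex.ofRealCLM ∘ g) := Complex.ofRealCLM.contDiff.comp hg
    set ψ : 𝓢(Spacetime d, ℂ) := hg1.toSchwartzMap hg2 with hψ
    have h3 : (Lp.toTemperedDistribution H) ψ = (Lp.toTemperedDistribution G) (𝓕 ψ) := by
      rw [hH, ← Lp.fourier_toTemperedDistribution_eq]; rfl
    rw [Lp.toTemperedDistribution_apply, Lp.toTemperedDistribution_apply] at h3
    have h4 : ∫ z, (𝓕 ψ) z * G z = 0 := by
      refine hG _ fun ζ hζ => ?_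
      rw [expTransform_fourier]
      have h5 : (2 * Real.pi)⁻¹ • ζ ∉ tsupport g := fun hmem => by
        have := hgs hmem
        simp only [Set.mem_ofPred_eq] at this
        rw [smul_inv_smul₀ (by positivity)] at this
        exact this hζ
      change ((g ((2 * Real.pi)⁻¹ • ζ) : ℝ) : ℂ) = 0
      rw [image_eq_zero_of_notMem_tsupport h5, Complex.ofReal_zero]
    exact h3.trans h4
  rw [← Lp.inner_fourier_eq, L2.inner_def]
  refine integral_eq_zero_of_ae ?_
  filter_upwards [key h₁ hG₁, key h₂ hG₂] with x hx₁ hx₂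
  by_cases h : (2 * Real.pi) • x ∈ A₁
  · rw [hx₂ (hA.notMem_of_mem_left h)]; simp
  · rw [hx₁ h]; simp

/-! ### Oscillatory integrals -/

/-- `z ↦ ∫ e^{i z·P(ω)} h(ω) dm(ω)`. -/
def oscIntegral {d : ℕ} {Ω : Type*} [MeasurableSpace Ω] (m : Measure Ω) (P : Ω → Spacetime d)
    (h : Ω → ℂ) (z : Spacetime d) : ℂ :=
  ∫ ω, Complex.exp (Complex.I * (inner ℝ z (P ω) : ℝ)) * h ω ∂m

section Osc

variable {d : ℕ} {Ω : Type*} [MeasurableSpace Ω] {m : Measure Ω} {P : Ω → Spacetime d} {h : Ω → ℂ}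

theorem norm_exp_I_mul (t : ℝ) : ‖Complex.exp (Complex.I * t)‖ = 1 := by
  rw [mul_comm, Complex.norm_exp_ofReal_mul_I]

theorem norm_oscIntegral_le (z : Spacetime d) : ‖oscIntegral m P h z‖ ≤ ∫ ω, ‖h ω‖ ∂m := by
  refine (norm_integral_le_integral_norm _).trans_eq ?_
  simp_rw [norm_mul, norm_exp_I_mul, one_mul]

theorem continuous_oscIntegral (hP : Measurable P) (hh : Integrable h m) :
    Continuous (oscIntegral m P h) := by
  refine continuous_of_dominated (bound := fun ω => ‖h ω‖) ?_ ?_ hh.norm ?_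
  · intro z
    have : Measurable fun ω => Complex.exp (Complex.I * (inner ℝ z (P ω) : ℝ)) := by fun_prop
    exact this.aestronglyMeasurable.mul hh.aestronglyMeasurable
  · intro z
    refine Eventually.of_forall fun ω => ?_
    rw [norm_mul, norm_exp_I_mul, one_mul]
  · refine Eventually.of_forall fun ω => ?_
    fun_prop

theorem integrable_schwartz_mul_oscIntegral (hP : Measurable P) (hh : Integrable h m)
    (φ : 𝓢(Spacetime d, ℂ)) : Integrable fun z => φ z * oscIntegral m P h z :=
  φ.integrable.mul_bdd (c := ∫ ω, ‖h ω‖ ∂m) (continuous_oscIntegral hP hh).aestronglyMeasurable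
    (Eventually.of_forall fun z => norm_oscIntegral_le z)

/-- The tempered distribution `oscIntegral m P h` is the Fourier transform of a measure. -/
theorem integral_schwartz_mul_oscIntegral [SFinite m] (hP : Measurable P) (hh : Integrable h m)
    (φ : 𝓢(Spacetime d, ℂ)) :
    ∫ z, φ z * oscIntegral m P h z = ∫ ω, expTransform d φ (P ω) * h ω ∂m := by
  have hint : Integrable (fun p : Spacetime d × Ω =>
      φ p.1 * (Complex.exp (Complex.I * (inner ℝ p.1 (P p.2) : ℝ)) * h p.2))
      (volume.prod m) := by
    have h1 : Integrable (fun p : Spacetime d × Ω => φ p.1 * h p.2) (volume.prod m) :=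
      φ.integrable.mul_prod hh
    have h2 : Measurable fun p : Spacetime d × Ω =>
      Complex.exp (Complex.I * (inner ℝ p.1 (P p.2) : ℝ)) := by fun_prop
    refine (h1.bdd_mul (c := 1) h2.aestronglyMeasurable
      (Eventually.of_forall fun p => (norm_exp_I_mul _).le)).congr
      (Eventually.of_forall fun p => ?_)
    ring
  simp only [oscIntegral, ← integral_const_mul]
  rw [integral_integral_swap hint]
  refine integral_congr_ae (Eventually.of_forall fun ω => ?_)
  simp only
  rw [expTransform_apply, ← integral_mul_const]
  refine integral_congr_ae (Eventually.of_forall fun z => ?_)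
  simp only
  ring

/-- Multiplication on the Fourier side of a convolution, with the convolution kept as a product
measure together with the sum map. The density of `σ⁺ ∗ σ⁺` is thus needed only where it is
estimated. -/
theorem oscIntegral_mul {Ω' : Type*} [MeasurableSpace Ω'] {m' : Measure Ω'} [SFinite m]
    [SFinite m'] {P' : Ω' → Spacetime d} {h' : Ω' → ℂ} (z : Spacetime d) :
    oscIntegral m P h z * oscIntegral m' P' h' z =
      oscIntegral (m.prod m') (fun p => P p.1 + P' p.2) (fun p => h p.1 * h' p.2) z := by
  rw [oscIntegral, oscIntegral, ← integral_prod_mul, oscIntegral]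
  refine integral_congr_ae (Eventually.of_forall fun p => ?_)
  simp only [inner_add_right]
  push_cast
  rw [mul_add, Complex.exp_add]
  ring

end Osc

/-! ### Norms -/

theorem eLpNorm_two_pow {α : Type*} [MeasurableSpace α] {μ : Measure α} (f : α → ℂ) :
    eLpNorm f 2 μ ^ 2 = ∫⁻ x, ‖f x‖ₑ ^ 2 ∂μ := by
  have := eLpNorm_nnreal_pow_eq_lintegral (μ := μ) (f := f) (p := 2) two_ne_zero
  simpa using this

theorem eLpNorm_four_pow {α : Type*} [MeasurableSpace α] {μ : Measure α} (f : α → ℂ) :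
    eLpNorm f 4 μ ^ 4 = ∫⁻ x, ‖f x‖ₑ ^ 4 ∂μ := by
  have := eLpNorm_nnreal_pow_eq_lintegral (μ := μ) (f := f) (p := 4) four_ne_zero
  simpa using this

theorem enorm_two_pow {α : Type*} [MeasurableSpace α] {μ : Measure α} (f : Lp ℂ 2 μ) :
    ‖f‖ₑ ^ 2 = ∫⁻ x, ‖f x‖ₑ ^ 2 ∂μ := by
  rw [Lp.enorm_def, eLpNorm_two_pow]

theorem enorm_four_pow {α : Type*} [MeasurableSpace α] {μ : Measure α} (f : Lp ℂ 4 μ) :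
    ‖f‖ₑ ^ 4 = ∫⁻ x, ‖f x‖ₑ ^ 4 ∂μ := by
  rw [Lp.enorm_def, eLpNorm_four_pow]

theorem toTemperedDistribution_injective {d : ℕ} (p : ℝ≥0∞) [Fact (1 ≤ p)] :
    Function.Injective
      (Lp.toTemperedDistribution : Lp ℂ p (volume : Measure (Spacetime d)) → _) := by
  have h := LinearMap.ker_eq_bot.1
    (Lp.ker_toTemperedDistributionCLM_eq_bot (F := ℂ) (p := p)
      (μ := (volume : Measure (Spacetime d))))
  exact h

/-- A tempered distribution has at most one `L^p` representative, so the infimum runs over a single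
function. -/
theorem distLpNorm_eq {d : ℕ} {p : ℝ≥0∞} [Fact (1 ≤ p)] {u : 𝓢'(Spacetime d, ℂ)}
    {F : Lp ℂ p (volume : Measure (Spacetime d))} (h : Lp.toTemperedDistribution F = u) :
    distLpNorm p u = ‖F‖ₑ := by
  refine le_antisymm (iInf₂_le F h) (le_iInf₂ fun F' h' => ?_)
  rw [toTemperedDistribution_injective p (h'.trans h.symm)]

/-! ### The extension operator -/

section Extension

variable {d : ℕ} {μ : Measure (Spacetime d)}

/-- Square integrable functions are limits of integrable ones of smaller modulus. -/
theorem exists_integrable_tendsto (f : Lp ℂ 2 μ) :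
    ∃ u : ℕ → Lp ℂ 2 μ, (∀ n, Integrable (u n) μ) ∧ (∀ n, ∀ᵐ x ∂μ, ‖u n x‖ₑ ≤ ‖f x‖ₑ) ∧
      Tendsto u atTop (𝓝 f) := by
  have hfm : StronglyMeasurable f := Lp.stronglyMeasurable f
  -- By Chebyshev these sets have finite measure, so the truncations are integrable. Truncation does
  -- not increase the modulus, which later lets `convForm` of the approximants be bounded by that of
  -- `f`.
  set S : ℕ → Set (Spacetime d) := fun n => {x | (1 : ℝ) / (n + 1) ≤ ‖f x‖} with hS
  have hSm : ∀ n, MeasurableSet (S n) := fun n =>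
    measurableSet_le measurable_const hfm.norm.measurable
  have hfin : ∀ n, μ (S n) < ∞ := by
    intro n
    have hpos : (0 : ℝ) < 1 / (n + 1) := by positivity
    have h := (Lp.memLp f).meas_ge_lt_top two_ne_zero ENNReal.ofNat_ne_top
      (ε := Real.toNNReal (1 / (n + 1))) (Real.toNNReal_pos.2 hpos).ne'
    refine lt_of_le_of_lt (measure_mono fun x hx => ?_) h
    exact Real.toNNReal_le_iff_le_coe.2 hx
  have hmem : ∀ n, MemLp ((S n).indicator f) 2 μ := fun n => (Lp.memLp f).indicator (hSm n)
  refine ⟨fun n => (hmem n).toLp, fun n => ?_, fun n => ?_, ?_⟩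
  · refine Integrable.congr ?_ (hmem n).coeFn_toLp.symm
    rw [integrable_indicator_iff (hSm n)]
    have : IsFiniteMeasure (μ.restrict (S n)) := ⟨by simpa using hfin n⟩
    exact ((Lp.memLp f).restrict (S n)).integrable one_le_two
  · filter_upwards [(hmem n).coeFn_toLp] with x hx
    rw [hx]
    exact enorm_indicator_le_enorm_self _ _
  · rw [Lp.tendsto_Lp_iff_tendsto_eLpNorm']
    have h0 : ∀ n, eLpNorm (⇑(hmem n).toLp - ⇑f) 2 μ =
        (∫⁻ x, ‖(S n)ᶜ.indicator f x‖ₑ ^ 2 ∂μ) ^ (1 / 2 : ℝ) := by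
      intro n
      have h1 : ⇑(hmem n).toLp - ⇑f =ᵐ[μ] fun x => - (S n)ᶜ.indicator f x := by
        filter_upwards [(hmem n).coeFn_toLp] with x hx
        rw [Pi.sub_apply, hx]
        by_cases hxS : x ∈ S n <;> simp [hxS]
      rw [eLpNorm_congr_ae h1, ← eLpNorm_two_pow, ← ENNReal.rpow_natCast, ← ENNReal.rpow_mul]
      norm_num
      exact eLpNorm_neg _ _ _
    simp_rw [h0]
    have h2 : Tendsto (fun n => ∫⁻ x, ‖(S n)ᶜ.indicator f x‖ₑ ^ 2 ∂μ) atTop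
        (𝓝 (∫⁻ _, 0 ∂μ)) := by
      refine tendsto_lintegral_of_dominated_convergence (fun x => ‖f x‖ₑ ^ 2) ?_ ?_ ?_ ?_
      · intro n
        exact ((hfm.measurable.indicator (hSm n).compl).enorm).pow_const 2
      · intro n
        refine Eventually.of_forall fun x => ?_
        exact pow_le_pow_left₀ (by simp) (enorm_indicator_le_enorm_self _ _) 2
      · rw [← enorm_two_pow]
        exact ENNReal.pow_ne_top enorm_ne_top
      · refine Eventually.of_forall fun x => ?_
        refine tendsto_const_nhds.congr' ?_
        by_cases hx : f x = 0
        · refine Eventually.of_forall fun n => ?_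
          simp [Set.indicator, hx]
        · have hp : 0 < ‖f x‖ := norm_pos_iff.2 hx
          have := tendsto_one_div_add_atTop_nhds_zero_nat (𝕜 := ℝ)
          filter_upwards [this.eventually (gt_mem_nhds hp)] with n hn
          have : x ∈ S n := hn.le
          simp [this]
    have h3 := h2.ennrpow_const (1 / 2 : ℝ)
    simpa using h3

variable (μ) in
/-- The integrable functions in `L²`. -/
def integrableSubmodule : Submodule ℂ (Lp ℂ 2 μ) where
  carrier := {f | Integrable f μ}
  zero_mem' := (integrable_zero _ _ _).congr (Lp.coeFn_zero _ _ _).symm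
  add_mem' := fun {f g} hf hg => (hf.add hg).congr (Lp.coeFn_add f g).symm
  smul_mem' := fun c f hf => (hf.smul c).congr (Lp.coeFn_smul c f).symm

theorem denseRange_integrableSubmodule :
    DenseRange (integrableSubmodule μ).subtype := by
  intro f
  obtain ⟨u, hu, -, hlim⟩ := exists_integrable_tendsto f
  exact mem_closure_of_tendsto hlim (Eventually.of_forall fun n => ⟨⟨u n, hu n⟩, rfl⟩)

variable [μ.HasTemperateGrowth]

theorem adjointRestriction_add (f g : Lp ℂ 2 μ) :
    adjointRestriction (f + g) = adjointRestriction f + adjointRestriction g := by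
  ext φ
  have := map_add (Lp.toTemperedDistributionCLM ℂ μ 2) f g
  exact congrArg (fun u : 𝓢'(Spacetime d, ℂ) => u (expTransform d φ)) this

theorem adjointRestriction_smul (c : ℂ) (f : Lp ℂ 2 μ) :
    adjointRestriction (c • f) = c • adjointRestriction f := by
  ext φ
  have := map_smul (Lp.toTemperedDistributionCLM ℂ μ 2) c f
  exact congrArg (fun u : 𝓢'(Spacetime d, ℂ) => u (expTransform d φ)) this

theorem continuous_adjointRestriction_apply (φ : 𝓢(Spacetime d, ℂ)) :
    Continuous fun f : Lp ℂ 2 μ => adjointRestriction f φ := by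
  have h1 := (Lp.toTemperedDistributionCLM ℂ μ 2).continuous
  have h2 : Continuous fun u : 𝓢'(Spacetime d, ℂ) => u (expTransform d φ) :=
    (PointwiseConvergenceCLM.evalCLM (RingHom.id ℂ) ℂ (expTransform d φ)).continuous
  exact h2.comp h1

/-- For integrable `f`, the distribution `T f` is a bounded continuous function. -/
theorem adjointRestriction_apply_of_integrable [SFinite μ] {f : Lp ℂ 2 μ} (hf : Integrable f μ)
    (φ : 𝓢(Spacetime d, ℂ)) : adjointRestriction f φ = ∫ z, φ z * oscIntegral μ id f z := by
  rw [integral_schwartz_mul_oscIntegral measurable_id hf]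
  exact Lp.toTemperedDistribution_apply f (expTransform d φ)

theorem toTemperedDistribution_toLp_oscIntegral [SFinite μ] {f : Lp ℂ 2 μ} (hf : Integrable f μ)
    {p : ℝ≥0∞} [Fact (1 ≤ p)] (h : MemLp (oscIntegral μ id f) p) :
    Lp.toTemperedDistribution h.toLp = adjointRestriction f := by
  ext φ
  rw [Lp.toTemperedDistribution_apply, adjointRestriction_apply_of_integrable hf]
  refine integral_congr_ae ?_
  filter_upwards [h.coeFn_toLp] with z hz
  rw [hz, smul_eq_mul]

/-- A bound on integrable functions gives a bounded extension operator. -/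
theorem exists_extension [SFinite μ] {C : ℝ} (hC : 0 ≤ C)
    (h : ∀ f : Lp ℂ 2 μ, Integrable f μ → MemLp (oscIntegral μ id f) 4 ∧
      eLpNorm (oscIntegral μ id f) 4 ≤ ENNReal.ofReal C * ‖f‖ₑ) :
    ∃ E : Lp ℂ 2 μ →L[ℂ] Lp ℂ 4 (volume : Measure (Spacetime d)),
      ∀ f, Lp.toTemperedDistribution (E f) = adjointRestriction f := by
  set T : integrableSubmodule μ →ₗ[ℂ] Lp ℂ 4 (volume : Measure (Spacetime d)) :=
    { toFun := fun f => (h f f.2).1.toLp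
      map_add' := fun f g => by
        -- Linearity is checked among distributions, where it is already known, and pulled back by
        -- uniqueness of representatives.
        refine toTemperedDistribution_injective 4 ?_
        have := map_add (Lp.toTemperedDistributionCLM ℂ (volume : Measure (Spacetime d)) 4)
          (h f f.2).1.toLp (h g g.2).1.toLp
        simp only [Lp.toTemperedDistributionCLM_apply] at this
        rw [this, toTemperedDistribution_toLp_oscIntegral f.2,
          toTemperedDistribution_toLp_oscIntegral g.2,
          toTemperedDistribution_toLp_oscIntegral (f + g).2, ← adjointRestriction_add]
        rfl
      map_smul' := fun c f => by
        refine toTemperedDistribution_injective 4 ?_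
        have := map_smul (Lp.toTemperedDistributionCLM ℂ (volume : Measure (Spacetime d)) 4)
          c (h f f.2).1.toLp
        simp only [Lp.toTemperedDistributionCLM_apply] at this
        rw [RingHom.id_apply, this, toTemperedDistribution_toLp_oscIntegral f.2,
          toTemperedDistribution_toLp_oscIntegral (c • f).2, ← adjointRestriction_smul]
        rfl } with hT
  have hd := denseRange_integrableSubmodule (μ := μ)
  have hb : ∀ f, ‖T f‖ ≤ C * ‖(integrableSubmodule μ).subtype f‖ := by
    intro f
    have h1 : ‖T f‖ₑ ≤ ENNReal.ofReal C * ‖(f : Lp ℂ 2 μ)‖ₑ := by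
      rw [Lp.enorm_def]
      exact (eLpNorm_congr_ae (h f f.2).1.coeFn_toLp).trans_le (h f f.2).2
    rw [← ofReal_norm, ← ofReal_norm, ← ENNReal.ofReal_mul hC,
      ENNReal.ofReal_le_ofReal_iff (by positivity)] at h1
    exact h1
  refine ⟨T.extendOfNorm (integrableSubmodule μ).subtype, fun f => ?_⟩
  ext φ
  -- Tested against a fixed `φ`, both sides are continuous in `f` and agree on the dense subspace of
  -- integrable functions.
  refine hd.induction_on (p := fun f => (Lp.toTemperedDistribution
    (T.extendOfNorm (integrableSubmodule μ).subtype f)) φ = adjointRestriction f φ) f ?_ ?_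
  · refine isClosed_eq ?_ (continuous_adjointRestriction_apply φ)
    have h1 := (Lp.toTemperedDistributionCLM ℂ (volume : Measure (Spacetime d)) 4).continuous
    have h2 : Continuous fun u : 𝓢'(Spacetime d, ℂ) => u φ :=
      (PointwiseConvergenceCLM.evalCLM (RingHom.id ℂ) ℂ φ).continuous
    exact h2.comp (h1.comp (T.extendOfNorm (integrableSubmodule μ).subtype).continuous)
  · intro f
    rw [LinearMap.extendOfNorm_eq hd ⟨C, hb⟩]
    exact congrArg (fun u : 𝓢'(Spacetime d, ℂ) => u φ)
      (toTemperedDistribution_toLp_oscIntegral f.2 (h f f.2).1)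

theorem extension_ae_eq [SFinite μ]
    {E : Lp ℂ 2 μ →L[ℂ] Lp ℂ 4 (volume : Measure (Spacetime d))}
    (hE : ∀ f, Lp.toTemperedDistribution (E f) = adjointRestriction f) {f : Lp ℂ 2 μ}
    (hf : Integrable f μ) (h : MemLp (oscIntegral μ id f) 4) :
    E f =ᵐ[volume] oscIntegral μ id f := by
  have : E f = h.toLp := toTemperedDistribution_injective 4
    ((hE f).trans (toTemperedDistribution_toLp_oscIntegral hf h).symm)
  rw [this]
  exact h.coeFn_toLp

end Extension

/-! ### The bilinear estimate on the upper sheet -/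

instance (d : ℕ) (s : ℝ) : SFinite (sigmaPlus d s) := by
  unfold sigmaPlus baseMeasure; infer_instance

instance (d : ℕ) (s : ℝ) : SFinite (sigmaMinus d s) := by
  unfold sigmaMinus baseMeasure; infer_instance

theorem sq_lintegral_mul_le {α : Type*} [MeasurableSpace α] {μ : Measure α} {f g : α → ℝ≥0∞}
    (hf : AEMeasurable f μ) (hg : AEMeasurable g μ) :
    (∫⁻ a, f a * g a ∂μ) ^ 2 ≤ (∫⁻ a, f a ^ 2 ∂μ) * ∫⁻ a, g a ^ 2 ∂μ := by
  have h := ENNReal.lintegral_mul_le_Lp_mul_Lq μ Real.HolderConjugate.two_two hf hg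
  have h2 := pow_le_pow_left₀ (by simp) h 2
  refine h2.trans_eq ?_
  rw [mul_pow, ← ENNReal.rpow_natCast, ← ENNReal.rpow_natCast, ← ENNReal.rpow_mul,
    ← ENNReal.rpow_mul]
  norm_num

/-- The supremum of the density of `σ_s^+ ∗ σ_s^+` for `d = 2, 3`. -/
def densityBound (d : ℕ) (s : ℝ) : ℝ :=
  if d = 2 then sphereArea d / (2 * s) else sphereArea d / 2

theorem densityBound_pos {d : ℕ} (hd : d = 2 ∨ d = 3) {s : ℝ} (hs : 0 < s) :
    0 < densityBound d s := by
  have := sphereArea_pos (d := d) (by omega)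
  unfold densityBound; split_ifs <;> positivity

/-- In terms of the invariant mass `m > 2s`, the density is `A/m` for `d = 2` and `A√(m²/4 - s²)/m`
for `d = 3`, with `A` the sphere area. The supremum is approached only as `m → 2s`, respectively `m
→ ∞`, and is not attained. -/
theorem convDensity_lt {d : ℕ} (hd : d = 2 ∨ d = 3) {s : ℝ} (hs : 0 < s) (ζ : Spacetime d) :
    convDensity d s ζ < densityBound d s := by
  have hA := sphereArea_pos (d := d) (by omega)
  unfold convDensity
  split_ifs with h
  swap
  · exact densityBound_pos hd hs
  have hτ : 0 < ζ.snd := lt_of_le_of_lt (Real.sqrt_nonneg _) h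
  have h1 := (Real.sqrt_lt' hτ).1 h
  unfold radialDensity
  set m2 := ζ.snd ^ 2 - ‖ζ.fst‖ ^ 2
  have h2 : (2 * s) ^ 2 < m2 := by simp only [m2]; linarith
  have hm : 2 * s < Real.sqrt m2 := Real.lt_sqrt_of_sq_lt h2
  have hm0 : 0 < Real.sqrt m2 := by linarith
  unfold densityBound
  rcases hd with rfl | rfl
  · simp only [le_refl, tsub_eq_zero_of_le, pow_zero, if_true]
    rw [mul_one_div]
    exact div_lt_div_of_pos_left hA (by positivity) hm
  · norm_num
    rw [div_eq_mul_one_div (sphereArea 3)]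
    refine mul_lt_mul_of_pos_left ?_ hA
    rw [div_lt_div_iff₀ hm0 two_pos, one_mul, ← lt_div_iff₀ two_pos,
      Real.sqrt_lt' (by positivity), div_pow, Real.sq_sqrt (by nlinarith)]
    nlinarith

theorem lintegral_prod_sigmaPlus_add {d : ℕ} (hd : 2 ≤ d) {s : ℝ} (hs : 0 < s)
    {g : Spacetime d → ℝ≥0∞} (hg : Measurable g) :
    ∫⁻ p, g (p.1 + p.2) ∂(sigmaPlus d s).prod (sigmaPlus d s) =
      ∫⁻ ζ, ENNReal.ofReal (convDensity d s ζ) * g ζ := by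
  rw [lintegral_prod _ (by fun_prop), lintegral_lintegral_sigmaPlus_add hd hs hg]

/-- The quadratic form in `|f|²` that controls `‖f σ ∗ f σ‖_2²`. -/
def convForm (d : ℕ) (s : ℝ) (f : Spacetime d → ℂ) : ℝ≥0∞ :=
  ∫⁻ p, ENNReal.ofReal (convDensity d s (p.1 + p.2)) * (‖f p.1‖ₑ ^ 2 * ‖f p.2‖ₑ ^ 2)
    ∂(sigmaPlus d s).prod (sigmaPlus d s)

theorem enorm_toLp_expTransform_sq {d : ℕ} (φ : 𝓢(Spacetime d, ℂ)) :
    ∫⁻ ζ, ‖expTransform d φ ζ‖ₑ ^ 2 =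
      ENNReal.ofReal ((2 * Real.pi) ^ (d + 1) * ‖φ.toLp 2‖ ^ 2) := by
  rw [← norm_expTransform_sq, ENNReal.ofReal_pow (norm_nonneg _), ofReal_norm, enorm_two_pow]
  refine lintegral_congr_ae ?_
  filter_upwards [SchwartzMap.coeFn_toLp (expTransform d φ) 2 volume] with z hz
  rw [hz]

/-- Cauchy-Schwarz with weights `k^(-1/2)` and `k^(1/2)`, where `k` is the density of `σ⁺ ∗ σ⁺`. In
the first factor `k⁻¹` cancels the density, leaving the Lebesgue `L²` norm of the transform of `φ`,
which Plancherel evaluates. -/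
theorem sq_enorm_integral_expTransform_le {d : ℕ} (hd : 2 ≤ d) {s : ℝ} (hs : 0 < s)
    {f : Spacetime d → ℂ} (hf : StronglyMeasurable f) (φ : 𝓢(Spacetime d, ℂ)) :
    ‖∫ p, expTransform d φ (p.1 + p.2) * (f p.1 * f p.2)
        ∂(sigmaPlus d s).prod (sigmaPlus d s)‖ₑ ^ 2 ≤
      ENNReal.ofReal ((2 * Real.pi) ^ (d + 1) * ‖φ.toLp 2‖ ^ 2) * convForm d s f := by
  set ν := (sigmaPlus d s).prod (sigmaPlus d s)
  set w : Spacetime d → ℝ≥0∞ := fun ζ => ENNReal.ofReal (Real.sqrt (convDensity d s ζ)) with hw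
  have hk := measurable_convDensity d s
  have hwm : Measurable w := by fun_prop
  have hfm := hf.measurable
  have hΦm : Measurable (expTransform d φ) := (expTransform d φ).continuous.measurable
  have hw2 : ∀ ζ, w ζ ^ 2 = ENNReal.ofReal (convDensity d s ζ) := fun ζ => by
    rw [hw, ← ENNReal.ofReal_pow (Real.sqrt_nonneg _), Real.sq_sqrt (convDensity_nonneg d s ζ)]
  -- The weight does vanish on part of space-time, but sums of two points of the sheet almost never
  -- fall there.
  have hpos : ∀ᵐ p ∂ν, w (p.1 + p.2) ≠ 0 := by
    have h0 : ν {p | w (p.1 + p.2) = 0} = 0 := by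
      have hS : MeasurableSet {ζ : Spacetime d | w ζ = 0} := hwm (measurableSet_singleton 0)
      have hS' : MeasurableSet {p : Spacetime d × Spacetime d | w (p.1 + p.2) = 0} :=
        (measurable_fst.add measurable_snd) hS
      rw [← lintegral_indicator_one hS']
      refine (lintegral_prod_sigmaPlus_add hd hs
        (g := {ζ : Spacetime d | w ζ = 0}.indicator (fun _ => 1))
        (measurable_const.indicator hS)).trans ?_
      refine (lintegral_congr fun ζ => ?_).trans lintegral_zero
      rw [← hw2]
      by_cases h : w ζ = 0
      · simp [h]
      · simp [Set.indicator, h]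
    rw [ae_iff]
    simpa using h0
  calc _ ≤ (∫⁻ p, ‖expTransform d φ (p.1 + p.2) * (f p.1 * f p.2)‖ₑ ∂ν) ^ 2 :=
        pow_le_pow_left₀ (by simp) (enorm_integral_le_lintegral_enorm _) 2
    _ = (∫⁻ p, (‖expTransform d φ (p.1 + p.2)‖ₑ * (w (p.1 + p.2))⁻¹) *
          (w (p.1 + p.2) * (‖f p.1‖ₑ * ‖f p.2‖ₑ)) ∂ν) ^ 2 := by
        congr 1
        refine lintegral_congr_ae ?_
        filter_upwards [hpos] with p hp
        rw [enorm_mul, enorm_mul, mul_assoc, ← mul_assoc (w _)⁻¹,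
          ENNReal.inv_mul_cancel hp ENNReal.ofReal_ne_top, one_mul]
    _ ≤ (∫⁻ p, (‖expTransform d φ (p.1 + p.2)‖ₑ * (w (p.1 + p.2))⁻¹) ^ 2 ∂ν) *
          ∫⁻ p, (w (p.1 + p.2) * (‖f p.1‖ₑ * ‖f p.2‖ₑ)) ^ 2 ∂ν :=
        sq_lintegral_mul_le (Measurable.aemeasurable (by fun_prop))
          (Measurable.aemeasurable (by fun_prop))
    _ ≤ _ := by
        refine mul_le_mul' ?_ (le_of_eq ?_)
        · rw [lintegral_prod_sigmaPlus_add hd hs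
            (g := fun ζ => (‖expTransform d φ ζ‖ₑ * (w ζ)⁻¹) ^ 2) (by fun_prop),
            ← enorm_toLp_expTransform_sq]
          refine lintegral_mono fun ζ => ?_
          rw [← hw2, mul_pow, mul_left_comm, ← mul_pow]
          refine mul_le_of_le_one_right' ?_
          exact pow_le_one₀ (by simp) (ENNReal.mul_inv_le_one _)
        · refine lintegral_congr fun p => ?_
          rw [← hw2]; ring

/-- The `L⁴` norm of the extension is the square root of the `L²` norm of its square, and the latter
is bounded by duality against Schwartz functions. -/
theorem eLpNorm_oscIntegral_sigmaPlus {d : ℕ} (hd : 2 ≤ d) {s : ℝ} (hs : 0 < s)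
    {f : Spacetime d → ℂ} (hf : StronglyMeasurable f) (hi : Integrable f (sigmaPlus d s))
    (hQ : convForm d s f ≠ ∞) :
    MemLp (oscIntegral (sigmaPlus d s) id f) 4 ∧
      eLpNorm (oscIntegral (sigmaPlus d s) id f) 4 ^ 4 ≤
        ENNReal.ofReal ((2 * Real.pi) ^ (d + 1)) * convForm d s f := by
  set σ := sigmaPlus d s
  set T := oscIntegral σ id f with hT
  set G := oscIntegral (σ.prod σ) (fun p => id p.1 + id p.2) (fun p => f p.1 * f p.2) with hG
  have hTc : Continuous T := continuous_oscIntegral measurable_id hi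
  have hTG : ∀ z, T z * T z = G z := fun z => oscIntegral_mul z
  have hPm : Measurable fun p : Spacetime d × Spacetime d => id p.1 + id p.2 := by fun_prop
  have hff : Integrable (fun p : Spacetime d × Spacetime d => f p.1 * f p.2) (σ.prod σ) :=
    hi.mul_prod hi
  set C := Real.sqrt ((2 * Real.pi) ^ (d + 1) * (convForm d s f).toReal) with hC
  have hpi := Real.pi_pos
  have hC2 : C ^ 2 = (2 * Real.pi) ^ (d + 1) * (convForm d s f).toReal :=
    Real.sq_sqrt (by positivity)
  have hmain := memLp_two_of_schwartz (G := G) (C := C) (Real.sqrt_nonneg _)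
    (continuous_oscIntegral hPm hff).locallyIntegrable
    (integrable_schwartz_mul_oscIntegral hPm hff) (fun φ => by
      rw [hG, integral_schwartz_mul_oscIntegral hPm hff]
      have h1 := sq_enorm_integral_expTransform_le hd hs hf φ
      rw [← ENNReal.ofReal_toReal hQ, ← ENNReal.ofReal_mul (by positivity), ← ofReal_norm,
        ← ENNReal.ofReal_pow (norm_nonneg _), ENNReal.ofReal_le_ofReal_iff (by positivity)] at h1
      refine le_of_sq_le_sq ?_ (by positivity)
      rw [mul_pow, hC2]
      refine h1.trans_eq (by ring))
  have h4 : eLpNorm T 4 ^ 4 = eLpNorm G 2 ^ 2 := by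
    rw [eLpNorm_four_pow, eLpNorm_two_pow]
    refine lintegral_congr fun z => ?_
    rw [← hTG, enorm_mul]; ring
  have h5 : eLpNorm T 4 ^ 4 ≤ ENNReal.ofReal ((2 * Real.pi) ^ (d + 1)) * convForm d s f := by
    rw [h4, ← ENNReal.ofReal_toReal hQ, ← ENNReal.ofReal_mul (by positivity), ← hC2,
      ENNReal.ofReal_pow (Real.sqrt_nonneg _)]
    exact pow_le_pow_left₀ (by simp) hmain.2 2
  refine ⟨⟨hTc.aestronglyMeasurable, ?_⟩, h5⟩
  by_contra htop
  rw [not_lt, top_le_iff] at htop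
  rw [htop] at h5
  simp only [ne_eq, OfNat.ofNat_ne_zero, not_false_eq_true, ENNReal.top_pow, top_le_iff] at h5
  exact ENNReal.mul_ne_top ENNReal.ofReal_ne_top hQ h5

theorem convForm_mono {d : ℕ} {s : ℝ} {f g : Spacetime d → ℂ}
    (h : ∀ᵐ x ∂sigmaPlus d s, ‖f x‖ₑ ≤ ‖g x‖ₑ) : convForm d s f ≤ convForm d s g := by
  refine lintegral_mono_ae ?_
  have h1 := Measure.quasiMeasurePreserving_fst (μ := sigmaPlus d s) (ν := sigmaPlus d s) |>.ae h
  have h2 := Measure.quasiMeasurePreserving_snd (μ := sigmaPlus d s) (ν := sigmaPlus d s) |>.ae h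
  filter_upwards [h1, h2] with p hp1 hp2
  gcongr

theorem lintegral_prod_enorm_sq {d : ℕ} {s : ℝ} (f : Lp ℂ 2 (sigmaPlus d s)) :
    ∫⁻ p, ‖f p.1‖ₑ ^ 2 * ‖f p.2‖ₑ ^ 2 ∂(sigmaPlus d s).prod (sigmaPlus d s) = ‖f‖ₑ ^ 4 := by
  have hfm := (Lp.stronglyMeasurable f).measurable
  rw [lintegral_prod_mul (f := fun x => ‖f x‖ₑ ^ 2) (g := fun x => ‖f x‖ₑ ^ 2)
    (Measurable.aemeasurable (by fun_prop)) (Measurable.aemeasurable (by fun_prop)),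
    ← enorm_two_pow]
  ring

theorem convForm_le {d : ℕ} (hd : d = 2 ∨ d = 3) {s : ℝ} (hs : 0 < s)
    (f : Lp ℂ 2 (sigmaPlus d s)) :
    convForm d s f ≤ ENNReal.ofReal (densityBound d s) * ‖f‖ₑ ^ 4 := by
  have hfm := (Lp.stronglyMeasurable f).measurable
  rw [← lintegral_prod_enorm_sq, ← lintegral_const_mul _ (by fun_prop)]
  refine lintegral_mono fun p => ?_
  have := (convDensity_lt hd hs (p.1 + p.2)).le
  gcongr

/-- The density lies strictly below its bound everywhere, so the integrands differ strictly wherever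
`|f|² ⊗ |f|²` is nonzero, a set of positive measure. Finiteness of the form keeps the inequality
strict after integration. -/
theorem convForm_lt {d : ℕ} (hd : d = 2 ∨ d = 3) {s : ℝ} (hs : 0 < s)
    {f : Lp ℂ 2 (sigmaPlus d s)} (hf : f ≠ 0) :
    convForm d s f < ENNReal.ofReal (densityBound d s) * ‖f‖ₑ ^ 4 := by
  have hfm := (Lp.stronglyMeasurable f).measurable
  have hk := measurable_convDensity d s
  have hfin := ne_top_of_le_ne_top (ENNReal.mul_ne_top ENNReal.ofReal_ne_top
    (ENNReal.pow_ne_top enorm_ne_top)) (convForm_le hd hs f)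
  have hF : ∫⁻ p, ‖f p.1‖ₑ ^ 2 * ‖f p.2‖ₑ ^ 2 ∂(sigmaPlus d s).prod (sigmaPlus d s) ≠ 0 := by
    rw [lintegral_prod_enorm_sq]
    simpa using hf
  rw [← lintegral_prod_enorm_sq, ← lintegral_const_mul _ (by fun_prop)]
  set S : Set (Spacetime d × Spacetime d) :=
    {p | ‖f p.1‖ₑ ^ 2 * ‖f p.2‖ₑ ^ 2 ≠ 0} with hS
  have hS0 : (sigmaPlus d s).prod (sigmaPlus d s) S ≠ 0 := by
    intro h
    refine hF ((lintegral_eq_zero_iff (by fun_prop)).2 ?_)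
    exact h
  refine lintegral_strict_mono_of_ae_le_of_ae_lt_on (s := S)
    (Measurable.aemeasurable (by fun_prop)) hfin ?_ hS0 ?_
  · refine Eventually.of_forall fun p => ?_
    have := (convDensity_lt hd hs (p.1 + p.2)).le
    simp only
    gcongr
  · refine Eventually.of_forall fun p hp => ?_
    refine ENNReal.mul_lt_mul_left hp ?_ ?_
    · exact ENNReal.mul_ne_top (ENNReal.pow_ne_top enorm_ne_top) (ENNReal.pow_ne_top enorm_ne_top)
    · exact (ENNReal.ofReal_lt_ofReal_iff (densityBound_pos hd hs)).2 (convDensity_lt hd hs _)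

/-! ### The extension operators of the two sheets -/

theorem measurePreserving_neg_sigmaMinus (d : ℕ) (s : ℝ) :
    MeasurePreserving Neg.neg (sigmaMinus d s) (sigmaPlus d s) := by
  refine ⟨measurable_neg, Measure.ext_of_lintegral _ fun g hg => ?_⟩
  have hψ := (continuous_psi d s).measurable
  have hu := (continuous_upperMap d s).measurable
  have hl := (continuous_lowerMap d s).measurable
  rw [lintegral_map hg measurable_neg, lintegral_sigmaPlus hg, sigmaMinus,
    lintegral_map (by fun_prop) hl, baseMeasure,
    lintegral_withDensity_eq_lintegral_mul _ (by fun_prop) (by fun_prop),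
    ← lintegral_neg_eq_self]
  refine lintegral_congr fun y => ?_
  have : -lowerMap d s (-y) = upperMap d s y := by
    have h1 : -lowerMap d s (-y) = WithLp.toLp 2 (- -y, - -psi d s (-y)) := rfl
    rw [h1, neg_neg, neg_neg, psi_neg, upperMap]
  simp only [Pi.mul_apply, this, psi_neg]

theorem measurePreserving_neg_sigmaPlus (d : ℕ) (s : ℝ) :
    MeasurePreserving Neg.neg (sigmaPlus d s) (sigmaMinus d s) :=
  MeasurePreserving.symm (MeasurableEquiv.neg (Spacetime d)) (measurePreserving_neg_sigmaMinus d s)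

/-- Complex conjugation on `L^p`. -/
def conjLp {d : ℕ} {p : ℝ≥0∞} [Fact (1 ≤ p)] (μ : Measure (Spacetime d)) :
    Lp ℂ p μ →L[ℝ] Lp ℂ p μ :=
  (Complex.conjCLE : ℂ →L[ℝ] ℂ).compLpL p μ

theorem coeFn_conjLp {d : ℕ} {p : ℝ≥0∞} [Fact (1 ≤ p)] {μ : Measure (Spacetime d)}
    (f : Lp ℂ p μ) : conjLp μ f =ᵐ[μ] fun z => (starRingEnd ℂ) (f z) :=
  (Complex.conjCLE : ℂ →L[ℝ] ℂ).coeFn_compLpL f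

theorem norm_conjLp {d : ℕ} {p : ℝ≥0∞} [Fact (1 ≤ p)] {μ : Measure (Spacetime d)}
    (f : Lp ℂ p μ) : ‖conjLp μ f‖ = ‖f‖ := by
  rw [Lp.norm_def, Lp.norm_def]
  congr 1
  refine eLpNorm_congr_norm_ae ?_
  filter_upwards [coeFn_conjLp f] with z hz
  rw [hz, RCLike.norm_conj]

section Reflect

variable {d : ℕ} {μ ν : Measure (Spacetime d)}

/-- `ζ ↦ conj (f (-ζ))`. -/
def reflect (h : MeasurePreserving Neg.neg ν μ) (f : Lp ℂ 2 μ) : Lp ℂ 2 ν :=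
  conjLp ν (Lp.compMeasurePreserving Neg.neg h f)

theorem coeFn_reflect (h : MeasurePreserving Neg.neg ν μ) (f : Lp ℂ 2 μ) :
    reflect h f =ᵐ[ν] fun ζ => (starRingEnd ℂ) (f (-ζ)) := by
  filter_upwards [coeFn_conjLp (Lp.compMeasurePreserving Neg.neg h f),
    Lp.coeFn_compMeasurePreserving f h] with ζ h1 h2
  rw [reflect, h1, h2]
  rfl

theorem norm_reflect (h : MeasurePreserving Neg.neg ν μ) (f : Lp ℂ 2 μ) :
    ‖reflect h f‖ = ‖f‖ := by
  rw [reflect, norm_conjLp, Lp.norm_compMeasurePreserving]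

theorem continuous_reflect (h : MeasurePreserving Neg.neg ν μ) : Continuous (reflect h) :=
  (conjLp ν).continuous.comp (Lp.isometry_compMeasurePreserving h).continuous

theorem integrable_reflect (h : MeasurePreserving Neg.neg ν μ) {f : Lp ℂ 2 μ}
    (hf : Integrable f μ) : Integrable (reflect h f) ν := by
  refine Integrable.congr ?_ (coeFn_reflect h f).symm
  have h1 : Integrable (fun ζ => f (-ζ)) ν := h.integrable_comp_of_integrable hf
  exact (Complex.conjCLE : ℂ →L[ℝ] ℂ).integrable_comp h1

/-- The conjugate of `e^{iz·ζ}` is `e^{iz·(-ζ)}`. -/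
theorem oscIntegral_reflect (h : MeasurePreserving Neg.neg ν μ) (f : Lp ℂ 2 μ)
    (z : Spacetime d) :
    oscIntegral ν id (reflect h f) z = (starRingEnd ℂ) (oscIntegral μ id f z) := by
  have h1 : oscIntegral ν id (reflect h f) z =
      ∫ ζ, (fun ζ => Complex.exp (Complex.I * (inner ℝ z (-ζ) : ℝ)) *
        (starRingEnd ℂ) (f ζ)) (-ζ) ∂ν := by
    refine integral_congr_ae ?_
    filter_upwards [coeFn_reflect h f] with ζ hζ
    rw [hζ]
    simp
  have h2 := h.integral_comp (MeasurableEquiv.neg (Spacetime d)).measurableEmbedding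
    (fun ζ => Complex.exp (Complex.I * (inner ℝ z (-ζ) : ℝ)) * (starRingEnd ℂ) (f ζ))
  rw [h1, h2, oscIntegral, ← integral_conj]
  refine integral_congr_ae (Eventually.of_forall fun ζ => ?_)
  simp only [inner_neg_right, map_mul, ← Complex.exp_conj, Complex.conj_I, Complex.conj_ofReal,
    id_eq, Complex.ofReal_neg, mul_neg, neg_mul]

theorem memLp_oscIntegral_reflect (h : MeasurePreserving Neg.neg ν μ) {f : Lp ℂ 2 μ}
    {p : ℝ≥0∞} (hf : MemLp (oscIntegral μ id f) p) :
    MemLp (oscIntegral ν id (reflect h f)) p ∧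
      eLpNorm (oscIntegral ν id (reflect h f)) p = eLpNorm (oscIntegral μ id f) p := by
  have h1 : oscIntegral ν id (reflect h f) = star (oscIntegral μ id f) := by
    ext z; exact oscIntegral_reflect h f z
  rw [h1]
  exact ⟨hf.star, eLpNorm_congr_norm_ae (Eventually.of_forall fun z => by simp)⟩

/-- This symmetry serves twice: it makes the constants of the two sheets agree, and it supplies the
pairs `F`, `conj F` for which Hölder is an equality. -/
theorem extension_reflect [μ.HasTemperateGrowth] [ν.HasTemperateGrowth] [SFinite μ] [SFinite ν]
    (h : MeasurePreserving Neg.neg ν μ)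
    {E : Lp ℂ 2 μ →L[ℂ] Lp ℂ 4 (volume : Measure (Spacetime d))}
    (hE : ∀ f, Lp.toTemperedDistribution (E f) = adjointRestriction f)
    {E' : Lp ℂ 2 ν →L[ℂ] Lp ℂ 4 (volume : Measure (Spacetime d))}
    (hE' : ∀ f, Lp.toTemperedDistribution (E' f) = adjointRestriction f)
    (hmem : ∀ f : Lp ℂ 2 μ, Integrable f μ → MemLp (oscIntegral μ id f) 4) (f : Lp ℂ 2 μ) :
    E' (reflect h f) = conjLp volume (E f) := by
  refine denseRange_integrableSubmodule.induction_on
    (p := fun f => E' (reflect h f) = conjLp volume (E f)) f ?_ ?_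
  · exact isClosed_eq (E'.continuous.comp (continuous_reflect h))
      ((conjLp volume).continuous.comp E.continuous)
  · intro f
    refine Lp.ext ?_
    have hm := hmem f f.2
    filter_upwards [extension_ae_eq hE f.2 hm, coeFn_conjLp (E f),
      extension_ae_eq hE' (integrable_reflect h f.2) (memLp_oscIntegral_reflect h hm).1]
      with z h1 h2 h3
    rw [Submodule.subtype_apply, h3, h2, h1, oscIntegral_reflect]

end Reflect

/-- The fourth power of the bilinear bound for the constant of one sheet. -/
def sheetBound (d : ℕ) (s : ℝ) : ℝ := (2 * Real.pi) ^ (d + 1) * densityBound d s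

theorem sheetBound_pos {d : ℕ} (hd : d = 2 ∨ d = 3) {s : ℝ} (hs : 0 < s) :
    0 < sheetBound d s := by
  have := densityBound_pos hd hs
  have := Real.pi_pos
  unfold sheetBound; positivity

theorem convForm_ne_top {d : ℕ} (hd : d = 2 ∨ d = 3) {s : ℝ} (hs : 0 < s)
    (f : Lp ℂ 2 (sigmaPlus d s)) : convForm d s f ≠ ∞ :=
  ne_top_of_le_ne_top (ENNReal.mul_ne_top ENNReal.ofReal_ne_top
    (ENNReal.pow_ne_top enorm_ne_top)) (convForm_le hd hs f)

theorem oscIntegral_sigmaPlus_bound {d : ℕ} (hd : d = 2 ∨ d = 3) {s : ℝ} (hs : 0 < s)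
    {f : Lp ℂ 2 (sigmaPlus d s)} (hf : Integrable f (sigmaPlus d s)) :
    MemLp (oscIntegral (sigmaPlus d s) id f) 4 ∧
      eLpNorm (oscIntegral (sigmaPlus d s) id f) 4 ≤
        ENNReal.ofReal (sheetBound d s ^ (1 / 4 : ℝ)) * ‖f‖ₑ := by
  obtain ⟨h1, h2⟩ := eLpNorm_oscIntegral_sigmaPlus (d := d) (by omega) hs
    (Lp.stronglyMeasurable f) hf (convForm_ne_top hd hs f)
  refine ⟨h1, ?_⟩
  have hM := sheetBound_pos hd hs
  rw [← ENNReal.pow_le_pow_left_iff four_ne_zero, mul_pow, ← ENNReal.ofReal_pow (by positivity),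
    ← Real.rpow_natCast, ← Real.rpow_mul hM.le]
  refine h2.trans ?_
  norm_num
  rw [sheetBound, ENNReal.ofReal_mul (by have := Real.pi_pos; positivity), mul_assoc]
  gcongr
  exact convForm_le hd hs f

theorem oscIntegral_sigmaMinus_bound {d : ℕ} (hd : d = 2 ∨ d = 3) {s : ℝ} (hs : 0 < s)
    {f : Lp ℂ 2 (sigmaMinus d s)} (hf : Integrable f (sigmaMinus d s)) :
    MemLp (oscIntegral (sigmaMinus d s) id f) 4 ∧
      eLpNorm (oscIntegral (sigmaMinus d s) id f) 4 ≤
        ENNReal.ofReal (sheetBound d s ^ (1 / 4 : ℝ)) * ‖f‖ₑ := by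
  have h := measurePreserving_neg_sigmaPlus d s
  obtain ⟨h1, h2⟩ := oscIntegral_sigmaPlus_bound hd hs (integrable_reflect h hf)
  have h3 : star (oscIntegral (sigmaPlus d s) id (reflect h f)) =
      oscIntegral (sigmaMinus d s) id f := by
    ext z; simp [oscIntegral_reflect]
  rw [← ofReal_norm, norm_reflect, ofReal_norm] at h2
  rw [← h3]
  refine ⟨h1.star, le_of_eq_of_le ?_ h2⟩
  exact eLpNorm_congr_norm_ae (Eventually.of_forall fun z => by simp)

theorem exists_extension_sigmaPlus {d : ℕ} (hd : d = 2 ∨ d = 3) {s : ℝ} [hs : Fact (0 < s)] :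
    ∃ E : Lp ℂ 2 (sigmaPlus d s) →L[ℂ] Lp ℂ 4 (volume : Measure (Spacetime d)),
      ∀ f, Lp.toTemperedDistribution (E f) = adjointRestriction f :=
  exists_extension (Real.rpow_nonneg (sheetBound_pos hd hs.out).le _)
    fun _ hf => oscIntegral_sigmaPlus_bound hd hs.out hf

theorem exists_extension_sigmaMinus {d : ℕ} (hd : d = 2 ∨ d = 3) {s : ℝ} [hs : Fact (0 < s)] :
    ∃ E : Lp ℂ 2 (sigmaMinus d s) →L[ℂ] Lp ℂ 4 (volume : Measure (Spacetime d)),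
      ∀ f, Lp.toTemperedDistribution (E f) = adjointRestriction f :=
  exists_extension (Real.rpow_nonneg (sheetBound_pos hd hs.out).le _)
    fun _ hf => oscIntegral_sigmaMinus_bound hd hs.out hf

/-- The bilinear estimate for all square integrable functions. -/
theorem extension_sigmaPlus_four_le {d : ℕ} (hd : d = 2 ∨ d = 3) {s : ℝ} [hs : Fact (0 < s)]
    {E : Lp ℂ 2 (sigmaPlus d s) →L[ℂ] Lp ℂ 4 (volume : Measure (Spacetime d))}
    (hE : ∀ f, Lp.toTemperedDistribution (E f) = adjointRestriction f)
    (f : Lp ℂ 2 (sigmaPlus d s)) :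
    ‖E f‖ₑ ^ 4 ≤ ENNReal.ofReal ((2 * Real.pi) ^ (d + 1)) * convForm d s f := by
  obtain ⟨u, hu, hle, hlim⟩ := exists_integrable_tendsto f
  have h1 : Tendsto (fun n => ‖E (u n)‖ₑ ^ 4) atTop (𝓝 (‖E f‖ₑ ^ 4)) := by
    have h2 := ((E.continuous.tendsto f).comp hlim).enorm
    exact ((ENNReal.continuous_pow 4).tendsto _).comp h2
  refine le_of_tendsto h1 (Eventually.of_forall fun n => ?_)
  obtain ⟨h2, h3⟩ := eLpNorm_oscIntegral_sigmaPlus (d := d) (by omega) hs.out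
    (Lp.stronglyMeasurable (u n)) (hu n) (convForm_ne_top hd hs.out (u n))
  rw [Lp.enorm_def, eLpNorm_congr_ae (extension_ae_eq hE (hu n) h2)]
  refine h3.trans ?_
  gcongr
  exact convForm_mono (hle n)

/-- The source of nonexistence on one sheet: strict for each nonzero `f`, while `sheetBound_le`
shows that the constant cannot be lowered. -/
theorem extension_sigmaPlus_four_lt {d : ℕ} (hd : d = 2 ∨ d = 3) {s : ℝ} [hs : Fact (0 < s)]
    {E : Lp ℂ 2 (sigmaPlus d s) →L[ℂ] Lp ℂ 4 (volume : Measure (Spacetime d))}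
    (hE : ∀ f, Lp.toTemperedDistribution (E f) = adjointRestriction f)
    {f : Lp ℂ 2 (sigmaPlus d s)} (hf : f ≠ 0) :
    ‖E f‖ₑ ^ 4 < ENNReal.ofReal (sheetBound d s) * ‖f‖ₑ ^ 4 := by
  have hpi : 0 < (2 * Real.pi) ^ (d + 1) := by have := Real.pi_pos; positivity
  refine (extension_sigmaPlus_four_le hd hE f).trans_lt ?_
  rw [sheetBound, ENNReal.ofReal_mul hpi.le, mul_assoc]
  exact ENNReal.mul_lt_mul_right (ENNReal.ofReal_pos.2 hpi).ne' ENNReal.ofReal_ne_top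
    (convForm_lt hd hs.out hf)

/-! ### Orthogonality of the products -/

instance holderTriple_four_four_two : ENNReal.HolderTriple 4 4 2 where
  inv_add_inv_eq_inv := by
    rw [← ENNReal.toReal_eq_toReal_iff' (by simp) (by simp), ENNReal.toReal_add (by simp) (by simp)]
    norm_num

/-- The product of two functions in `L⁴`, as an element of `L²`. -/
def mulFour (d : ℕ) : Lp ℂ 4 (volume : Measure (Spacetime d)) →L[ℂ]
    Lp ℂ 4 (volume : Measure (Spacetime d)) →L[ℂ] Lp ℂ 2 (volume : Measure (Spacetime d)) :=
  (ContinuousLinearMap.mul ℂ ℂ).holderL volume 4 4 2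

variable {d : ℕ}

theorem coeFn_mulFour (F G : Lp ℂ 4 (volume : Measure (Spacetime d))) :
    mulFour d F G =ᵐ[volume] fun z => F z * G z :=
  (ContinuousLinearMap.mul ℂ ℂ).coeFn_holder F G

theorem mulFour_comm (F G : Lp ℂ 4 (volume : Measure (Spacetime d))) :
    mulFour d F G = mulFour d G F := by
  refine Lp.ext ?_
  filter_upwards [coeFn_mulFour F G, coeFn_mulFour G F] with z h1 h2
  rw [h1, h2, mul_comm]

theorem norm_mulFour_self (F : Lp ℂ 4 (volume : Measure (Spacetime d))) :
    ‖mulFour d F F‖ = ‖F‖ ^ 2 := by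
  have h : ‖mulFour d F F‖ₑ ^ 2 = (‖F‖ₑ ^ 2) ^ 2 := by
    rw [← pow_mul, enorm_four_pow, enorm_two_pow]
    refine lintegral_congr_ae ?_
    filter_upwards [coeFn_mulFour F F] with z hz
    rw [hz, enorm_mul]; ring
  have h2 : ‖mulFour d F F‖ₑ = ‖F‖ₑ ^ 2 := (ENNReal.pow_right_strictMono two_ne_zero).injective h
  rw [← ofReal_norm, ← ofReal_norm, ← ENNReal.ofReal_pow (norm_nonneg _)] at h2
  exact (ENNReal.ofReal_eq_ofReal_iff (norm_nonneg _) (by positivity)).1 h2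

theorem norm_mulFour_conj (F : Lp ℂ 4 (volume : Measure (Spacetime d))) :
    ‖mulFour d F (conjLp volume F)‖ = ‖F‖ ^ 2 := by
  rw [← norm_mulFour_self, Lp.norm_def, Lp.norm_def]
  congr 1
  refine eLpNorm_congr_norm_ae ?_
  filter_upwards [coeFn_mulFour F F, coeFn_mulFour F (conjLp volume F), coeFn_conjLp F]
    with z h1 h2 h3
  rw [h1, h2, h3, norm_mul, norm_mul, RCLike.norm_conj]

theorem norm_mulFour_le (F G : Lp ℂ 4 (volume : Measure (Spacetime d))) :
    ‖mulFour d F G‖ ≤ ‖F‖ * ‖G‖ := by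
  refine ((ContinuousLinearMap.mul ℂ ℂ).norm_holder_apply_apply_le F G).trans ?_
  have := ContinuousLinearMap.opNorm_mul_le ℂ ℂ
  have h0 := norm_nonneg F
  have h1 := norm_nonneg G
  calc _ ≤ 1 * ‖F‖ * ‖G‖ := by gcongr
    _ = _ := by rw [one_mul]

/-- The Fourier support of a product of two extensions. -/
theorem integral_schwartz_mul_mulFour {μ ν : Measure (Spacetime d)} [μ.HasTemperateGrowth]
    [ν.HasTemperateGrowth] [SFinite μ] [SFinite ν] {A : Set (Spacetime d)}
    (hA : ∀ᵐ p ∂μ.prod ν, p.1 + p.2 ∈ A)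
    {E : Lp ℂ 2 μ →L[ℂ] Lp ℂ 4 (volume : Measure (Spacetime d))}
    (hE : ∀ f, Lp.toTemperedDistribution (E f) = adjointRestriction f)
    {E' : Lp ℂ 2 ν →L[ℂ] Lp ℂ 4 (volume : Measure (Spacetime d))}
    (hE' : ∀ f, Lp.toTemperedDistribution (E' f) = adjointRestriction f)
    (hmem : ∀ f : Lp ℂ 2 μ, Integrable f μ → MemLp (oscIntegral μ id f) 4)
    (hmem' : ∀ f : Lp ℂ 2 ν, Integrable f ν → MemLp (oscIntegral ν id f) 4)
    (f : Lp ℂ 2 μ) (g : Lp ℂ 2 ν) {φ : 𝓢(Spacetime d, ℂ)}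
    (hφ : ∀ ζ ∈ A, expTransform d φ ζ = 0) :
    ∫ z, φ z * mulFour d (E f) (E' g) z = 0 := by
  have hc : Continuous fun G : Lp ℂ 2 (volume : Measure (Spacetime d)) =>
      Lp.toTemperedDistribution G φ := by
    have h1 := (Lp.toTemperedDistributionCLM ℂ (volume : Measure (Spacetime d)) 2).continuous
    have h2 : Continuous fun u : 𝓢'(Spacetime d, ℂ) => u φ :=
      (PointwiseConvergenceCLM.evalCLM (RingHom.id ℂ) ℂ φ).continuous
    exact h2.comp h1
  suffices h : Lp.toTemperedDistribution (mulFour d (E f) (E' g)) φ = 0 by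
    rwa [Lp.toTemperedDistribution_apply] at h
  -- The pairing is continuous in each argument, so density reduces `f` and then `g` to integrable
  -- functions, for which the product is an explicit oscillatory integral.
  refine denseRange_integrableSubmodule.induction_on
    (p := fun f => Lp.toTemperedDistribution (mulFour d (E f) (E' g)) φ = 0) f ?_ fun f => ?_
  · refine isClosed_eq (hc.comp ?_) continuous_const
    fun_prop
  refine denseRange_integrableSubmodule.induction_on
    (p := fun g => Lp.toTemperedDistribution (mulFour d (E ((integrableSubmodule μ).subtype f))
      (E' g)) φ = 0) g ?_ fun g => ?_
  · refine isClosed_eq (hc.comp ?_) continuous_const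
    fun_prop
  simp only [Submodule.subtype_apply]
  rw [Lp.toTemperedDistribution_apply]
  have hfg : Integrable (fun p : Spacetime d × Spacetime d => (f : Lp ℂ 2 μ) p.1 *
      (g : Lp ℂ 2 ν) p.2) (μ.prod ν) := f.2.mul_prod g.2
  have hP : Measurable fun p : Spacetime d × Spacetime d => id p.1 + id p.2 := by fun_prop
  have h1 := integral_schwartz_mul_oscIntegral hP hfg φ
  have h2 : ∫ p, expTransform d φ (id p.1 + id p.2) *
      ((f : Lp ℂ 2 μ) p.1 * (g : Lp ℂ 2 ν) p.2) ∂(μ.prod ν) = 0 := by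
    refine integral_eq_zero_of_ae ?_
    filter_upwards [hA] with p hp
    simp [hφ _ hp]
  rw [← h2, ← h1]
  refine integral_congr_ae ?_
  filter_upwards [coeFn_mulFour (E f) (E' g), extension_ae_eq hE f.2 (hmem f f.2),
    extension_ae_eq hE' g.2 (hmem' g g.2)] with z h3 h4 h5
  rw [h3, h4, h5, oscIntegral_mul, smul_eq_mul]

/-! Sums of two points of the sheets. -/

theorem ae_sigmaPlus {s : ℝ} {p : Spacetime d → Prop} (hp : MeasurableSet {ζ | p ζ})
    (h : ∀ y, p (upperMap d s y)) : ∀ᵐ ζ ∂sigmaPlus d s, p ζ :=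
  (ae_map_iff (continuous_upperMap d s).measurable.aemeasurable hp).2 (Eventually.of_forall h)

theorem ae_sigmaMinus {s : ℝ} {p : Spacetime d → Prop} (hp : MeasurableSet {ζ | p ζ})
    (h : ∀ y, p (lowerMap d s y)) : ∀ᵐ ζ ∂sigmaMinus d s, p ζ :=
  (ae_map_iff (continuous_lowerMap d s).measurable.aemeasurable hp).2 (Eventually.of_forall h)

theorem ae_prod_of_ae {μ ν : Measure (Spacetime d)} [SFinite μ] [SFinite ν]
    {p q : Spacetime d → Prop} (hp : ∀ᵐ ζ ∂μ, p ζ) (hq : ∀ᵐ ζ ∂ν, q ζ) :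
    ∀ᵐ x ∂μ.prod ν, p x.1 ∧ q x.2 :=
  (Measure.quasiMeasurePreserving_fst.ae hp).and (Measure.quasiMeasurePreserving_snd.ae hq)

/-- The solid region `τ ≥ √(s² + |ξ|²)`. -/
def futureRegion (d : ℕ) (s : ℝ) : Set (Spacetime d) := {ζ | psi d s ζ.fst ≤ ζ.snd}

/-- The solid region `τ ≤ -√(s² + |ξ|²)`. -/
def pastRegion (d : ℕ) (s : ℝ) : Set (Spacetime d) := {ζ | ζ.snd ≤ -psi d s ζ.fst}

/-- The spacelike region `|τ| ≤ |ξ|`. -/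
def spacelikeRegion (d : ℕ) : Set (Spacetime d) := {ζ | |ζ.snd| ≤ ‖ζ.fst‖}

theorem continuous_psi_fst (d : ℕ) (s : ℝ) :
    Continuous fun ζ : Spacetime d => psi d s ζ.fst :=
  (continuous_psi d s).comp (WithLp.continuous_fst 2 _ _)

theorem isClosed_futureRegion (d : ℕ) (s : ℝ) : IsClosed (futureRegion d s) :=
  isClosed_le (continuous_psi_fst d s) (WithLp.continuous_snd 2 _ _)

theorem isClosed_pastRegion (d : ℕ) (s : ℝ) : IsClosed (pastRegion d s) :=
  isClosed_le (WithLp.continuous_snd 2 _ _) (continuous_psi_fst d s).neg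

theorem isClosed_spacelikeRegion (d : ℕ) : IsClosed (spacelikeRegion d) :=
  isClosed_le (WithLp.continuous_snd 2 _ _).abs (WithLp.continuous_fst 2 _ _).norm

theorem disjoint_future_spacelike {s : ℝ} (hs : 0 < s) :
    Disjoint (futureRegion d s) (spacelikeRegion d) := by
  rw [Set.disjoint_left]
  intro ζ h1 h2
  have h3 := norm_lt_psi d hs ζ.fst
  have h4 : psi d s ζ.fst ≤ ζ.snd := h1
  have h5 : |ζ.snd| ≤ ‖ζ.fst‖ := h2
  linarith [le_abs_self ζ.snd]

theorem disjoint_spacelike_past {s : ℝ} (hs : 0 < s) :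
    Disjoint (spacelikeRegion d) (pastRegion d s) := by
  rw [Set.disjoint_left]
  intro ζ h2 h1
  have h3 := norm_lt_psi d hs ζ.fst
  have h4 : ζ.snd ≤ -psi d s ζ.fst := h1
  have h5 : |ζ.snd| ≤ ‖ζ.fst‖ := h2
  linarith [neg_abs_le ζ.snd]

theorem disjoint_future_past {s : ℝ} (hs : 0 < s) :
    Disjoint (futureRegion d s) (pastRegion d s) := by
  rw [Set.disjoint_left]
  intro ζ h2 h1
  have h3 := psi_pos d hs ζ.fst
  have h4 : ζ.snd ≤ -psi d s ζ.fst := h1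
  have h5 : psi d s ζ.fst ≤ ζ.snd := h2
  linarith

/-- This places upper + lower in the spacelike region. It follows from Cauchy-Schwarz for the
vectors `(s, x)` and `(s, y)`, that is, `s² + x·y ≤ ψ(x)ψ(y)`. -/
theorem abs_psi_sub_psi_le {s : ℝ} (hs : 0 < s) (x y : EuclideanSpace ℝ (Fin d)) :
    |psi d s x - psi d s y| ≤ ‖x - y‖ := by
  have hx := psi_pos d hs x
  have hy := psi_pos d hs y
  have hx2 := psi_sq d s x
  have hy2 := psi_sq d s y
  refine abs_le_of_sq_le_sq ?_ (norm_nonneg _)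
  rw [norm_sub_sq_real]
  have h1 : inner ℝ x y + s ^ 2 ≤ psi d s x * psi d s y := by
    refine le_of_sq_le_sq ?_ (by positivity)
    have h2 := abs_le.1 (abs_real_inner_le_norm x y)
    rw [mul_pow, hx2, hy2]
    nlinarith [sq_nonneg (‖x‖ - ‖y‖), norm_nonneg x, norm_nonneg y,
      mul_nonneg (norm_nonneg x) (norm_nonneg y)]
  nlinarith

/-- Sums of two upper points even have invariant mass at least `2s`; the threshold `s` is enough to
separate them from the spacelike region by disjoint closed sets. -/
theorem psi_add_le {s : ℝ} (hs : 0 < s) (x y : EuclideanSpace ℝ (Fin d)) :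
    psi d s (x + y) ≤ psi d s x + psi d s y := by
  have hx := norm_lt_psi d hs x
  have hy := norm_lt_psi d hs y
  have hx2 := psi_sq d s x
  have hy2 := psi_sq d s y
  have h0 := norm_nonneg x
  have h1 := norm_nonneg y
  refine Real.sqrt_le_iff.2 ⟨by linarith, ?_⟩
  rw [norm_add_sq_real]
  have h2 := real_inner_le_norm x y
  nlinarith [mul_nonneg h0 h1, mul_le_mul hx.le hy.le h1 (by linarith), sq_nonneg s]

theorem ae_add_mem_futureRegion {s : ℝ} (hs : 0 < s) :
    ∀ᵐ p ∂(sigmaPlus d s).prod (sigmaPlus d s), p.1 + p.2 ∈ futureRegion d s := by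
  have hm : MeasurableSet {ζ : Spacetime d | ζ.snd = psi d s ζ.fst} :=
    (isClosed_eq (WithLp.continuous_snd 2 _ _) (continuous_psi_fst d s)).measurableSet
  have h := ae_sigmaPlus (s := s) hm fun y => rfl
  filter_upwards [ae_prod_of_ae h h] with p hp
  change psi d s (p.1.fst + p.2.fst) ≤ p.1.snd + p.2.snd
  rw [hp.1, hp.2]
  exact psi_add_le hs _ _

theorem ae_add_mem_pastRegion {s : ℝ} (hs : 0 < s) :
    ∀ᵐ p ∂(sigmaMinus d s).prod (sigmaMinus d s), p.1 + p.2 ∈ pastRegion d s := by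
  have hm : MeasurableSet {ζ : Spacetime d | ζ.snd = -psi d s ζ.fst} :=
    (isClosed_eq (WithLp.continuous_snd 2 _ _) (continuous_psi_fst d s).neg).measurableSet
  have h := ae_sigmaMinus (s := s) hm fun y => rfl
  filter_upwards [ae_prod_of_ae h h] with p hp
  change p.1.snd + p.2.snd ≤ -psi d s (p.1.fst + p.2.fst)
  rw [hp.1, hp.2]
  linarith [psi_add_le hs p.1.fst p.2.fst]

theorem ae_add_mem_spacelikeRegion {s : ℝ} (hs : 0 < s) :
    ∀ᵐ p ∂(sigmaPlus d s).prod (sigmaMinus d s), p.1 + p.2 ∈ spacelikeRegion d := by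
  have hm : MeasurableSet {ζ : Spacetime d | ζ.snd = psi d s ζ.fst} :=
    (isClosed_eq (WithLp.continuous_snd 2 _ _) (continuous_psi_fst d s)).measurableSet
  have hm' : MeasurableSet {ζ : Spacetime d | ζ.snd = -psi d s ζ.fst} :=
    (isClosed_eq (WithLp.continuous_snd 2 _ _) (continuous_psi_fst d s).neg).measurableSet
  filter_upwards [ae_prod_of_ae (ae_sigmaPlus (s := s) hm fun y => rfl)
    (ae_sigmaMinus (s := s) hm' fun y => rfl)] with p hp
  change |p.1.snd + p.2.snd| ≤ ‖p.1.fst + p.2.fst‖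
  rw [hp.1, hp.2, ← psi_neg d s p.2.fst, ← sub_eq_add_neg]
  simpa using abs_psi_sub_psi_le hs p.1.fst (-p.2.fst)

/-! ### Pythagoras for the square of a sum. -/

theorem bilinear_add_self {V W : Type*} [NormedAddCommGroup V] [NormedSpace ℂ V]
    [NormedAddCommGroup W] [NormedSpace ℂ W] (B : V →L[ℂ] V →L[ℂ] W)
    (h : ∀ x y, B x y = B y x) (x y : V) :
    B (x + y) (x + y) = B x x + (2 : ℂ) • B x y + B y y := by
  simp only [map_add, add_apply]
  rw [h y x]
  module

theorem norm_add_sq_of_orthogonal {H : Type*} [NormedAddCommGroup H] [InnerProductSpace ℂ H]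
    {x y z : H} (hxy : (inner ℂ x y : ℂ) = 0) (hxz : (inner ℂ x z : ℂ) = 0)
    (hyz : (inner ℂ y z : ℂ) = 0) :
    ‖x + (2 : ℂ) • y + z‖ ^ 2 = ‖x‖ ^ 2 + 4 * ‖y‖ ^ 2 + ‖z‖ ^ 2 := by
  have e1 := norm_add_sq_eq_norm_sq_add_norm_sq_of_inner_eq_zero (𝕜 := ℂ) (x + (2 : ℂ) • y) z
    (by rw [inner_add_left, inner_smul_left, hxz, hyz]; simp)
  have e2 := norm_add_sq_eq_norm_sq_add_norm_sq_of_inner_eq_zero (𝕜 := ℂ) x ((2 : ℂ) • y)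
    (by rw [inner_smul_right, hxy]; simp)
  have e3 : ‖(2 : ℂ) • y‖ = 2 * ‖y‖ := by rw [norm_smul]; simp
  rw [e3] at e2
  nlinarith

theorem norm_add_four_of_orthogonal {F G : Lp ℂ 4 (volume : Measure (Spacetime d))}
    (h12 : (inner ℂ (mulFour d F F) (mulFour d F G) : ℂ) = 0)
    (h13 : (inner ℂ (mulFour d F F) (mulFour d G G) : ℂ) = 0)
    (h23 : (inner ℂ (mulFour d F G) (mulFour d G G) : ℂ) = 0) :
    ‖F + G‖ ^ 4 = ‖F‖ ^ 4 + ‖G‖ ^ 4 + 4 * ‖mulFour d F G‖ ^ 2 := by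
  have e1 := norm_mulFour_self F
  have e2 := norm_mulFour_self G
  have e3 := norm_mulFour_self (F + G)
  have e4 := norm_add_sq_of_orthogonal h12 h13 h23
  have e5 := bilinear_add_self (mulFour d) mulFour_comm F G
  have e6 : ‖mulFour d (F + G) (F + G)‖ ^ 2 =
    ‖mulFour d F F‖ ^ 2 + 4 * ‖mulFour d F G‖ ^ 2 + ‖mulFour d G G‖ ^ 2 :=
    (congrArg (fun x => ‖x‖ ^ 2) e5).trans e4
  have key : ∀ a b c u v w m : ℝ, u = a ^ 2 → v = b ^ 2 → w = c ^ 2 →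
      w ^ 2 = u ^ 2 + 4 * m ^ 2 + v ^ 2 → c ^ 4 = a ^ 4 + b ^ 4 + 4 * m ^ 2 := by
    intro a b c u v w m hu hv hw h
    subst hu hv hw
    linarith
  exact key _ _ _ _ _ _ _ e1 e2 e3 e6

/-- The `L⁴` norm of the extension from the two-sheeted hyperboloid. -/
theorem norm_add_four {s : ℝ} (hd : d = 2 ∨ d = 3) [hs : Fact (0 < s)]
    {E : Lp ℂ 2 (sigmaPlus d s) →L[ℂ] Lp ℂ 4 (volume : Measure (Spacetime d))}
    (hE : ∀ f, Lp.toTemperedDistribution (E f) = adjointRestriction f)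
    {E' : Lp ℂ 2 (sigmaMinus d s) →L[ℂ] Lp ℂ 4 (volume : Measure (Spacetime d))}
    (hE' : ∀ f, Lp.toTemperedDistribution (E' f) = adjointRestriction f)
    (f : Lp ℂ 2 (sigmaPlus d s)) (g : Lp ℂ 2 (sigmaMinus d s)) :
    ‖E f + E' g‖ ^ 4 =
      ‖E f‖ ^ 4 + ‖E' g‖ ^ 4 + 4 * ‖mulFour d (E f) (E' g)‖ ^ 2 := by
  have hm := fun (f : Lp ℂ 2 (sigmaPlus d s)) (hf : Integrable f (sigmaPlus d s)) =>
    (oscIntegral_sigmaPlus_bound hd hs.out hf).1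
  have hm' := fun (f : Lp ℂ 2 (sigmaMinus d s)) (hf : Integrable f (sigmaMinus d s)) =>
    (oscIntegral_sigmaMinus_bound hd hs.out hf).1
  have h1 := fun φ hφ => integral_schwartz_mul_mulFour (ae_add_mem_futureRegion hs.out) hE hE
    hm hm f f (φ := φ) hφ
  have h2 := fun φ hφ => integral_schwartz_mul_mulFour (ae_add_mem_spacelikeRegion hs.out) hE hE'
    hm hm' f g (φ := φ) hφ
  have h3 := fun φ hφ => integral_schwartz_mul_mulFour (ae_add_mem_pastRegion hs.out) hE' hE'
    hm' hm' g g (φ := φ) hφ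
  refine norm_add_four_of_orthogonal ?_ ?_ ?_
  · exact inner_eq_zero_of_disjoint_fourier_support (isClosed_futureRegion d s)
      (isClosed_spacelikeRegion d) (disjoint_future_spacelike hs.out) h1 h2
  · exact inner_eq_zero_of_disjoint_fourier_support (isClosed_futureRegion d s)
      (isClosed_pastRegion d s) (disjoint_future_past hs.out) h1 h3
  · exact inner_eq_zero_of_disjoint_fourier_support (isClosed_spacelikeRegion d)
      (isClosed_pastRegion d s) (disjoint_spacelike_past hs.out) h2 h3

/-! ### Exponential test functions -/

/-- In the cone `‖ζ‖ ≤ 2τ`, so `x^n/n! ≤ e^x` at `x = a(1 + ‖ζ‖)/2` applies. Exponential decay in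
`τ` thus beats any polynomial weight on sheets and cone. -/
theorem exp_neg_mul_le_one_add_norm {d : ℕ} {a : ℝ} (ha : 0 < a) (n : ℕ) {ζ : Spacetime d}
    (h0 : 0 ≤ ζ.snd) (h : ‖ζ.fst‖ ≤ ζ.snd) :
    Real.exp (-a * ζ.snd) ≤
      n.factorial * (2 / a) ^ n * Real.exp (a / 2) * (1 + ‖ζ‖) ^ (-(n : ℝ)) := by
  have hn : ‖ζ‖ ≤ 2 * ζ.snd := by
    refine (abs_le_of_sq_le_sq' ?_ (by positivity)).2
    rw [WithLp.prod_norm_sq_eq_of_L2, Real.norm_eq_abs, sq_abs]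
    nlinarith [norm_nonneg ζ.fst, sq_nonneg ζ.snd]
  have hz := norm_nonneg ζ
  have h1 := Real.pow_div_factorial_le_exp (x := a / 2 * (1 + ‖ζ‖)) (by positivity) n
  have h2 : Real.exp (a / 2 * (1 + ‖ζ‖)) ≤ Real.exp (a / 2) * Real.exp (a * ζ.snd) := by
    rw [← Real.exp_add]
    refine Real.exp_le_exp.2 ?_
    nlinarith
  have h3 : (0 : ℝ) < n.factorial := by positivity
  rw [div_le_iff₀ h3, mul_pow] at h1
  rw [Real.rpow_neg (by positivity), Real.rpow_natCast, neg_mul, Real.exp_neg, inv_eq_one_div,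
    div_le_iff₀ (Real.exp_pos _), ← div_eq_mul_inv, div_mul_eq_mul_div, one_le_div (by positivity),
    div_pow]
  calc (1 + ‖ζ‖) ^ n = 2 ^ n / a ^ n * ((a / 2) ^ n * (1 + ‖ζ‖) ^ n) := by
        rw [div_pow]; field_simp
    _ ≤ 2 ^ n / a ^ n * (Real.exp (a / 2) * Real.exp (a * ζ.snd) * n.factorial) := by
        have := h1.trans (mul_le_mul_of_nonneg_right h2 h3.le)
        gcongr
    _ = _ := by ring

theorem integrable_exp_sigmaPlus {d : ℕ} {s : ℝ} [hs : Fact (0 < s)] {a : ℝ} (ha : 0 < a) :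
    Integrable (fun ζ : Spacetime d => Real.exp (-a * ζ.snd)) (sigmaPlus d s) := by
  obtain ⟨n, hn⟩ := (inferInstance : (sigmaPlus d s).HasTemperateGrowth).exists_integrable
  have hm := measurable_snd_spacetime d
  have hm1 := measurable_fst_spacetime d
  refine (hn.const_mul (n.factorial * (2 / a) ^ n * Real.exp (a / 2))).mono'
    (Measurable.aestronglyMeasurable (by fun_prop)) ?_
  have h : ∀ᵐ ζ ∂sigmaPlus d s, 0 ≤ ζ.snd ∧ ‖ζ.fst‖ ≤ ζ.snd := by
    refine ae_sigmaPlus ((measurableSet_le measurable_const hm).inter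
      (measurableSet_le hm1.norm hm)) fun y => ?_
    exact ⟨(psi_pos d hs.out y).le, (norm_lt_psi d hs.out y).le⟩
  filter_upwards [h] with ζ hζ
  rw [Real.norm_of_nonneg (Real.exp_pos _).le]
  exact exp_neg_mul_le_one_add_norm ha n hζ.1 hζ.2

theorem map_add_prod_sigmaPlus {d : ℕ} (hd : 2 ≤ d) {s : ℝ} (hs : 0 < s) :
    ((sigmaPlus d s).prod (sigmaPlus d s)).map (fun p => p.1 + p.2) =
      volume.withDensity fun ζ => ENNReal.ofReal (convDensity d s ζ) := by
  have hk := measurable_convDensity d s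
  refine Measure.ext_of_lintegral _ fun g hg => ?_
  rw [lintegral_map hg (by fun_prop), lintegral_prod_sigmaPlus_add hd hs hg,
    lintegral_withDensity_eq_lintegral_mul _ (by fun_prop) hg]
  rfl

theorem integral_prod_sigmaPlus_add {d : ℕ} (hd : 2 ≤ d) {s : ℝ} (hs : 0 < s)
    {V : Type*} [NormedAddCommGroup V] [NormedSpace ℝ V] {g : Spacetime d → V}
    (hg : StronglyMeasurable g) :
    ∫ p, g (p.1 + p.2) ∂(sigmaPlus d s).prod (sigmaPlus d s) = ∫ ζ, convDensity d s ζ • g ζ := by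
  have hk := measurable_convDensity d s
  rw [← integral_map (φ := fun p : Spacetime d × Spacetime d => p.1 + p.2)
    (Measurable.aemeasurable (by fun_prop)) hg.aestronglyMeasurable,
    map_add_prod_sigmaPlus hd hs, integral_withDensity_eq_integral_toReal_smul (by fun_prop)
      (Eventually.of_forall fun _ => ENNReal.ofReal_lt_top)]
  refine integral_congr_ae (Eventually.of_forall fun ζ => ?_)
  simp only
  rw [ENNReal.toReal_ofReal (convDensity_nonneg d s ζ)]

theorem integrable_convDensity_mul_exp {d : ℕ} (hd : 2 ≤ d) {s : ℝ} [hs : Fact (0 < s)] {a : ℝ}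
    (ha : 0 < a) :
    Integrable fun ζ : Spacetime d => convDensity d s ζ * Real.exp (-a * ζ.snd) := by
  have hk := measurable_convDensity d s
  have hm := measurable_snd_spacetime d
  have h1 : Integrable (fun ζ : Spacetime d => Real.exp (-a * ζ.snd))
      (volume.withDensity fun ζ => ENNReal.ofReal (convDensity d s ζ)) := by
    rw [← map_add_prod_sigmaPlus hd hs.out, integrable_map_measure
      (Measurable.aestronglyMeasurable (by fun_prop)) (Measurable.aemeasurable (by fun_prop))]
    have h2 := integrable_exp_sigmaPlus (d := d) (s := s) ha
    refine (h2.mul_prod h2).congr (Eventually.of_forall fun p => ?_)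
    simp only [Function.comp_apply]
    rw [← Real.exp_add, ← mul_add]
    rfl
  rw [integrable_withDensity_iff_integrable_smul' (by fun_prop)
    (Eventually.of_forall fun _ => ENNReal.ofReal_lt_top)] at h1
  refine h1.congr (Eventually.of_forall fun ζ => ?_)
  simp only
  rw [ENNReal.toReal_ofReal (convDensity_nonneg d s ζ), smul_eq_mul]

/-- The exponential turns sums into products, so the tensor square of the test function depends only
on `ζ + ζ'` and integrates against the density. This is why exponentials are the test functions. -/
theorem sq_integral_exp_sigmaPlus {d : ℕ} (hd : 2 ≤ d) {s : ℝ} (hs : 0 < s) (a : ℝ) :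
    (∫ ζ : Spacetime d, Real.exp (-a * ζ.snd) ∂sigmaPlus d s) ^ 2 =
      ∫ ζ, convDensity d s ζ * Real.exp (-a * ζ.snd) := by
  have hm := measurable_snd_spacetime d
  have h := integral_prod_sigmaPlus_add hd hs (g := fun ζ => Real.exp (-a * ζ.snd))
    (Measurable.stronglyMeasurable (by fun_prop))
  simp only [smul_eq_mul] at h
  rw [sq, ← integral_prod_mul, ← h]
  refine integral_congr_ae (Eventually.of_forall fun p => ?_)
  simp only
  rw [← Real.exp_add, ← mul_add]
  rfl

theorem memLp_exp_sigmaPlus {d : ℕ} {s : ℝ} [hs : Fact (0 < s)] {a : ℝ} (ha : 0 < a) :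
    MemLp (fun ζ : Spacetime d => (Real.exp (-a * ζ.snd) : ℂ)) 2 (sigmaPlus d s) := by
  have hm := measurable_snd_spacetime d
  rw [memLp_two_iff_integrable_sq_norm (Measurable.aestronglyMeasurable (by fun_prop))]
  refine (integrable_exp_sigmaPlus (d := d) (s := s) (a := 2 * a) (by positivity)).congr
    (Eventually.of_forall fun ζ => ?_)
  simp only
  rw [Complex.norm_real, Real.norm_of_nonneg (Real.exp_pos _).le, ← Real.exp_nat_mul]
  congr 1
  push_cast
  ring

/-- The exponential `e^{-aτ}` as an element of `L²(σ_s^+)`. -/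
def expLp (d : ℕ) (s : ℝ) [Fact (0 < s)] {a : ℝ} (ha : 0 < a) : Lp ℂ 2 (sigmaPlus d s) :=
  (memLp_exp_sigmaPlus ha).toLp

theorem coeFn_expLp {d : ℕ} {s : ℝ} [Fact (0 < s)] {a : ℝ} (ha : 0 < a) :
    expLp d s ha =ᵐ[sigmaPlus d s] fun ζ => (Real.exp (-a * ζ.snd) : ℂ) :=
  (memLp_exp_sigmaPlus ha).coeFn_toLp

theorem integrable_expLp {d : ℕ} {s : ℝ} [Fact (0 < s)] {a : ℝ} (ha : 0 < a) :
    Integrable (expLp d s ha) (sigmaPlus d s) :=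
  (integrable_exp_sigmaPlus ha).ofReal.congr (coeFn_expLp ha).symm

theorem norm_exp_sigmaPlus_four {d : ℕ} (hd : 2 ≤ d) {s : ℝ} [hs : Fact (0 < s)] {a : ℝ}
    (ha : 0 < a) :
    ‖expLp d s ha‖ ^ 4 =
      ∫ ζ : Spacetime d, convDensity d s ζ * Real.exp (-(2 * a) * ζ.snd) := by
  rw [← sq_integral_exp_sigmaPlus hd hs.out]
  have h : ‖expLp d s ha‖ ^ 2 =
      ∫ ζ : Spacetime d, Real.exp (-(2 * a) * ζ.snd) ∂sigmaPlus d s := by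
    have h1 := enorm_two_pow (expLp d s ha)
    rw [← ofReal_norm, ← ENNReal.ofReal_pow (norm_nonneg _)] at h1
    have h2 : ∫⁻ ζ, ‖expLp d s ha ζ‖ₑ ^ 2 ∂sigmaPlus d s =
        ENNReal.ofReal (∫ ζ : Spacetime d, Real.exp (-(2 * a) * ζ.snd) ∂sigmaPlus d s) := by
      rw [ofReal_integral_eq_lintegral_ofReal (integrable_exp_sigmaPlus (by positivity))
        (Eventually.of_forall fun ζ => (Real.exp_pos _).le)]
      refine lintegral_congr_ae ?_
      filter_upwards [coeFn_expLp (d := d) (s := s) ha] with ζ hζ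
      rw [hζ, ← ofReal_norm, Complex.norm_real, Real.norm_of_nonneg (Real.exp_pos _).le,
        ← ENNReal.ofReal_pow (Real.exp_pos _).le, ← Real.exp_nat_mul]
      congr 2
      push_cast
      ring
    rw [h2] at h1
    exact (ENNReal.ofReal_eq_ofReal_iff (by positivity)
      (integral_nonneg fun ζ => (Real.exp_pos _).le)).1 h1
  rw [← h]; ring

theorem integral_schwartz_mul_mulFour_self {d : ℕ} (hd : d = 2 ∨ d = 3) {s : ℝ}
    [hs : Fact (0 < s)]
    {E : Lp ℂ 2 (sigmaPlus d s) →L[ℂ] Lp ℂ 4 (volume : Measure (Spacetime d))}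
    (hE : ∀ f, Lp.toTemperedDistribution (E f) = adjointRestriction f)
    {f : Lp ℂ 2 (sigmaPlus d s)} (hf : Integrable f (sigmaPlus d s)) (φ : 𝓢(Spacetime d, ℂ)) :
    ∫ z, φ z * mulFour d (E f) (E f) z =
      ∫ p, expTransform d φ (id p.1 + id p.2) * (f p.1 * f p.2)
        ∂(sigmaPlus d s).prod (sigmaPlus d s) := by
  have hP : Measurable fun p : Spacetime d × Spacetime d => id p.1 + id p.2 := by fun_prop
  have h1 := integral_schwartz_mul_oscIntegral hP (hf.mul_prod hf) φ
  refine Eq.trans (integral_congr_ae ?_) h1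
  filter_upwards [coeFn_mulFour (E f) (E f),
    extension_ae_eq hE hf (oscIntegral_sigmaPlus_bound hd hs.out hf).1] with z h3 h4
  rw [h3, h4, oscIntegral_mul]

theorem integral_prod_expLp {d : ℕ} (hd : 2 ≤ d) {s : ℝ}
    [hs : Fact (0 < s)] {a : ℝ} (ha : 0 < a) {Φ : Spacetime d → ℂ} (hΦ : StronglyMeasurable Φ) :
    ∫ p, Φ (id p.1 + id p.2) * (expLp d s ha p.1 * expLp d s ha p.2)
        ∂(sigmaPlus d s).prod (sigmaPlus d s) =
      ∫ ζ, Φ ζ * ((convDensity d s ζ * Real.exp (-a * ζ.snd) : ℝ) : ℂ) := by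
  have hm := measurable_snd_spacetime d
  have hfe := coeFn_expLp (d := d) (s := s) ha
  have h3 := integral_prod_sigmaPlus_add hd hs.out
    (g := fun ζ => Φ ζ * (Real.exp (-a * ζ.snd) : ℂ))
    (hΦ.mul (Measurable.stronglyMeasurable (by fun_prop)))
  refine Eq.trans (integral_congr_ae ?_) (h3.trans (integral_congr_ae ?_))
  · filter_upwards [Measure.quasiMeasurePreserving_fst.ae hfe,
      Measure.quasiMeasurePreserving_snd.ae hfe] with p hp1 hp2
    rw [hp1, hp2, ← Complex.ofReal_mul, ← Real.exp_add, ← mul_add]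
    rfl
  · refine Eventually.of_forall fun ζ => ?_
    simp only [Complex.real_smul, Complex.ofReal_mul]
    ring

theorem norm_integral_schwartz_mul_le {d : ℕ} (φ : 𝓢(Spacetime d, ℂ))
    (G : Lp ℂ 2 (volume : Measure (Spacetime d))) :
    ‖∫ z, φ z * G z‖ ≤ ‖φ.toLp 2‖ * ‖G‖ := by
  have h5 : ∫ z, φ z * G z = inner ℂ (conjLp volume (φ.toLp 2)) G := by
    rw [L2.inner_def]
    refine integral_congr_ae ?_
    filter_upwards [coeFn_conjLp (φ.toLp 2 volume), SchwartzMap.coeFn_toLp φ 2 volume]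
      with z h6 h7
    rw [h6, h7]
    simp [mul_comm]
  rw [h5]
  refine (norm_inner_le_norm _ _).trans_eq ?_
  rw [norm_conjLp]

theorem integrable_sq_convDensity {d : ℕ} (hd : d = 2 ∨ d = 3) {s : ℝ} [hs : Fact (0 < s)]
    {a : ℝ} (ha : 0 < a) :
    Integrable fun ζ : Spacetime d => convDensity d s ζ *
      (convDensity d s ζ * Real.exp (-a * ζ.snd)) := by
  refine (integrable_convDensity_mul_exp (by omega) ha).bdd_mul
    (c := densityBound d s) (measurable_convDensity d s).aestronglyMeasurable
    (Eventually.of_forall fun ζ => ?_)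
  rw [Real.norm_of_nonneg (convDensity_nonneg d s ζ)]
  exact (convDensity_lt hd hs.out ζ).le

theorem lintegral_sq_convDensity {d : ℕ} (hd : d = 2 ∨ d = 3) {s : ℝ} [hs : Fact (0 < s)]
    {a : ℝ} (ha : 0 < a) :
    ∫⁻ ζ : Spacetime d, ‖((convDensity d s ζ * Real.exp (-a * ζ.snd) : ℝ) : ℂ)‖ₑ ^ 2 =
      ENNReal.ofReal (∫ ζ : Spacetime d, convDensity d s ζ *
        (convDensity d s ζ * Real.exp (-(2 * a) * ζ.snd))) := by
  have h0 := convDensity_nonneg d s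
  rw [ofReal_integral_eq_lintegral_ofReal (integrable_sq_convDensity hd (by positivity))
    (Eventually.of_forall fun ζ => mul_nonneg (h0 ζ) (mul_nonneg (h0 ζ) (Real.exp_pos _).le))]
  refine lintegral_congr fun ζ => ?_
  rw [← ofReal_norm, Complex.norm_real, Real.norm_of_nonneg
    (mul_nonneg (h0 ζ) (Real.exp_pos _).le), ← ENNReal.ofReal_pow
    (mul_nonneg (h0 ζ) (Real.exp_pos _).le), mul_pow, ← Real.exp_nat_mul]
  congr 1
  rw [sq, mul_assoc]
  congr 3
  push_cast
  ring

/-- Plancherel's theorem for the square of the extension of an exponential. -/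
theorem integral_sq_convDensity_le {d : ℕ} (hd : d = 2 ∨ d = 3) {s : ℝ} [hs : Fact (0 < s)]
    {E : Lp ℂ 2 (sigmaPlus d s) →L[ℂ] Lp ℂ 4 (volume : Measure (Spacetime d))}
    (hE : ∀ f, Lp.toTemperedDistribution (E f) = adjointRestriction f) {a : ℝ} (ha : 0 < a) :
    (2 * Real.pi) ^ (d + 1) * ∫ ζ : Spacetime d, convDensity d s ζ *
        (convDensity d s ζ * Real.exp (-(2 * a) * ζ.snd)) ≤
      ‖E (expLp d s ha)‖ ^ 4 := by
  have hd2 : 2 ≤ d := by omega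
  have hui : Integrable fun ζ : Spacetime d =>
      ((convDensity d s ζ * Real.exp (-a * ζ.snd) : ℝ) : ℂ) :=
    (integrable_convDensity_mul_exp hd2 ha).ofReal
  have hpi := Real.pi_pos
  obtain ⟨R, hRp, hR2⟩ : ∃ R : ℝ, 0 < R ∧ R ^ 2 = (2 * Real.pi) ^ (d + 1) :=
    ⟨Real.sqrt ((2 * Real.pi) ^ (d + 1)), Real.sqrt_pos.2 (by positivity),
      Real.sq_sqrt (by positivity)⟩
  -- Up to scaling, `k e^{-aτ}` is the Fourier transform of the squared extension. Every Schwartz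
  -- `Φ` is the transform of some `φ`, so Cauchy-Schwarz and Plancherel bound the pairing of `k
  -- e^{-aτ}` with `Φ`, and duality gives its `L²` bound.
  have hbound : ∀ Φ : 𝓢(Spacetime d, ℂ),
      ‖∫ ζ, Φ ζ * ((convDensity d s ζ * Real.exp (-a * ζ.snd) : ℝ) : ℂ)‖ ≤
        (‖E (expLp d s ha)‖ ^ 2 / R) * ‖Φ.toLp 2‖ := by
    intro Φ
    obtain ⟨φ, rfl⟩ := expTransform_surjective d Φ
    have hn : ‖(expTransform d φ).toLp 2‖ = R * ‖φ.toLp 2‖ := by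
      have := norm_expTransform_sq φ
      rw [← hR2, ← mul_pow] at this
      exact (sq_eq_sq₀ (norm_nonneg _) (by positivity)).1 this
    have h1 := norm_integral_schwartz_mul_le φ
      (mulFour d (E (expLp d s ha)) (E (expLp d s ha)))
    have h2 := (integral_schwartz_mul_mulFour_self hd hE (integrable_expLp ha) φ).trans
      (integral_prod_expLp hd2 ha (expTransform d φ).continuous.stronglyMeasurable)
    have h3 := norm_mulFour_self (E (expLp d s ha))
    have key : ∀ x m e u v : ℝ, x ≤ u * m → m = e ^ 2 → v = R * u → x ≤ e ^ 2 / R * v := by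
      intro x m e u v h h' h''
      subst h' h''
      refine h.trans_eq ?_
      field_simp
    exact key _ _ _ _ _ ((congrArg norm h2).symm.trans_le h1) h3 hn
  have hmain := memLp_two_of_schwartz (C := ‖E (expLp d s ha)‖ ^ 2 / R) (by positivity)
    hui.locallyIntegrable (fun Φ => by
      obtain ⟨C, hC⟩ := Φ.decay 0 0
      exact hui.bdd_mul (c := C) Φ.continuous.aestronglyMeasurable
        (Eventually.of_forall fun z => by simpa using hC.2 z)) hbound
  have h8 := pow_le_pow_left₀ (by simp) hmain.2 2
  rw [eLpNorm_two_pow, ← ENNReal.ofReal_pow (by positivity), div_pow, hR2,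
    lintegral_sq_convDensity hd ha, ENNReal.ofReal_le_ofReal_iff (by positivity),
    le_div_iff₀ (by positivity)] at h8
  linarith

/-! ### The lower bound for the constant of one sheet -/

/-- Test with `e^{-aτ/2}`: its fourth-power norm is `∫ k e^{-aτ}`, while its extension has at least
`(2π)^(d+1) ∫ k² e^{-aτ}`. An admissible `C` therefore dominates the mean of `k` in the weight `k
e^{-aτ}`. -/
theorem integral_convDensity_sub_le {d : ℕ} (hd : d = 2 ∨ d = 3) {s : ℝ} [hs : Fact (0 < s)]
    {E : Lp ℂ 2 (sigmaPlus d s) →L[ℂ] Lp ℂ 4 (volume : Measure (Spacetime d))}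
    (hE : ∀ f, Lp.toTemperedDistribution (E f) = adjointRestriction f) {C : ℝ}
    (hC : ∀ f, ‖E f‖ ^ 4 ≤ (2 * Real.pi) ^ (d + 1) * C * ‖f‖ ^ 4) {a : ℝ} (ha : 0 < a) :
    ∫ ζ : Spacetime d, (convDensity d s ζ - C) *
      (convDensity d s ζ * Real.exp (-a * ζ.snd)) ≤ 0 := by
  have h1 := integral_sq_convDensity_le hd hE (half_pos ha)
  have h2 := hC (expLp d s (half_pos ha))
  rw [norm_exp_sigmaPlus_four (by omega)] at h2
  rw [mul_div_cancel₀ a two_ne_zero] at h1 h2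
  have h3 := h1.trans h2
  rw [mul_assoc, mul_le_mul_iff_right₀ (by have := Real.pi_pos; positivity)] at h3
  simp only [sub_mul]
  rw [integral_sub (integrable_sq_convDensity hd ha)
    ((integrable_convDensity_mul_exp (by omega) ha).const_mul C), integral_const_mul]
  linarith

/-! ### The case `d = 2`: concentration at the vertex. -/

theorem isOpen_densitySupport (d : ℕ) (s : ℝ) :
    IsOpen {ζ : Spacetime d | Real.sqrt (4 * s ^ 2 + ‖ζ.fst‖ ^ 2) < ζ.snd} := by
  have h1 := (WithLp.continuous_fst 2 (EuclideanSpace ℝ (Fin d)) ℝ)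
  have h2 := (WithLp.continuous_snd 2 (EuclideanSpace ℝ (Fin d)) ℝ)
  exact isOpen_lt (by fun_prop) h2

/-- On its support the density is `A/m`, and `m ≤ τ`. -/
theorem convDensity_two_bounds {s : ℝ} {ζ : Spacetime 2}
    (h : convDensity 2 s ζ ≠ 0) :
    0 < ζ.snd ∧ sphereArea 2 / ζ.snd ≤ convDensity 2 s ζ := by
  have hA := sphereArea_pos (d := 2) le_rfl
  unfold convDensity at h ⊢
  split_ifs at h ⊢ with hc
  · have hτ : 0 < ζ.snd := lt_of_le_of_lt (Real.sqrt_nonneg _) hc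
    have h1 := (Real.sqrt_lt' hτ).1 hc
    refine ⟨hτ, ?_⟩
    unfold radialDensity
    simp only [le_refl, tsub_eq_zero_of_le, pow_zero, mul_one_div]
    refine div_le_div_of_nonneg_left hA.le (Real.sqrt_pos.2 (by nlinarith)) ?_
    exact Real.sqrt_le_iff.2 ⟨hτ.le, by nlinarith [sq_nonneg ‖ζ.fst‖]⟩
  · exact absurd rfl h

theorem convDensity_two_pos {s : ℝ} {ζ : Spacetime 2}
    (h : Real.sqrt (4 * s ^ 2 + ‖ζ.fst‖ ^ 2) < ζ.snd) : 0 < convDensity 2 s ζ := by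
  have hA := sphereArea_pos (d := 2) le_rfl
  have hτ : 0 < ζ.snd := lt_of_le_of_lt (Real.sqrt_nonneg _) h
  have h1 := (Real.sqrt_lt' hτ).1 h
  have h2 : 0 < Real.sqrt (ζ.snd ^ 2 - ‖ζ.fst‖ ^ 2) := Real.sqrt_pos.2 (by nlinarith)
  unfold convDensity radialDensity
  rw [if_pos h]
  simp only [le_refl, tsub_eq_zero_of_le, pow_zero]
  positivity

theorem integral_convDensity_two_pos {s : ℝ} [hs : Fact (0 < s)] {t : ℝ} (ht : 2 * s < t) :
    0 < ∫ ζ in {ζ : Spacetime 2 | ζ.snd < t}, convDensity 2 s ζ * Real.exp (-1 * ζ.snd) := by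
  have hm := measurable_snd_spacetime 2
  have hS : MeasurableSet {ζ : Spacetime 2 | ζ.snd < t} := measurableSet_lt hm measurable_const
  rw [setIntegral_pos_iff_support_of_nonneg_ae
    (Eventually.of_forall fun ζ => mul_nonneg (convDensity_nonneg 2 s ζ) (Real.exp_pos _).le)
    (integrable_convDensity_mul_exp le_rfl one_pos).integrableOn]
  have ho : IsOpen ({ζ : Spacetime 2 | Real.sqrt (4 * s ^ 2 + ‖ζ.fst‖ ^ 2) < ζ.snd} ∩
      {ζ : Spacetime 2 | ζ.snd < t}) :=
    (isOpen_densitySupport 2 s).inter (isOpen_lt (WithLp.continuous_snd 2 _ _) continuous_const)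
  refine (ho.measure_pos volume ?_).trans_le (measure_mono (Set.inter_subset_inter_left _ ?_))
  · refine ⟨WithLp.toLp 2 (0, (2 * s + t) / 2), ?_, ?_⟩
    · have h0 := hs.out
      change Real.sqrt (4 * s ^ 2 + ‖(0 : EuclideanSpace ℝ (Fin 2))‖ ^ 2) < (2 * s + t) / 2
      rw [Real.sqrt_lt' (by linarith), norm_zero]
      nlinarith
    · change (2 * s + t) / 2 < t
      linarith
  · intro ζ hζ
    exact (mul_pos (convDensity_two_pos hζ) (Real.exp_pos _)).ne'

/-- As `a → ∞` the weight `e^{-aτ}` favours the smallest `τ` in the support, near `2s`, where the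
density is close to its supremum. A `C` below the supremum would make the integral positive for
large `a`. -/
theorem densityBound_two_le {s : ℝ} [hs : Fact (0 < s)] {C : ℝ}
    (hC : ∀ a : ℝ, 0 < a → ∫ ζ : Spacetime 2, (convDensity 2 s ζ - C) *
      (convDensity 2 s ζ * Real.exp (-a * ζ.snd)) ≤ 0) : densityBound 2 s ≤ C := by
  by_contra! hlt
  have hs0 := hs.out
  have hA := sphereArea_pos (d := 2) le_rfl
  have hM := densityBound_pos (d := 2) (Or.inl rfl) hs0
  have hm := measurable_snd_spacetime 2
  -- Levels `max(C, 0) < c < b < sup k`; positivity of `c` is needed because `C` may be negative. On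
  -- the support `k ≥ b` for `τ < t₁ = A/b`, and `k ≥ c` for `τ ≤ t₀ = A/c`.
  obtain ⟨c, hc1, hc2⟩ := exists_between (max_lt hlt hM)
  obtain ⟨b, hb1, hb2⟩ := exists_between hc2
  have hc0 : 0 < c := (le_max_right _ _).trans_lt hc1
  have hCc : C < c := (le_max_left _ _).trans_lt hc1
  have hb0 : 0 < b := hc0.trans hb1
  set t₀ := sphereArea 2 / c with ht₀
  set t₁ := sphereArea 2 / b with ht₁
  have ht : t₁ < t₀ := div_lt_div_of_pos_left hA hc0 hb1
  have ht2 : 2 * s < t₁ := by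
    rw [densityBound, if_pos rfl, lt_div_iff₀ (by positivity)] at hb2
    rw [ht₁, lt_div_iff₀ hb0]; linarith
  have hS : MeasurableSet {ζ : Spacetime 2 | ζ.snd < t₁} := measurableSet_lt hm measurable_const
  have hP := integral_convDensity_two_pos ht2
  set P := ∫ ζ in {ζ : Spacetime 2 | ζ.snd < t₁}, convDensity 2 s ζ * Real.exp (-1 * ζ.snd)
    with hPd
  have hI := integrable_convDensity_mul_exp (d := 2) (s := s) le_rfl one_pos
  set Q := ∫ ζ : Spacetime 2, convDensity 2 s ζ * Real.exp (-1 * ζ.snd) with hQd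
  -- Take `a = 1 + t` and multiply by `e^{t t₀}`. The part `τ < t₁` gains at least `(b - c)e^{t(t₀ -
  -- t₁)}P`, the middle is nonnegative, and beyond `t₀` the loss is at most `cQ`.
  have main : ∀ t : ℝ, 0 ≤ t → (b - c) * Real.exp (t * (t₀ - t₁)) * P ≤ c * Q := by
    intro t h0
    have hi1 : Integrable fun ζ : Spacetime 2 => Real.exp (t * t₀) * ((convDensity 2 s ζ - C) *
        (convDensity 2 s ζ * Real.exp (-(1 + t) * ζ.snd))) := by
      simp only [sub_mul]
      exact ((integrable_sq_convDensity (Or.inl rfl) (by positivity)).sub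
        ((integrable_convDensity_mul_exp le_rfl (by positivity)).const_mul C)).const_mul _
    have hi2 : Integrable fun ζ : Spacetime 2 => (b - c) * Real.exp (t * (t₀ - t₁)) *
        ({ζ : Spacetime 2 | ζ.snd < t₁}.indicator
          (fun ζ => convDensity 2 s ζ * Real.exp (-1 * ζ.snd)) ζ) -
        c * (convDensity 2 s ζ * Real.exp (-1 * ζ.snd)) :=
      ((hI.indicator hS).const_mul _).sub (hI.const_mul _)
    have h1 := integral_mono hi2 hi1 fun ζ => ?_
    · rw [integral_sub ((hI.indicator hS).const_mul _) (hI.const_mul _), integral_const_mul,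
        integral_const_mul, integral_const_mul, integral_indicator hS] at h1
      have h2 := mul_nonpos_of_nonneg_of_nonpos (Real.exp_pos (t * t₀)).le
        (hC (1 + t) (by positivity))
      linarith
    · simp only
      have hk0 := convDensity_nonneg 2 s ζ
      have e1 : Real.exp (t * t₀) * ((convDensity 2 s ζ - C) *
          (convDensity 2 s ζ * Real.exp (-(1 + t) * ζ.snd))) =
          (convDensity 2 s ζ - C) * (convDensity 2 s ζ * Real.exp (-1 * ζ.snd)) *
            Real.exp (t * (t₀ - ζ.snd)) := by
        have : Real.exp (-(1 + t) * ζ.snd) * Real.exp (t * t₀) =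
            Real.exp (-1 * ζ.snd) * Real.exp (t * (t₀ - ζ.snd)) := by
          rw [← Real.exp_add, ← Real.exp_add]; ring_nf
        linear_combination (convDensity 2 s ζ - C) * convDensity 2 s ζ * this
      rw [e1]
      by_cases hz : convDensity 2 s ζ = 0
      · simp [Set.indicator_apply, hz]
      obtain ⟨hτ, hk⟩ := convDensity_two_bounds hz
      set w := convDensity 2 s ζ * Real.exp (-1 * ζ.snd) with hw
      have hw0 : 0 ≤ w := by positivity
      have he := Real.exp_pos (t * (t₀ - ζ.snd))
      rcases lt_or_ge ζ.snd t₁ with h2 | h2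
      · rw [Set.indicator_of_mem (by exact h2)]
        have h3 : b ≤ convDensity 2 s ζ := by
          refine le_trans ?_ hk
          rw [le_div_iff₀ hτ]
          rw [ht₁, lt_div_iff₀ hb0] at h2
          linarith
        have h4 : Real.exp (t * (t₀ - t₁)) ≤ Real.exp (t * (t₀ - ζ.snd)) :=
          Real.exp_le_exp.2 (mul_le_mul_of_nonneg_left (by linarith) h0)
        have h5 := mul_le_mul (show b - c ≤ convDensity 2 s ζ - C by linarith) h4
          (Real.exp_pos _).le (by linarith)
        nlinarith [mul_le_mul_of_nonneg_right h5 hw0, mul_nonneg hc0.le hw0]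
      · rw [Set.indicator_of_notMem (by simpa using h2), mul_zero, zero_sub]
        rcases le_or_gt ζ.snd t₀ with h3 | h3
        · have h4 : c ≤ convDensity 2 s ζ := by
            refine le_trans ?_ hk
            rw [le_div_iff₀ hτ]
            rw [ht₀, le_div_iff₀ hc0] at h3
            linarith
          have h5 : 0 ≤ (convDensity 2 s ζ - C) * w * Real.exp (t * (t₀ - ζ.snd)) :=
            mul_nonneg (mul_nonneg (by linarith) hw0) he.le
          nlinarith [mul_nonneg hc0.le hw0]
        · have h4 : Real.exp (t * (t₀ - ζ.snd)) ≤ 1 :=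
            Real.exp_le_one_iff.2 (mul_nonpos_of_nonneg_of_nonpos h0 (by linarith))
          have h5 : -c ≤ convDensity 2 s ζ - C := by linarith
          calc -(c * w) ≤ -(c * w) * Real.exp (t * (t₀ - ζ.snd)) := by
                nlinarith [mul_nonneg hc0.le hw0]
            _ = -c * (w * Real.exp (t * (t₀ - ζ.snd))) := by ring
            _ ≤ (convDensity 2 s ζ - C) * (w * Real.exp (t * (t₀ - ζ.snd))) :=
                mul_le_mul_of_nonneg_right h5 (mul_nonneg hw0 he.le)
            _ = _ := by ring
  have hδ : 0 < (b - c) * (t₀ - t₁) * P := by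
    have h1 : 0 < b - c := by linarith
    have h2 : 0 < t₀ - t₁ := by linarith
    positivity
  have hQ0 : 0 ≤ Q := integral_nonneg fun ζ =>
    mul_nonneg (convDensity_nonneg 2 s ζ) (Real.exp_pos _).le
  -- For this `t` the linear term of `e^x ≥ 1 + x` already yields `cQ`; the term `1` overshoots by
  -- `(b - c)P > 0`.
  have h1 := main (c * Q / ((b - c) * (t₀ - t₁) * P)) (by positivity)
  have h2 := Real.add_one_le_exp (c * Q / ((b - c) * (t₀ - t₁) * P) * (t₀ - t₁))
  have h3 : (b - c) * P * (c * Q / ((b - c) * (t₀ - t₁) * P) * (t₀ - t₁)) = c * Q := by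
    have e1 : b - c ≠ 0 := (sub_pos.2 hb1).ne'
    have e2 : t₀ - t₁ ≠ 0 := (sub_pos.2 ht).ne'
    field_simp
  have h4 : 0 < (b - c) * P := mul_pos (by linarith) hP
  nlinarith [mul_le_mul_of_nonneg_left h2 h4.le]

/-! ### The case `d = 3`: escape to infinity in the cone. -/

/-- The solid light cone. -/
def lightCone (d : ℕ) : Set (Spacetime d) := {ζ | ‖ζ.fst‖ < ζ.snd}

theorem isOpen_lightCone (d : ℕ) : IsOpen (lightCone d) :=
  isOpen_lt (WithLp.continuous_fst 2 _ _).norm (WithLp.continuous_snd 2 _ _)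

theorem integrableOn_exp_lightCone (d : ℕ) :
    IntegrableOn (fun ζ : Spacetime d => Real.exp (-1 * ζ.snd)) (lightCone d) := by
  have hm := measurable_snd_spacetime d
  have h := (integrable_one_add_norm (E := Spacetime d) (μ := volume) (r := ((d + 2 : ℕ) : ℝ)) (by
    rw [finrank_spacetime]; exact_mod_cast Nat.lt_succ_self _)).const_mul
      ((d + 2).factorial * (2 / 1) ^ (d + 2) * Real.exp (1 / 2))
  refine h.integrableOn.mono' (Measurable.aestronglyMeasurable (by fun_prop)) ?_
  refine (ae_restrict_iff' (isOpen_lightCone d).measurableSet).2 (Eventually.of_forall ?_)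
  intro ζ hζ
  rw [Real.norm_of_nonneg (Real.exp_pos _).le]
  have hζ' : ‖ζ.fst‖ < ζ.snd := hζ
  exact exp_neg_mul_le_one_add_norm one_pos (d + 2) ((norm_nonneg _).trans hζ'.le) hζ'.le

theorem convDensity_eq_zero_of_notMem {d : ℕ} {s : ℝ} {ζ : Spacetime d} (h : ζ ∉ lightCone d) :
    convDensity d s ζ = 0 := by
  unfold convDensity
  refine if_neg fun h1 => h ?_
  exact lt_of_le_of_lt (Real.le_sqrt_of_sq_le (by nlinarith [sq_nonneg s])) h1

/-- At scale `r` and with `q = τ² - |ξ|²`, the density is `A√(q/4 - s²/r²)/√q`: the mass becomes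
negligible. -/
theorem tendsto_convDensity_three {s : ℝ} {ζ : Spacetime 3} (h : ζ ∈ lightCone 3) :
    Tendsto (fun n : ℕ => convDensity 3 s (((n : ℝ) + 1) • ζ)) atTop
      (𝓝 (sphereArea 3 / 2)) := by
  have h1 : ‖ζ.fst‖ < ζ.snd := h
  have hτ : 0 < ζ.snd := (norm_nonneg _).trans_lt h1
  have hq : 0 < ζ.snd ^ 2 - ‖ζ.fst‖ ^ 2 := by nlinarith [norm_nonneg ζ.fst]
  set q := ζ.snd ^ 2 - ‖ζ.fst‖ ^ 2 with hqd
  have hn : Tendsto (fun n : ℕ => ((n : ℝ) + 1)) atTop atTop :=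
    tendsto_atTop_add_const_right _ _ tendsto_natCast_atTop_atTop
  have hev : ∀ᶠ n : ℕ in atTop, convDensity 3 s (((n : ℝ) + 1) • ζ) =
      sphereArea 3 * (Real.sqrt (q / 4 - s ^ 2 / ((n : ℝ) + 1) ^ 2) / Real.sqrt q) := by
    have h2 : ∀ᶠ n : ℕ in atTop, 4 * s ^ 2 / q < ((n : ℝ) + 1) ^ 2 :=
      ((tendsto_pow_atTop two_ne_zero).comp hn).eventually_gt_atTop _
    filter_upwards [h2] with n hn2
    have hp : (0 : ℝ) < (n : ℝ) + 1 := by positivity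
    set r := (n : ℝ) + 1
    rw [div_lt_iff₀ hq] at hn2
    have e1 : (r • ζ).snd = r * ζ.snd := rfl
    have e2 : ‖(r • ζ).fst‖ = r * ‖ζ.fst‖ := by
      rw [show (r • ζ).fst = r • ζ.fst from rfl, norm_smul, Real.norm_of_nonneg hp.le]
    unfold convDensity
    rw [e1, e2, if_pos ((Real.sqrt_lt' (by positivity)).2 (by nlinarith))]
    unfold radialDensity
    have e3 : (r * ζ.snd) ^ 2 - (r * ‖ζ.fst‖) ^ 2 = r ^ 2 * q := by rw [hqd]; ring
    have e4 : r ^ 2 * q / 4 - s ^ 2 = r ^ 2 * (q / 4 - s ^ 2 / r ^ 2) := by field_simp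
    rw [e3, e4, Real.sqrt_mul (by positivity), Real.sqrt_mul (by positivity),
      Real.sqrt_sq hp.le]
    norm_num
    rw [mul_div_mul_left _ _ hp.ne']
    tauto
  refine Tendsto.congr' (hev.mono fun n h => h.symm) ?_
  have hz : Tendsto (fun n : ℕ => s ^ 2 / ((n : ℝ) + 1) ^ 2) atTop (𝓝 0) :=
    tendsto_const_nhds.div_atTop ((tendsto_pow_atTop two_ne_zero).comp hn)
  have h3 : Tendsto (fun n : ℕ => sphereArea 3 *
      (Real.sqrt (q / 4 - s ^ 2 / ((n : ℝ) + 1) ^ 2) / Real.sqrt q)) atTop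
      (𝓝 (sphereArea 3 * (Real.sqrt (q / 4 - 0) / Real.sqrt q))) :=
    (((tendsto_const_nhds.sub hz).sqrt).div_const _).const_mul _
  convert h3 using 2
  rw [sub_zero, Real.sqrt_div hq.le, show (4 : ℝ) = 2 ^ 2 by norm_num, Real.sqrt_sq (by norm_num)]
  have := Real.sqrt_pos.2 hq
  field_simp

/-- Take `a = 1/(n + 1)` and rescale `ζ` by `n + 1`, which fixes the exponential. The density tends
to its supremum `M` on the open cone and vanishes outside, so dominated convergence gives `(M - C)M
∫ e^{-τ} ≤ 0` over the cone. -/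
theorem densityBound_three_le {s : ℝ} [hs : Fact (0 < s)] {C : ℝ}
    (hC : ∀ a : ℝ, 0 < a → ∫ ζ : Spacetime 3, (convDensity 3 s ζ - C) *
      (convDensity 3 s ζ * Real.exp (-a * ζ.snd)) ≤ 0) : densityBound 3 s ≤ C := by
  by_contra! hlt
  have hM := densityBound_pos (d := 3) (Or.inr rfl) hs.out
  have hMd : densityBound 3 s = sphereArea 3 / 2 := by simp [densityBound]
  set M := densityBound 3 s with hMdef
  have hm := measurable_snd_spacetime 3
  have hk := measurable_convDensity 3 s
  have hS := (isOpen_lightCone 3).measurableSet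
  have hint := integrableOn_exp_lightCone 3
  have hscale : ∀ n : ℕ, ∫ ζ : Spacetime 3, (convDensity 3 s (((n : ℝ) + 1) • ζ) - C) *
      (convDensity 3 s (((n : ℝ) + 1) • ζ) * Real.exp (-1 * ζ.snd)) ≤ 0 := by
    intro n
    have hp : (0 : ℝ) < (n : ℝ) + 1 := by positivity
    have h1 := Measure.integral_comp_smul (volume : Measure (Spacetime 3))
      (fun ζ => (convDensity 3 s ζ - C) *
        (convDensity 3 s ζ * Real.exp (-((n : ℝ) + 1)⁻¹ * ζ.snd))) ((n : ℝ) + 1)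
    have h2 : ∀ ζ : Spacetime 3, -((n : ℝ) + 1)⁻¹ * (((n : ℝ) + 1) • ζ).snd = -1 * ζ.snd := by
      intro ζ
      rw [show (((n : ℝ) + 1) • ζ).snd = ((n : ℝ) + 1) * ζ.snd from rfl]
      field_simp
    simp only [h2] at h1
    rw [h1, smul_eq_mul]
    exact mul_nonpos_of_nonneg_of_nonpos (abs_nonneg _) (hC _ (by positivity))
  have hlim : Tendsto (fun n : ℕ => ∫ ζ : Spacetime 3,
      (convDensity 3 s (((n : ℝ) + 1) • ζ) - C) *
        (convDensity 3 s (((n : ℝ) + 1) • ζ) * Real.exp (-1 * ζ.snd))) atTop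
      (𝓝 (∫ ζ : Spacetime 3, (lightCone 3).indicator
        (fun ζ => (M - C) * (M * Real.exp (-1 * ζ.snd))) ζ)) := by
    refine tendsto_integral_of_dominated_convergence
      ((lightCone 3).indicator fun ζ => (M + |C|) * (M * Real.exp (-1 * ζ.snd))) ?_ ?_ ?_ ?_
    · intro n
      exact Measurable.aestronglyMeasurable (by fun_prop)
    · exact (integrable_indicator_iff hS).2 ((hint.const_mul M).const_mul _)
    · intro n
      refine Eventually.of_forall fun ζ => ?_
      by_cases hζ : ζ ∈ lightCone 3
      · rw [Set.indicator_of_mem hζ]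
        have h1 := (convDensity_lt (Or.inr rfl) hs.out (((n : ℝ) + 1) • ζ)).le
        have h0 := convDensity_nonneg 3 s (((n : ℝ) + 1) • ζ)
        rw [norm_mul, Real.norm_of_nonneg (mul_nonneg h0 (Real.exp_pos _).le), Real.norm_eq_abs]
        refine mul_le_mul ((abs_sub _ _).trans ?_) (by gcongr)
          (mul_nonneg h0 (Real.exp_pos _).le) (by positivity)
        rw [abs_of_nonneg h0]
        gcongr
      · rw [Set.indicator_of_notMem hζ, convDensity_eq_zero_of_notMem]
        · simp
        · intro h2
          refine hζ ?_
          have hp : (0 : ℝ) < (n : ℝ) + 1 := by positivity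
          have h3 : ‖((n : ℝ) + 1) • ζ.fst‖ < ((n : ℝ) + 1) * ζ.snd := h2
          rw [norm_smul, Real.norm_of_nonneg hp.le] at h3
          exact lt_of_mul_lt_mul_left h3 hp.le
    · refine Eventually.of_forall fun ζ => ?_
      by_cases hζ : ζ ∈ lightCone 3
      · rw [Set.indicator_of_mem hζ, hMd]
        have := tendsto_convDensity_three (s := s) hζ
        exact (this.sub_const C).mul (this.mul_const _)
      · rw [Set.indicator_of_notMem hζ]
        have : ∀ n : ℕ, convDensity 3 s (((n : ℝ) + 1) • ζ) = 0 := fun n => by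
          refine convDensity_eq_zero_of_notMem fun h2 => hζ ?_
          have hp : (0 : ℝ) < (n : ℝ) + 1 := by positivity
          have h3 : ‖((n : ℝ) + 1) • ζ.fst‖ < ((n : ℝ) + 1) * ζ.snd := h2
          rw [norm_smul, Real.norm_of_nonneg hp.le] at h3
          exact lt_of_mul_lt_mul_left h3 hp.le
        simp [this]
  have hle := le_of_tendsto' hlim hscale
  rw [integral_indicator hS] at hle
  have hpos : 0 < ∫ ζ in lightCone 3, (M - C) * (M * Real.exp (-1 * ζ.snd)) := by
    have hMC : 0 < M - C := by linarith
    rw [setIntegral_pos_iff_support_of_nonneg_ae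
      (Eventually.of_forall fun ζ => by simp only [Pi.zero_apply]; positivity)
      ((hint.const_mul M).const_mul _)]
    have : (Function.support fun ζ : Spacetime 3 => (M - C) * (M * Real.exp (-1 * ζ.snd))) =
        Set.univ := Set.eq_univ_of_forall fun ζ => by
      rw [Function.mem_support]; positivity
    rw [this, Set.univ_inter]
    refine (isOpen_lightCone 3).measure_pos volume ⟨WithLp.toLp 2 (0, 1), ?_⟩
    change ‖(0 : EuclideanSpace ℝ (Fin 3))‖ < 1
    simp
  linarith

theorem sheetBound_le {d : ℕ} (hd : d = 2 ∨ d = 3) {s : ℝ} [hs : Fact (0 < s)]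
    {E : Lp ℂ 2 (sigmaPlus d s) →L[ℂ] Lp ℂ 4 (volume : Measure (Spacetime d))}
    (hE : ∀ f, Lp.toTemperedDistribution (E f) = adjointRestriction f) {C : ℝ}
    (hC : ∀ f, ‖E f‖ ^ 4 ≤ C * ‖f‖ ^ 4) : sheetBound d s ≤ C := by
  have hpi : 0 < (2 * Real.pi) ^ (d + 1) := by have := Real.pi_pos; positivity
  have h := fun a ha => integral_convDensity_sub_le hd hE
    (C := C / (2 * Real.pi) ^ (d + 1)) (fun f => by rw [mul_div_cancel₀ _ hpi.ne']; exact hC f)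
    (a := a) ha
  rw [sheetBound, mul_comm, ← le_div_iff₀ hpi]
  rcases hd with rfl | rfl
  · exact densityBound_two_le h
  · exact densityBound_three_le h

/-! ### Best constants as operator norms -/

section OpNorm

variable {μ : Measure (Spacetime d)} [μ.HasTemperateGrowth]
  {E : Lp ℂ 2 μ →L[ℂ] Lp ℂ 4 (volume : Measure (Spacetime d))}

theorem bestConst_eq_opNorm
    (hE : ∀ f, Lp.toTemperedDistribution (E f) = adjointRestriction f) :
    bestConst 4 μ = ENNReal.ofReal ‖E‖ := by
  have hle : bestConst 4 μ ≤ ENNReal.ofReal ‖E‖ := by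
    refine iSup₂_le fun f hf => ?_
    rw [distLpNorm_eq (hE f)]
    refine ENNReal.div_le_of_le_mul ?_
    rw [← ofReal_norm, ← ofReal_norm, ← ENNReal.ofReal_mul (norm_nonneg _)]
    exact ENNReal.ofReal_le_ofReal (E.le_opNorm f)
  have hfin : bestConst 4 μ ≠ ∞ := ne_top_of_le_ne_top ENNReal.ofReal_ne_top hle
  refine le_antisymm hle (ENNReal.ofReal_le_of_le_toReal ?_)
  refine E.opNorm_le_bound ENNReal.toReal_nonneg fun f => ?_
  by_cases hf : f = 0
  · simp [hf]
  have h1 : distLpNorm 4 (adjointRestriction f) / ‖f‖ₑ ≤ bestConst 4 μ :=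
    le_iSup₂ (f := fun (f : Lp ℂ 2 μ) (_ : f ≠ 0) =>
      distLpNorm 4 (adjointRestriction f) / ‖f‖ₑ) f hf
  rw [distLpNorm_eq (hE f), ENNReal.div_le_iff (by simpa using hf) enorm_ne_top] at h1
  have h2 := ENNReal.toReal_mono (ENNReal.mul_ne_top hfin enorm_ne_top) h1
  rwa [ENNReal.toReal_mul, toReal_enorm, toReal_enorm] at h2

theorem isExtremizer_iff
    (hE : ∀ f, Lp.toTemperedDistribution (E f) = adjointRestriction f) {f : Lp ℂ 2 μ} :
    IsExtremizer 4 μ f ↔ f ≠ 0 ∧ ‖E f‖ = ‖E‖ * ‖f‖ := by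
  rw [IsExtremizer, distLpNorm_eq (hE f), bestConst_eq_opNorm hE, ← ofReal_norm, ← ofReal_norm,
    ← ENNReal.ofReal_mul (norm_nonneg _), ENNReal.ofReal_eq_ofReal_iff (norm_nonneg _)
    (by positivity)]

theorem isExtremizingSeq_iff
    (hE : ∀ f, Lp.toTemperedDistribution (E f) = adjointRestriction f) {f : ℕ → Lp ℂ 2 μ} :
    IsExtremizingSeq 4 μ f ↔
      (∀ n, ‖f n‖ ≤ 1) ∧ Tendsto (fun n => ‖E (f n)‖) atTop (𝓝 ‖E‖) := by
  rw [IsExtremizingSeq, bestConst_eq_opNorm hE]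
  have h : ∀ n, distLpNorm 4 (adjointRestriction (f n)) = ENNReal.ofReal ‖E (f n)‖ := fun n => by
    rw [distLpNorm_eq (hE _), ofReal_norm]
  simp only [h]
  refine and_congr_right fun _ => ⟨fun h1 => ?_, fun h1 => ENNReal.tendsto_ofReal h1⟩
  have h2 := (ENNReal.tendsto_toReal ENNReal.ofReal_ne_top).comp h1
  simpa [Function.comp_def, ENNReal.toReal_ofReal] using h2

theorem exists_clm_of_bound {B : Lp ℂ 2 μ → Lp ℂ 4 (volume : Measure (Spacetime d))}
    (hB : ∀ f, Lp.toTemperedDistribution (B f) = adjointRestriction f) (C : ℝ)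
    (h : ∀ f, ‖B f‖ ≤ C * ‖f‖) :
    ∃ E : Lp ℂ 2 μ →L[ℂ] Lp ℂ 4 (volume : Measure (Spacetime d)), ∀ f, E f = B f := by
  refine ⟨LinearMap.mkContinuous
    { toFun := B
      map_add' := fun f g => toTemperedDistribution_injective 4 ?_
      map_smul' := fun c f => toTemperedDistribution_injective 4 ?_ } C h, fun f => rfl⟩
  · have := map_add (Lp.toTemperedDistributionCLM ℂ (volume : Measure (Spacetime d)) 4)
      (B f) (B g)
    simp only [Lp.toTemperedDistributionCLM_apply] at this
    rw [this, hB, hB, hB, adjointRestriction_add]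
  · have := map_smul (Lp.toTemperedDistributionCLM ℂ (volume : Measure (Spacetime d)) 4) c (B f)
    simp only [Lp.toTemperedDistributionCLM_apply] at this
    rw [RingHom.id_apply, this, hB, hB, adjointRestriction_smul]

end OpNorm

/-! ### Functions on the two-sheeted hyperboloid -/

theorem coeFn_plusPart {s : ℝ} (f : Lp ℂ 2 (sigmaBar d s)) :
    plusPart f =ᵐ[sigmaPlus d s] f :=
  MemLp.coeFn_toLp _

theorem coeFn_minusPart {s : ℝ} (f : Lp ℂ 2 (sigmaBar d s)) :
    minusPart f =ᵐ[sigmaMinus d s] f :=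
  MemLp.coeFn_toLp _

theorem norm_sq_eq_add {s : ℝ} (f : Lp ℂ 2 (sigmaBar d s)) :
    ‖f‖ ^ 2 = ‖plusPart f‖ ^ 2 + ‖minusPart f‖ ^ 2 := by
  have h : ‖f‖ₑ ^ 2 = ‖plusPart f‖ₑ ^ 2 + ‖minusPart f‖ₑ ^ 2 := by
    rw [enorm_two_pow, enorm_two_pow, enorm_two_pow]
    refine (lintegral_add_measure (fun z => ‖f z‖ₑ ^ 2) (sigmaPlus d s) (sigmaMinus d s)).trans ?_
    congr 1 <;> refine lintegral_congr_ae ?_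
    · filter_upwards [coeFn_plusPart f] with z hz
      rw [hz]
    · filter_upwards [coeFn_minusPart f] with z hz
      rw [hz]
  rw [← ofReal_norm, ← ofReal_norm, ← ofReal_norm, ← ENNReal.ofReal_pow (norm_nonneg _),
    ← ENNReal.ofReal_pow (norm_nonneg _), ← ENNReal.ofReal_pow (norm_nonneg _),
    ← ENNReal.ofReal_add (by positivity) (by positivity),
    ENNReal.ofReal_eq_ofReal_iff (by positivity) (by positivity)] at h
  exact h

/-- The sheets lie on opposite sides of `τ = 0`, so the components can be prescribed independently.
-/
theorem exists_parts_eq {s : ℝ} (hs : 0 < s) (g : Lp ℂ 2 (sigmaPlus d s))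
    (h : Lp ℂ 2 (sigmaMinus d s)) :
    ∃ f : Lp ℂ 2 (sigmaBar d s), plusPart f = g ∧ minusPart f = h := by
  have hm := measurable_snd_spacetime d
  have hS : MeasurableSet {ζ : Spacetime d | 0 < ζ.snd} := measurableSet_lt measurable_const hm
  have hS' : MeasurableSet {ζ : Spacetime d | ¬ 0 < ζ.snd} := hS.compl
  set F : Spacetime d → ℂ := {ζ : Spacetime d | 0 < ζ.snd}.piecewise g h with hF
  have hg : F =ᵐ[sigmaPlus d s] g := by
    filter_upwards [ae_sigmaPlus hS fun y => psi_pos d hs y] with ζ hζ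
    exact Set.piecewise_eq_of_mem _ _ _ hζ
  have hh : F =ᵐ[sigmaMinus d s] h := by
    filter_upwards [ae_sigmaMinus hS' fun y =>
      not_lt.2 (neg_nonpos.2 (psi_pos d hs y).le)] with ζ hζ
    exact Set.piecewise_eq_of_notMem _ _ _ hζ
  have hFm : StronglyMeasurable F :=
    (Lp.stronglyMeasurable g).piecewise hS (Lp.stronglyMeasurable h)
  have hFp : MemLp F 2 (sigmaBar d s) := by
    rw [memLp_two_iff_integrable_sq_norm hFm.aestronglyMeasurable, sigmaBar]
    exact (((memLp_congr_ae hg).2 (Lp.memLp g)).integrable_norm_pow two_ne_zero).add_measure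
      (((memLp_congr_ae hh).2 (Lp.memLp h)).integrable_norm_pow two_ne_zero)
  refine ⟨hFp.toLp, Lp.ext ?_, Lp.ext ?_⟩
  · exact (coeFn_plusPart _).trans (EventuallyEq.trans
      (ae_mono (Measure.le_add_right le_rfl : sigmaPlus d s ≤ sigmaBar d s) hFp.coeFn_toLp) hg)
  · exact (coeFn_minusPart _).trans (EventuallyEq.trans
      (ae_mono (Measure.le_add_left le_rfl : sigmaMinus d s ≤ sigmaBar d s) hFp.coeFn_toLp) hh)

/-! ### The two extension operators together -/

section TwoSheets

variable {s : ℝ} [hs : Fact (0 < s)]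
  {E : Lp ℂ 2 (sigmaPlus d s) →L[ℂ] Lp ℂ 4 (volume : Measure (Spacetime d))}
  {E' : Lp ℂ 2 (sigmaMinus d s) →L[ℂ] Lp ℂ 4 (volume : Measure (Spacetime d))}

theorem opNorm_sigmaMinus_eq (hd : d = 2 ∨ d = 3)
    (hE : ∀ f, Lp.toTemperedDistribution (E f) = adjointRestriction f)
    (hE' : ∀ f, Lp.toTemperedDistribution (E' f) = adjointRestriction f) : ‖E'‖ = ‖E‖ := by
  refine le_antisymm (E'.opNorm_le_bound (norm_nonneg _) fun f => ?_)
    (E.opNorm_le_bound (norm_nonneg _) fun f => ?_)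
  · have h1 := extension_reflect (measurePreserving_neg_sigmaPlus d s) hE' hE
      (fun f hf => (oscIntegral_sigmaMinus_bound hd hs.out hf).1) f
    have h2 := E.le_opNorm (reflect (measurePreserving_neg_sigmaPlus d s) f)
    have h3 := norm_reflect (measurePreserving_neg_sigmaPlus d s) f
    have h4 := (congrArg norm h1).trans (norm_conjLp (E' f))
    exact h4.symm.trans_le (h2.trans_eq (congrArg (‖E‖ * ·) h3))
  · have h1 := extension_reflect (measurePreserving_neg_sigmaMinus d s) hE hE'
      (fun f hf => (oscIntegral_sigmaPlus_bound hd hs.out hf).1) f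
    have h2 := E'.le_opNorm (reflect (measurePreserving_neg_sigmaMinus d s) f)
    have h3 := norm_reflect (measurePreserving_neg_sigmaMinus d s) f
    have h4 := (congrArg norm h1).trans (norm_conjLp (E f))
    exact h4.symm.trans_le (h2.trans_eq (congrArg (‖E'‖ * ·) h3))

theorem sheetBound_le_opNorm (hd : d = 2 ∨ d = 3)
    (hE : ∀ f, Lp.toTemperedDistribution (E f) = adjointRestriction f) :
    sheetBound d s ≤ ‖E‖ ^ 4 := by
  refine sheetBound_le hd hE fun f => ?_
  have h := pow_le_pow_left₀ (norm_nonneg _) (E.le_opNorm f) 4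
  rwa [mul_pow] at h

theorem opNorm_sigmaPlus_pos (hd : d = 2 ∨ d = 3)
    (hE : ∀ f, Lp.toTemperedDistribution (E f) = adjointRestriction f) : 0 < ‖E‖ := by
  have h := (sheetBound_pos hd hs.out).trans_le (sheetBound_le_opNorm hd hE)
  by_contra h0
  have : ‖E‖ = 0 := le_antisymm (not_lt.1 h0) (norm_nonneg _)
  simp [this] at h

theorem not_isExtremizer_sigmaPlus (hd : d = 2 ∨ d = 3)
    (hE : ∀ f, Lp.toTemperedDistribution (E f) = adjointRestriction f)
    (f : Lp ℂ 2 (sigmaPlus d s)) : ¬ IsExtremizer 4 (sigmaPlus d s) f := by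
  rw [isExtremizer_iff hE]
  rintro ⟨hf, h⟩
  have h1 := extension_sigmaPlus_four_lt hd hE hf
  rw [← ofReal_norm, ← ofReal_norm, ← ENNReal.ofReal_pow (norm_nonneg _),
    ← ENNReal.ofReal_pow (norm_nonneg _), ← ENNReal.ofReal_mul (sheetBound_pos hd hs.out).le,
    ENNReal.ofReal_lt_ofReal_iff_of_nonneg (by positivity), h, mul_pow] at h1
  have h2 := mul_le_mul_of_nonneg_right (sheetBound_le_opNorm hd hE) (pow_nonneg (norm_nonneg f) 4)
  linarith

/-- Hölder for the cross term. The square of the difference is kept, since equality and convergence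
of the components are read off from it. -/
theorem norm_add_four_le (hd : d = 2 ∨ d = 3)
    (hE : ∀ f, Lp.toTemperedDistribution (E f) = adjointRestriction f)
    (hE' : ∀ f, Lp.toTemperedDistribution (E' f) = adjointRestriction f)
    (f : Lp ℂ 2 (sigmaPlus d s)) (g : Lp ℂ 2 (sigmaMinus d s)) :
    ‖E f + E' g‖ ^ 4 ≤ 3 / 2 * (‖E f‖ ^ 2 + ‖E' g‖ ^ 2) ^ 2 -
      1 / 2 * (‖E f‖ ^ 2 - ‖E' g‖ ^ 2) ^ 2 := by
  have h1 := norm_add_four hd hE hE' f g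
  have h2 := norm_mulFour_le (E f) (E' g)
  have h3 := norm_nonneg (mulFour d (E f) (E' g))
  have key : ∀ a b c m : ℝ, c ^ 4 = a ^ 4 + b ^ 4 + 4 * m ^ 2 → m ≤ a * b → 0 ≤ m →
      c ^ 4 ≤ 3 / 2 * (a ^ 2 + b ^ 2) ^ 2 - 1 / 2 * (a ^ 2 - b ^ 2) ^ 2 := by
    intro a b c m h h' h0
    have := pow_le_pow_left₀ h0 h' 2
    nlinarith
  exact key _ _ _ _ h1 h2 h3

/-- The lower extension is the conjugate of the upper one, so the cross term is `4‖F²‖₂² = 4‖F‖₄⁴`,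
and `1 + 1 + 4 = 6`. -/
theorem norm_add_reflect_four (hd : d = 2 ∨ d = 3)
    (hE : ∀ f, Lp.toTemperedDistribution (E f) = adjointRestriction f)
    (hE' : ∀ f, Lp.toTemperedDistribution (E' f) = adjointRestriction f)
    (f : Lp ℂ 2 (sigmaPlus d s)) :
    ‖E f + E' (reflect (measurePreserving_neg_sigmaMinus d s) f)‖ ^ 4 = 6 * ‖E f‖ ^ 4 := by
  have h1 := extension_reflect (measurePreserving_neg_sigmaMinus d s) hE hE'
    (fun f hf => (oscIntegral_sigmaPlus_bound hd hs.out hf).1) f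
  have h2 := norm_add_four hd hE hE' f (reflect (measurePreserving_neg_sigmaMinus d s) f)
  have h3 := (congrArg norm h1).trans (norm_conjLp (E f))
  have h4 := (congrArg (fun G => ‖mulFour d (E f) G‖) h1).trans (norm_mulFour_conj (E f))
  have key : ∀ a b c m : ℝ, c ^ 4 = a ^ 4 + b ^ 4 + 4 * m ^ 2 → b = a → m = a ^ 2 →
      c ^ 4 = 6 * a ^ 4 := by
    intro a b c m h hb hm
    rw [h, hb, hm]; ring
  exact key _ _ _ _ h2 h3 h4

theorem exists_extension_sigmaBar
    (hE : ∀ f, Lp.toTemperedDistribution (E f) = adjointRestriction f)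
    (hE' : ∀ f, Lp.toTemperedDistribution (E' f) = adjointRestriction f) :
    ∃ B : Lp ℂ 2 (sigmaBar d s) →L[ℂ] Lp ℂ 4 (volume : Measure (Spacetime d)),
      (∀ f, B f = E (plusPart f) + E' (minusPart f)) ∧
        ∀ f, Lp.toTemperedDistribution (B f) = adjointRestriction f := by
  have hB : ∀ f : Lp ℂ 2 (sigmaBar d s),
      Lp.toTemperedDistribution (E (plusPart f) + E' (minusPart f)) = adjointRestriction f := by
    intro f
    have := map_add (Lp.toTemperedDistributionCLM ℂ (volume : Measure (Spacetime d)) 4)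
      (E (plusPart f)) (E' (minusPart f))
    simp only [Lp.toTemperedDistributionCLM_apply] at this
    rw [this, hE, hE', adjointRestriction_sigmaBar]
  obtain ⟨B, h⟩ := exists_clm_of_bound hB (‖E‖ + ‖E'‖) fun f => by
    have h1 := norm_sq_eq_add f
    have hp : ‖plusPart f‖ ≤ ‖f‖ := by
      refine le_of_sq_le_sq ?_ (norm_nonneg _)
      linarith [sq_nonneg ‖minusPart f‖]
    have hq : ‖minusPart f‖ ≤ ‖f‖ := by
      refine le_of_sq_le_sq ?_ (norm_nonneg _)
      linarith [sq_nonneg ‖plusPart f‖]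
    rw [add_mul]
    refine (norm_add_le _ _).trans (add_le_add ?_ ?_)
    · exact (E.le_opNorm _).trans (by gcongr)
    · exact (E'.le_opNorm _).trans (by gcongr)
  exact ⟨B, h, fun f => by rw [h, hB]⟩

end TwoSheets

/-! ### Real inequalities for the norms of the two components -/

theorem four_le_of_components {H x y p q N c : ℝ} (hx0 : 0 ≤ x) (hy0 : 0 ≤ y) (hx : x ≤ H * p)
    (hy : y ≤ H * q) (hN : N ^ 2 = p ^ 2 + q ^ 2)
    (hc : c ^ 4 ≤ 3 / 2 * (x ^ 2 + y ^ 2) ^ 2 - 1 / 2 * (x ^ 2 - y ^ 2) ^ 2) :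
    c ^ 4 ≤ 3 / 2 * H ^ 4 * N ^ 4 := by
  have h1 := pow_le_pow_left₀ hx0 hx 2
  have h2 := pow_le_pow_left₀ hy0 hy 2
  have h3 : x ^ 2 + y ^ 2 ≤ H ^ 2 * N ^ 2 := by rw [hN]; nlinarith
  have h4 := pow_le_pow_left₀ (by positivity) h3 2
  nlinarith [sq_nonneg (x ^ 2 - y ^ 2)]

/-- Equality leaves no room for `(x² - y²)²` nor for slack in `x² + y² ≤ H²N²`. Hence `x = y`, both
one-sheet bounds are sharp, and `p = q`; then `N ≠ 0` makes both nonzero. -/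
theorem components_eq_of_four_eq {H x y p q N c : ℝ} (hH : 0 < H) (hx0 : 0 ≤ x) (hy0 : 0 ≤ y)
    (hp : 0 ≤ p) (hq : 0 ≤ q) (hx : x ≤ H * p)
    (hy : y ≤ H * q) (hN : N ^ 2 = p ^ 2 + q ^ 2) (hN0 : N ≠ 0)
    (hc : c ^ 4 ≤ 3 / 2 * (x ^ 2 + y ^ 2) ^ 2 - 1 / 2 * (x ^ 2 - y ^ 2) ^ 2)
    (heq : c ^ 4 = 3 / 2 * H ^ 4 * N ^ 4) :
    p ≠ 0 ∧ q ≠ 0 ∧ x = H * p ∧ y = H * q := by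
  have h1 := pow_le_pow_left₀ hx0 hx 2
  have h2 := pow_le_pow_left₀ hy0 hy 2
  have h3 : x ^ 2 + y ^ 2 ≤ H ^ 2 * N ^ 2 := by rw [hN]; nlinarith
  have h4 := pow_le_pow_left₀ (by positivity) h3 2
  have h5 : (x ^ 2 - y ^ 2) ^ 2 = 0 := le_antisymm (by nlinarith) (sq_nonneg _)
  have h6 : (H ^ 2 * N ^ 2) ^ 2 ≤ (x ^ 2 + y ^ 2) ^ 2 := by nlinarith
  have h7 : H ^ 2 * N ^ 2 ≤ x ^ 2 + y ^ 2 := le_of_sq_le_sq h6 (by positivity)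
  have h8 : x ^ 2 = y ^ 2 := by have := pow_eq_zero_iff two_ne_zero |>.1 h5; linarith
  rw [hN] at h7
  have h9 : x ^ 2 = (H * p) ^ 2 := by nlinarith
  have h10 : y ^ 2 = (H * q) ^ 2 := by nlinarith
  have e1 : x = H * p := (sq_eq_sq₀ hx0 (by positivity)).1 h9
  have e2 : y = H * q := (sq_eq_sq₀ hy0 (by positivity)).1 h10
  have e3 : p = q := by
    have : x = y := (sq_eq_sq₀ hx0 hy0).1 h8
    rw [e1, e2] at this
    exact mul_left_cancel₀ hH.ne' this
  have hp0 : p ≠ 0 := by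
    rintro rfl
    rw [← e3] at hN
    refine hN0 (pow_eq_zero_iff two_ne_zero |>.1 (by rw [hN]; ring))
  exact ⟨hp0, e3 ▸ hp0, e1, e2⟩

/-- The equality case in the limit: `x² + y² → H²` and `x² - y² → 0`, so each square tends to
`H²/2`; then `p²` is squeezed between `x²/H²` and `1 - y²/H²`. -/
theorem tendsto_components {H : ℝ} {x y p q c : ℕ → ℝ} (hH : 0 < H) (hx0 : ∀ n, 0 ≤ x n)
    (hy0 : ∀ n, 0 ≤ y n) (hx : ∀ n, x n ≤ H * p n) (hy : ∀ n, y n ≤ H * q n)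
    (hN : ∀ n, p n ^ 2 + q n ^ 2 ≤ 1)
    (hc : ∀ n, c n ^ 4 ≤ 3 / 2 * (x n ^ 2 + y n ^ 2) ^ 2 - 1 / 2 * (x n ^ 2 - y n ^ 2) ^ 2)
    (hlim : Tendsto (fun n => c n ^ 4) atTop (𝓝 (3 / 2 * H ^ 4))) :
    Tendsto (fun n => x n ^ 2) atTop (𝓝 (H ^ 2 / 2)) ∧
      Tendsto (fun n => p n ^ 2) atTop (𝓝 (1 / 2)) := by
  have h1 := fun n => pow_le_pow_left₀ (hx0 n) (hx n) 2
  have h2 := fun n => pow_le_pow_left₀ (hy0 n) (hy n) 2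
  have h3 : ∀ n, x n ^ 2 + y n ^ 2 ≤ H ^ 2 := fun n => by nlinarith [h1 n, h2 n, hN n, sq_nonneg H]
  have h4 : ∀ n, (x n ^ 2 + y n ^ 2) ^ 2 ≤ H ^ 4 := fun n => by
    have := pow_le_pow_left₀ (by positivity) (h3 n) 2
    nlinarith
  have hS2 : Tendsto (fun n => (x n ^ 2 + y n ^ 2) ^ 2) atTop (𝓝 (H ^ 4)) := by
    refine tendsto_of_tendsto_of_tendsto_of_le_of_le (g := fun n => 2 / 3 * c n ^ 4) ?_
      tendsto_const_nhds (fun n => ?_) h4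
    · convert hlim.const_mul (2 / 3) using 2; ring
    · nlinarith [hc n, sq_nonneg (x n ^ 2 - y n ^ 2)]
  have hD2 : Tendsto (fun n => (x n ^ 2 - y n ^ 2) ^ 2) atTop (𝓝 0) := by
    refine tendsto_of_tendsto_of_tendsto_of_le_of_le (h := fun n => 3 * H ^ 4 - 2 * c n ^ 4)
      tendsto_const_nhds ?_ (fun n => sq_nonneg _) (fun n => ?_)
    · convert (hlim.const_mul 2).const_sub (3 * H ^ 4) using 2; ring
    · nlinarith [hc n, h4 n]
  have hS : Tendsto (fun n => x n ^ 2 + y n ^ 2) atTop (𝓝 (H ^ 2)) := by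
    have := hS2.sqrt
    rw [show H ^ 4 = (H ^ 2) ^ 2 by ring, Real.sqrt_sq (by positivity)] at this
    exact this.congr fun n => Real.sqrt_sq (by positivity)
  have hD : Tendsto (fun n => x n ^ 2 - y n ^ 2) atTop (𝓝 0) := by
    have := hD2.sqrt
    simp only [Real.sqrt_sq_eq_abs, Real.sqrt_zero] at this
    exact (tendsto_zero_iff_abs_tendsto_zero _).2 this
  have hX : Tendsto (fun n => x n ^ 2) atTop (𝓝 (H ^ 2 / 2)) := by
    have := (hS.add hD).div_const 2
    rw [add_zero] at this
    exact this.congr fun n => by ring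
  have hY : Tendsto (fun n => y n ^ 2) atTop (𝓝 (H ^ 2 / 2)) := by
    have := (hS.sub hD).div_const 2
    rw [sub_zero] at this
    exact this.congr fun n => by ring
  have hH2 : 0 < H ^ 2 := by positivity
  refine ⟨hX, tendsto_of_tendsto_of_tendsto_of_le_of_le (g := fun n => x n ^ 2 / H ^ 2)
    (h := fun n => 1 - y n ^ 2 / H ^ 2) ?_ ?_ (fun n => ?_) (fun n => ?_)⟩
  · convert hX.div_const (H ^ 2) using 2; field_simp
  · convert (hY.div_const (H ^ 2)).const_sub 1 using 2; field_simp; norm_num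
  · simp only
    rw [div_le_iff₀ hH2]
    nlinarith [h1 n]
  · have : y n ^ 2 / H ^ 2 ≤ q n ^ 2 := by
      rw [div_le_iff₀ hH2]; nlinarith [h2 n]
    simp only
    linarith [hN n]

theorem tendsto_ratio {H : ℝ} {x p : ℕ → ℝ} (hH : 0 < H) (hx0 : ∀ n, 0 ≤ x n)
    (hp0 : ∀ n, 0 ≤ p n) (hx : Tendsto (fun n => x n ^ 2) atTop (𝓝 (H ^ 2 / 2)))
    (hp : Tendsto (fun n => p n ^ 2) atTop (𝓝 (1 / 2))) :
    Tendsto (fun n => (p n)⁻¹ * x n) atTop (𝓝 H) := by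
  have h := (hx.div hp (by norm_num)).sqrt
  rw [show H ^ 2 / 2 / (1 / 2) = H ^ 2 by ring, Real.sqrt_sq hH.le] at h
  refine h.congr fun n => ?_
  rw [Pi.div_apply, ← div_pow, Real.sqrt_sq (div_nonneg (hx0 n) (hp0 n)), div_eq_inv_mul]

/-! ### Normalized components -/

theorem isExtremizingSeq_normalize {μ : Measure (Spacetime d)} [μ.HasTemperateGrowth]
    {E : Lp ℂ 2 μ →L[ℂ] Lp ℂ 4 (volume : Measure (Spacetime d))}
    (hE : ∀ f, Lp.toTemperedDistribution (E f) = adjointRestriction f) {f : ℕ → Lp ℂ 2 μ}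
    (hE0 : 0 < ‖E‖) (hx : Tendsto (fun n => ‖E (f n)‖ ^ 2) atTop (𝓝 (‖E‖ ^ 2 / 2)))
    (hp : Tendsto (fun n => ‖f n‖ ^ 2) atTop (𝓝 (1 / 2))) :
    (∀ᶠ n in atTop, f n ≠ 0) ∧ IsExtremizingSeq 4 μ (fun n => ‖f n‖⁻¹ • f n) := by
  constructor
  · filter_upwards [hp.eventually (lt_mem_nhds (show (0 : ℝ) < 1 / 2 by norm_num))] with n hn h0
    simp [h0] at hn
  refine (isExtremizingSeq_iff hE).2 ⟨fun n => ?_, ?_⟩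
  · have h1 := norm_smul (‖f n‖⁻¹) (f n)
    rw [h1, norm_inv, norm_norm]
    exact inv_mul_le_one
  · refine (tendsto_ratio hE0 (fun n => norm_nonneg _) (fun n => norm_nonneg _) hx hp).congr
      fun n => ?_
    have h1 : E (‖f n‖⁻¹ • f n) = ‖f n‖⁻¹ • E (f n) := E.map_smul_of_tower _ _
    have h2 := norm_smul (‖f n‖⁻¹) (E (f n))
    rw [norm_inv, norm_norm] at h2
    exact h2.symm.trans (congrArg norm h1).symm

/-! ### The constant of the two-sheeted hyperboloid -/

section TwoSheetConstant

variable {s : ℝ} [hs : Fact (0 < s)]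
  {E : Lp ℂ 2 (sigmaPlus d s) →L[ℂ] Lp ℂ 4 (volume : Measure (Spacetime d))}
  {E' : Lp ℂ 2 (sigmaMinus d s) →L[ℂ] Lp ℂ 4 (volume : Measure (Spacetime d))}
  {B : Lp ℂ 2 (sigmaBar d s) →L[ℂ] Lp ℂ 4 (volume : Measure (Spacetime d))}

theorem norm_sigmaBar_four_le (hd : d = 2 ∨ d = 3)
    (hE : ∀ f, Lp.toTemperedDistribution (E f) = adjointRestriction f)
    (hE' : ∀ f, Lp.toTemperedDistribution (E' f) = adjointRestriction f)
    (hB : ∀ f, B f = E (plusPart f) + E' (minusPart f)) (f : Lp ℂ 2 (sigmaBar d s)) :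
    ‖B f‖ ^ 4 ≤ 3 / 2 * (‖E (plusPart f)‖ ^ 2 + ‖E' (minusPart f)‖ ^ 2) ^ 2 -
      1 / 2 * (‖E (plusPart f)‖ ^ 2 - ‖E' (minusPart f)‖ ^ 2) ^ 2 :=
  (congrArg (fun G => ‖G‖ ^ 4) (hB f)).trans_le (norm_add_four_le hd hE hE' _ _)

theorem norm_sigmaBar_four_le_opNorm (hd : d = 2 ∨ d = 3)
    (hE : ∀ f, Lp.toTemperedDistribution (E f) = adjointRestriction f)
    (hE' : ∀ f, Lp.toTemperedDistribution (E' f) = adjointRestriction f)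
    (hB : ∀ f, B f = E (plusPart f) + E' (minusPart f)) (f : Lp ℂ 2 (sigmaBar d s)) :
    ‖B f‖ ^ 4 ≤ 3 / 2 * ‖E‖ ^ 4 * ‖f‖ ^ 4 :=
  four_le_of_components (norm_nonneg _) (norm_nonneg _) (E.le_opNorm _)
    ((E'.le_opNorm _).trans_eq (congrArg (· * _) (opNorm_sigmaMinus_eq hd hE hE')))
    (norm_sq_eq_add f) (norm_sigmaBar_four_le hd hE hE' hB f)

/-- For the lower bound, glue `g` to its reflection: the squared norm doubles while the fourth power
of the extension norm is multiplied by `6`, and `6/2² = 3/2`. -/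
theorem opNorm_sigmaBar_four (hd : d = 2 ∨ d = 3)
    (hE : ∀ f, Lp.toTemperedDistribution (E f) = adjointRestriction f)
    (hE' : ∀ f, Lp.toTemperedDistribution (E' f) = adjointRestriction f)
    (hB : ∀ f, B f = E (plusPart f) + E' (minusPart f)) :
    ‖B‖ ^ 4 = 3 / 2 * ‖E‖ ^ 4 := by
  have root : ∀ K : ℝ, 0 ≤ K → ∃ r : ℝ, 0 ≤ r ∧ r ^ 4 = K := fun K hK =>
    ⟨Real.sqrt (Real.sqrt K), Real.sqrt_nonneg _, by
      rw [show (4 : ℕ) = 2 * 2 by norm_num, pow_mul, Real.sq_sqrt (Real.sqrt_nonneg _),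
        Real.sq_sqrt hK]⟩
  have h0 : (0 : ℝ) ≤ ‖E‖ := norm_nonneg _
  have h0' : (0 : ℝ) ≤ ‖B‖ := norm_nonneg _
  refine le_antisymm ?_ ?_
  · obtain ⟨r, hr0, hr⟩ := root (3 / 2 * ‖E‖ ^ 4) (by positivity)
    rw [← hr]
    refine pow_le_pow_left₀ h0' (B.opNorm_le_bound hr0 fun f => ?_) 4
    refine (pow_le_pow_iff_left₀ (norm_nonneg _) (by positivity) four_ne_zero).1 ?_
    rw [mul_pow, hr]
    exact norm_sigmaBar_four_le_opNorm hd hE hE' hB f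
  · obtain ⟨r, hr0, hr⟩ := root (2 / 3 * ‖B‖ ^ 4) (by positivity)
    suffices h : ‖E‖ ≤ r by
      have := pow_le_pow_left₀ h0 h 4
      linarith
    refine E.opNorm_le_bound hr0 fun g => ?_
    refine (pow_le_pow_iff_left₀ (norm_nonneg _) (by positivity) four_ne_zero).1 ?_
    rw [mul_pow, hr]
    obtain ⟨f, hf1, hf2⟩ := exists_parts_eq hs.out g
      (reflect (measurePreserving_neg_sigmaMinus d s) g)
    have e1 := norm_sq_eq_add f
    rw [hf1, hf2, norm_reflect] at e1
    have e2 := norm_add_reflect_four hd hE hE' g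
    have e3 : B f = E g + E' (reflect (measurePreserving_neg_sigmaMinus d s) g) := by
      rw [hB, hf1, hf2]
    have e4 := pow_le_pow_left₀ (norm_nonneg _) (B.le_opNorm f) 4
    have e5 := (congrArg (fun G => ‖G‖ ^ 4) e3).trans e2
    have key : ∀ b x p N H : ℝ, b ^ 4 = 6 * x ^ 4 → b ^ 4 ≤ (H * N) ^ 4 →
        N ^ 2 = p ^ 2 + p ^ 2 → x ^ 4 ≤ 2 / 3 * H ^ 4 * p ^ 4 := by
      intro b x p N H h h' hN
      have : (H * N) ^ 4 = H ^ 4 * (N ^ 2) ^ 2 := by ring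
      rw [h, this, hN] at h'
      linarith
    exact key _ _ _ _ _ e5 e4 e1

theorem norm_sq_components_tendsto (hd : d = 2 ∨ d = 3)
    (hE : ∀ f, Lp.toTemperedDistribution (E f) = adjointRestriction f)
    (hE' : ∀ f, Lp.toTemperedDistribution (E' f) = adjointRestriction f)
    (hB : ∀ f, B f = E (plusPart f) + E' (minusPart f)) {f : ℕ → Lp ℂ 2 (sigmaBar d s)}
    (hf : ∀ n, ‖f n‖ ≤ 1) (hlim : Tendsto (fun n => ‖B (f n)‖) atTop (𝓝 ‖B‖)) :
    (Tendsto (fun n => ‖E (plusPart (f n))‖ ^ 2) atTop (𝓝 (‖E‖ ^ 2 / 2)) ∧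
      Tendsto (fun n => ‖plusPart (f n)‖ ^ 2) atTop (𝓝 (1 / 2))) ∧
    (Tendsto (fun n => ‖E' (minusPart (f n))‖ ^ 2) atTop (𝓝 (‖E'‖ ^ 2 / 2)) ∧
      Tendsto (fun n => ‖minusPart (f n)‖ ^ 2) atTop (𝓝 (1 / 2))) := by
  have hH := opNorm_sigmaPlus_pos hd hE
  have hEE := opNorm_sigmaMinus_eq hd hE hE'
  have hx := fun n => E.le_opNorm (plusPart (f n))
  have hy := fun n => (E'.le_opNorm (minusPart (f n))).trans_eq (congrArg (· * _) hEE)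
  have hN : ∀ n, ‖plusPart (f n)‖ ^ 2 + ‖minusPart (f n)‖ ^ 2 ≤ 1 := fun n =>
    (norm_sq_eq_add (f n)).symm.trans_le (pow_le_one₀ (norm_nonneg _) (hf n))
  have hc := fun n => norm_sigmaBar_four_le hd hE hE' hB (f n)
  have hl : Tendsto (fun n => ‖B (f n)‖ ^ 4) atTop (𝓝 (3 / 2 * ‖E‖ ^ 4)) :=
    opNorm_sigmaBar_four hd hE hE' hB ▸ hlim.pow 4
  refine ⟨tendsto_components hH (fun n => norm_nonneg _) (fun n => norm_nonneg _) hx hy hN hc hl,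
    ?_⟩
  rw [hEE]
  refine tendsto_components hH (fun n => norm_nonneg _) (fun n => norm_nonneg _) hy hx
    (fun n => (add_comm _ _).trans_le (hN n)) (fun n => (hc n).trans_eq (by ring)) hl

theorem isExtremizer_components (hd : d = 2 ∨ d = 3)
    (hE : ∀ f, Lp.toTemperedDistribution (E f) = adjointRestriction f)
    (hE' : ∀ f, Lp.toTemperedDistribution (E' f) = adjointRestriction f)
    (hB : ∀ f, B f = E (plusPart f) + E' (minusPart f)) {f : Lp ℂ 2 (sigmaBar d s)}
    (hf : f ≠ 0) (heq : ‖B f‖ ^ 4 = 3 / 2 * ‖E‖ ^ 4 * ‖f‖ ^ 4) :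
    IsExtremizer 4 (sigmaPlus d s) (plusPart f) ∧
      IsExtremizer 4 (sigmaMinus d s) (minusPart f) := by
  have hEE := opNorm_sigmaMinus_eq hd hE hE'
  obtain ⟨h1, h2, h3, h4⟩ := components_eq_of_four_eq (opNorm_sigmaPlus_pos hd hE)
    (norm_nonneg _) (norm_nonneg _) (norm_nonneg _) (norm_nonneg _) (E.le_opNorm (plusPart f))
    ((E'.le_opNorm (minusPart f)).trans_eq (congrArg (· * _) hEE)) (norm_sq_eq_add f)
    (norm_ne_zero_iff.2 hf) (norm_sigmaBar_four_le hd hE hE' hB f) heq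
  exact ⟨(isExtremizer_iff hE).2 ⟨norm_ne_zero_iff.1 h1, h3⟩,
    (isExtremizer_iff hE').2 ⟨norm_ne_zero_iff.1 h2, h4.trans (congrArg (· * _) hEE.symm)⟩⟩

end TwoSheetConstant

end Hyperboloid

end

open Hyperboloid
theorem mainTheorem6 (d : ℕ) (hd : d = 2 ∨ d = 3) (s : ℝ) [Fact (0 < s)] :
    -- the one-sheet constants are finite, and they agree for the two sheets
    bestConst 4 (sigmaPlus d s) ≠ ∞ ∧
    bestConst 4 (sigmaMinus d s) = bestConst 4 (sigmaPlus d s) ∧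
    -- the sharp inequality on the two-sheeted hyperboloid
    (∀ f : Lp ℂ 2 (sigmaBar d s),
      distLpNorm 4 (adjointRestriction f) ^ 4 ≤
        3 / 2 * bestConst 4 (sigmaPlus d s) ^ 4 * ‖f‖ₑ ^ 4) ∧
    -- equality forces both components to be extremizers
    (∀ f : Lp ℂ 2 (sigmaBar d s), f ≠ 0 →
      distLpNorm 4 (adjointRestriction f) ^ 4 =
        3 / 2 * bestConst 4 (sigmaPlus d s) ^ 4 * ‖f‖ₑ ^ 4 →
      IsExtremizer 4 (sigmaPlus d s) (plusPart f) ∧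
        IsExtremizer 4 (sigmaMinus d s) (minusPart f)) ∧
    -- extremizing sequences split
    (∀ f : ℕ → Lp ℂ 2 (sigmaBar d s), IsExtremizingSeq 4 (sigmaBar d s) f →
      (∀ᶠ n in atTop, plusPart (f n) ≠ 0 ∧ minusPart (f n) ≠ 0) ∧
      IsExtremizingSeq 4 (sigmaPlus d s) (fun n => ‖plusPart (f n)‖⁻¹ • plusPart (f n)) ∧
      IsExtremizingSeq 4 (sigmaMinus d s) (fun n => ‖minusPart (f n)‖⁻¹ • minusPart (f n))) ∧
    -- the two-sheeted constant
    bestConst 4 (sigmaBar d s) = (3 / 2) ^ (1 / 4 : ℝ) * bestConst 4 (sigmaPlus d s) ∧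
    -- nonexistence of extremizers
    ¬ ∃ f : Lp ℂ 2 (sigmaBar d s), IsExtremizer 4 (sigmaBar d s) f := by
  obtain ⟨E, hE⟩ := exists_extension_sigmaPlus (s := s) hd
  obtain ⟨E', hE'⟩ := exists_extension_sigmaMinus (s := s) hd
  obtain ⟨B, hB, hBr⟩ := exists_extension_sigmaBar hE hE'
  have hEE := opNorm_sigmaMinus_eq hd hE hE'
  have hBE := opNorm_sigmaBar_four hd hE hE' hB
  have hconst : ∀ f : Lp ℂ 2 (sigmaBar d s),
      3 / 2 * ENNReal.ofReal ‖E‖ ^ 4 * ‖f‖ₑ ^ 4 = ENNReal.ofReal (3 / 2 * ‖E‖ ^ 4 * ‖f‖ ^ 4) := by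
    intro f
    rw [ENNReal.ofReal_mul (by positivity), ENNReal.ofReal_mul (by positivity),
      ENNReal.ofReal_pow (norm_nonneg _), ENNReal.ofReal_pow (norm_nonneg _), ofReal_norm f,
      ENNReal.ofReal_div_of_pos two_pos, ENNReal.ofReal_ofNat, ENNReal.ofReal_ofNat]
  have hdist : ∀ f : Lp ℂ 2 (sigmaBar d s),
      distLpNorm 4 (adjointRestriction f) ^ 4 = ENNReal.ofReal (‖B f‖ ^ 4) := by
    intro f
    rw [distLpNorm_eq (hBr f), ENNReal.ofReal_pow (norm_nonneg _), ofReal_norm]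
  have hext : ∀ f : Lp ℂ 2 (sigmaBar d s), f ≠ 0 → ‖B f‖ ^ 4 = 3 / 2 * ‖E‖ ^ 4 * ‖f‖ ^ 4 →
      IsExtremizer 4 (sigmaPlus d s) (plusPart f) ∧
        IsExtremizer 4 (sigmaMinus d s) (minusPart f) :=
    fun f hf h => isExtremizer_components hd hE hE' hB hf h
  rw [bestConst_eq_opNorm hE, bestConst_eq_opNorm hE', bestConst_eq_opNorm hBr, hEE]
  refine ⟨ENNReal.ofReal_ne_top, rfl, fun f => ?_, fun f hf h => ?_, fun f hf => ?_, ?_, ?_⟩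
  · rw [hdist, hconst]
    exact ENNReal.ofReal_le_ofReal (norm_sigmaBar_four_le_opNorm hd hE hE' hB f)
  · rw [hdist, hconst, ENNReal.ofReal_eq_ofReal_iff (by positivity) (by positivity)] at h
    exact hext f hf h
  · obtain ⟨h1, h2⟩ := (isExtremizingSeq_iff hBr).1 hf
    obtain ⟨⟨h3, h4⟩, h5, h6⟩ := norm_sq_components_tendsto hd hE hE' hB h1 h2
    have hH := opNorm_sigmaPlus_pos hd hE
    have hp := isExtremizingSeq_normalize hE hH h3 h4
    have hm := isExtremizingSeq_normalize hE' (hH.trans_eq hEE.symm) h5 h6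
    exact ⟨hp.1.and hm.1, hp.2, hm.2⟩
  · have h1 : ‖B‖ = (3 / 2) ^ (1 / 4 : ℝ) * ‖E‖ := by
      refine (pow_left_inj₀ (norm_nonneg B) (by positivity) four_ne_zero).1 ?_
      rw [hBE, mul_pow, ← Real.rpow_natCast, ← Real.rpow_natCast, ← Real.rpow_mul (by norm_num)]
      norm_num
    rw [h1, ENNReal.ofReal_mul (by positivity), ← ENNReal.ofReal_rpow_of_pos (by norm_num),
      ENNReal.ofReal_div_of_pos two_pos, ENNReal.ofReal_ofNat, ENNReal.ofReal_ofNat]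
  · rintro ⟨f, hf⟩
    obtain ⟨hf0, h⟩ := (isExtremizer_iff hBr).1 hf
    -- Since `‖B‖⁴ = (3/2)‖E‖⁴`, an extremizer attains equality in the sharp inequality, and its
    -- upper component would be an extremizer for one sheet.
    refine not_isExtremizer_sigmaPlus hd hE _ (hext f hf0 ?_).1
    rw [h, mul_pow, hBE]
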